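/- Let $k$ be a field and let $R=\bigoplus_{i\ge 0}R_i$ be a commutative standard graded $k$-algebra, i.e. $R_0=k$, $\dim_k R_1=n<\infty$, and $R$ is generated by $R_1$ as a $k$-algebra. Let $x_1,\dots,x_n$ be a basis of $R_1$ and $R_+=\bigoplus_{i\ge1}R_i$. Let $K_R=R\otimes_k\wedge(T_1,\dots,T_n)$ be the Koszul complex, with $T_i$ of homological degree $1$ and internal degree $1$, and with $d$ the (graded) $R$-linear derivation such that $dT_i=x_i$. Write $H_{r,j}(K_R)$ for its homology in homological degree $r$ and internal degree $j$, $H_+(K_R)=\bigoplus_{r\ge1}H_r(K_R)$, and $$H(K_R)(z)=\sum_{r}\dim_k H_r(K_R)\,z^r,\qquad H(K_R)(x,y)=\sum_{r,j}\dim_k H_{r,j}(K_R)\,x^ry^j .$$ Suppose that $R$ is "trivially Golod": there are bihomogeneous cycles in $(K_R)_+=\bigoplus_{r\ge 1}(K_R)_r$ whose classes form a $k$-basis of $H_+(K_R)$ and such that the product of any two of them (including each with itself) is $0$. Let $C=sH_+(K_R)$, i.e. $C_{r+1,j}=H_{r,j}(K_R)$ for $r\ge1$, and let $\alpha:C\to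 K_R$ be the $k$-linear map that sends each element of the basis to its representing cycle. Let $Y=K_R\otimes_k T(C)$, where $T(C)$ is the tensor algebra, with the induced bigrading and the $R$-linear map $$d(x|c_1|c_2|\cdots|c_m)=dx|c_1|\cdots|c_m+(-1)^{|x|}x\,\alpha(c_1)|c_2|\cdots|c_m$$ for $m\ge 1$, and $d(x)=dx$ for $m=0$, where $x\in K_R$ is homogeneous of homological degree $|x|$ and $c_i\in C$. Then $(Y,d)$ is a minimal graded free resolution of $k$ over $R$: $d^2=0$, $d$ has homological degree $-1$ and preserves the internal degree, $Y$ is free over $R$ on bihomogeneous elements, $H_0(Y)=k$ (in internal degree $0$), $H_r(Y)=0$ for $r\ge1$, and $d(Y)\subseteq R_+Y$. Moreover, all the vector spaces $H_r(K_R)$, $H_{r,j}(K_R)$, $\operatorname{Tor}^R_r(k,k)$, $\operatorname{Tor}^R_{r,j}(k,k)$ are finite-dimensional, and the Poincaré series $P_R(z)=\sum_r\dim_k\operatorname{Tor}^R_r(k,k)z^r$ and $P_R(x,y)=\sum_{r,j}\dim_k\operatorname{Tor}^R_{r,j}(k,k)x^ry^j$ (where $\operatorname{Tor}^R_{r,j}(k,k)$,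 with internal degree $j$, is computed from any graded free resolution of $k$ over $R$) satisfy $$P_R(z)=\frac{(1+z)^n}{1-z\,(H(K_R)(z)-1)},\qquad P_R(x,y)=\frac{(1+xy)^n}{1-x\,(H(K_R)(x,y)-1)} .$$ -/

import Mathlib

open scoped TensorProduct

universe u

noncomputable section

namespace Golod

/-! ### Homology of graded complexes -/

section Homology

variable {k : Type u} [Field k] {M : Type u} [AddCommGroup M] [Module k M]

/-- `H_r = Z_r / B_r` for a `k`-linear `d : M → M` and a family `N` of subspaces of `M`
(the graded pieces), where `Z_r = N_r ∩ ker d` and `B_r = d (N_{r+1})`. -/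
abbrev Homology (N : ℕ → Submodule k M) (d : M →ₗ[k] M) (r : ℕ) : Type u :=
  ↥(N r ⊓ LinearMap.ker d) ⧸ ((N (r + 1)).map d).submoduleOf (N r ⊓ LinearMap.ker d)

/-- `H_{r,j}` for a bigraded complex (first degree homological, second degree internal) whose
differential has bidegree `(-1, 0)`. -/
abbrev BiHomology (N : ℕ → ℕ → Submodule k M) (d : M →ₗ[k] M) (r j : ℕ) : Type u :=
  Homology (fun s => N s j) d r

end Homology

/-! ### Generating series -/

/-- `∑ f(n) z^n`. -/
def series (f : ℕ → ℕ) : PowerSeries ℤ := PowerSeries.mk fun n => (f n : ℤ)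

/-- `∑ f(n,j) x^n y^j`, where `x` is the variable `0` and `y` is the variable `1`. -/
def biSeries (f : ℕ → ℕ → ℕ) : MvPowerSeries (Fin 2) ℤ := fun m => (f (m 0) (m 1) : ℤ)

/-! ### Standard graded algebras -/

section Graded

variable {k R : Type u} [Field k] [CommRing R] [Algebra k R]

/-- `R` is connected (`R_0 = k`, `R ≠ 0`) and generated as an algebra by the
finite-dimensional space `R_1`. -/
structure IsStandardGraded (𝒜 : ℕ → Submodule k R) [GradedAlgebra 𝒜] : Prop where
  nontrivial : Nontrivial R
  zero_eq : 𝒜 0 = 1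
  finite_one : Module.Finite k (𝒜 1)
  adjoin_one : Algebra.adjoin k (𝒜 1 : Set R) = ⊤

/-- The ideal `R_+` of elements of positive degree. -/
abbrev plusIdeal (𝒜 : ℕ → Submodule k R) [GradedAlgebra 𝒜] : Ideal R :=
  (HomogeneousIdeal.irrelevant 𝒜).toIdeal

/-- The residue field `k = R / R_+` as an `R`-module. -/
abbrev Residue (𝒜 : ℕ → Submodule k R) [GradedAlgebra 𝒜] : Type u := R ⧸ plusIdeal 𝒜

/-! ### Graded free resolutions and Tor -/

/-- `Tor_n^R(k,k)`, as a vector space over `k`. -/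
abbrev TorKK (𝒜 : ℕ → Submodule k R) [GradedAlgebra 𝒜] (n : ℕ) : Type u :=
  RestrictScalars k R
    (((CategoryTheory.Tor (ModuleCat.{u} R) n).obj (ModuleCat.of R (Residue 𝒜))).obj
      (ModuleCat.of R (Residue 𝒜)))

section Resolution

variable {M : Type u} [AddCommGroup M] [Module k M] [Module R M] [IsScalarTower k R M]

/-- `M = ⨁ M_{r,j}` with the `R`-linear differential `d` is a graded free resolution of `k` over
`R`; `r` is the homological and `j` the internal degree. -/
structure IsGradedFreeResolution (𝒜 : ℕ → Submodule k R) [GradedAlgebra 𝒜]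
    (ℳ : ℕ → ℕ → Submodule k M) (d : M →ₗ[R] M) : Prop where
  /-- `M` has an `R`-basis of bihomogeneous elements `e_b`, of bidegree `(h b, g b)`, and
  `M_{r,j}` is the direct sum of the spaces `R_p e_b` with `h b = r` and `p + g b = j`. -/
  free : ∃ (β : Type u) (e : Module.Basis β R M) (h g : β → ℕ), ∀ r j,
    ℳ r j = Submodule.span k
      {y | ∃ (b : β) (p : ℕ) (a : R), h b = r ∧ p + g b = j ∧ a ∈ 𝒜 p ∧ y = a • e b}
  map_succ : ∀ r j, ∀ y ∈ ℳ (r + 1) j, d y ∈ ℳ r j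
  map_zero : ∀ j, ∀ y ∈ ℳ 0 j, d y = 0
  d_comp_d : d ∘ₗ d = 0
  /-- Exactness in positive homological degrees. -/
  exact_succ : ∀ r j, ∀ y ∈ ℳ (r + 1) j, d y = 0 → ∃ w ∈ ℳ (r + 2) j, d w = y
  /-- There is a surjective augmentation `M → k` of bidegree `(0, 0)`, whose kernel in homological
  degree `0` is the image of `d`. -/
  augmentation : ∃ ε : M →ₗ[R] Residue 𝒜, Function.Surjective ε ∧ ε ∘ₗ d = 0 ∧
    (∀ r j, (r, j) ≠ (0, 0) → ∀ y ∈ ℳ r j, ε y = 0) ∧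
    ∀ j, ∀ y ∈ ℳ 0 j, ε y = 0 → ∃ w ∈ ℳ 1 j, d w = y

/-- A graded free resolution is minimal if `d(M) ⊆ R_+ M`. -/
structure IsMinimalGradedFreeResolution (𝒜 : ℕ → Submodule k R) [GradedAlgebra 𝒜]
    (ℳ : ℕ → ℕ → Submodule k M) (d : M →ₗ[R] M) : Prop
    extends IsGradedFreeResolution 𝒜 ℳ d where
  minimal : LinearMap.range d ≤ plusIdeal 𝒜 • (⊤ : Submodule R M)

/-- The bigraded pieces of `k ⊗_R M`. -/
def residueDeg (𝒜 : ℕ → Submodule k R) [GradedAlgebra 𝒜]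
    (ℳ : ℕ → ℕ → Submodule k M) (r j : ℕ) : Submodule k (Residue 𝒜 ⊗[R] M) :=
  (ℳ r j).map ((TensorProduct.mk R (Residue 𝒜) M 1).restrictScalars k)

/-- `H_{r,j}(k ⊗_R M)`. If `M` is a graded free resolution of `k` over `R`, this is
`Tor_{r,j}^R(k,k)`. -/
abbrev BiTor (𝒜 : ℕ → Submodule k R) [GradedAlgebra 𝒜]
    (ℳ : ℕ → ℕ → Submodule k M) (d : M →ₗ[R] M) (r j : ℕ) : Type u :=
  BiHomology (residueDeg 𝒜 ℳ) ((d.lTensor (Residue 𝒜)).restrictScalars k) r j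

end Resolution

/-! ### The Koszul complex -/

/-- The Koszul complex `K = R ⊗ ∧(T_1, …, T_n)`, as an algebra. -/
abbrev Koszul (R : Type u) [CommRing R] (n : ℕ) : Type u := ExteriorAlgebra R (Fin n → R)

/-- The differential of the Koszul complex: the antiderivation with `T_i ↦ x_i`. -/
def koszulD {n : ℕ} (x : Fin n → R) : Koszul R n →ₗ[R] Koszul R n :=
  CliffordAlgebra.contractLeft (Fintype.linearCombination R x)

/-- `T_i`. -/
def T (R : Type u) [CommRing R] {n : ℕ} (i : Fin n) : Koszul R n :=
  ExteriorAlgebra.ι R (Pi.single i 1)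

theorem koszulD_T_mul {n : ℕ} (x : Fin n → R) (i : Fin n) (y : Koszul R n) :
    koszulD x (T R i * y) = x i • y - T R i * koszulD x y := by
  have h := CliffordAlgebra.contractLeft_ι_mul (Q := (0 : QuadraticForm R (Fin n → R)))
    (Fintype.linearCombination R x) (Pi.single i 1) y
  have hx : Fintype.linearCombination R x (Pi.single i 1) = x i := by
    simp [Fintype.linearCombination_apply_single]
  rw [hx] at h
  exact h

theorem koszulD_one {n : ℕ} (x : Fin n → R) : koszulD x (1 : Koszul R n) = 0 :=
  CliffordAlgebra.contractLeft_one (Q := (0 : QuadraticForm R (Fin n → R)))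
    (Fintype.linearCombination R x)

/-- The piece of `K` of homological degree `r`, spanned over `R` by the products of `r` of
the `T_i`. -/
def koszulHomDeg (k : Type u) {R : Type u} [Field k] [CommRing R] [Algebra k R] (n r : ℕ) :
    Submodule k (Koszul R n) :=
  (⋀[R]^r (Fin n → R)).restrictScalars k

/-- The piece of `K` of homological degree `r` and internal degree `j`, where each `T_i` has
bidegree `(1, 1)`: it is spanned by the `a T_{i_1} ⋯ T_{i_r}` with `a ∈ R_p`, `p + r = j`. -/
def koszulDeg (𝒜 : ℕ → Submodule k R) (n r j : ℕ) : Submodule k (Koszul R n) :=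
  Submodule.span k {y | ∃ (p : ℕ) (a : R) (f : Fin r → Fin n), p + r = j ∧ a ∈ 𝒜 p ∧
    y = a • (List.ofFn fun s => T R (f s)).prod}

/-- `H_r(K)`. -/
abbrev KoszulHomology (k : Type u) {R : Type u} [Field k] [CommRing R] [Algebra k R] {n : ℕ}
    (x : Fin n → R) (r : ℕ) : Type u :=
  Homology (koszulHomDeg k n) ((koszulD x).restrictScalars k) r

/-- `H_{r,j}(K)`. -/
abbrev KoszulBiHomology (𝒜 : ℕ → Submodule k R) {n : ℕ} (x : Fin n → R) (r j : ℕ) : Type u :=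
  BiHomology (koszulDeg 𝒜 n) ((koszulD x).restrictScalars k) r j

/-- `Z_+(K)`: the cycles of the Koszul complex in `K_+ = ⨁_{r ≥ 1} K_r`. -/
def koszulZPlus {n : ℕ} (x : Fin n → R) : Submodule R (Koszul R n) :=
  LinearMap.ker (koszulD x) ⊓ ⨆ r : ℕ, ⋀[R]^(r + 1) (Fin n → R)

/-- `H_+(K)`. Its suspension `C = s H_+(K)` has the same underlying space. -/
abbrev HPlus {n : ℕ} (x : Fin n → R) : Type u :=
  ↥(koszulZPlus x) ⧸ (LinearMap.range (koszulD x)).submoduleOf (koszulZPlus x)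

/-- The homology class of a cycle. -/
def cls {n : ℕ} (x : Fin n → R) (z : koszulZPlus x) : HPlus x := Submodule.Quotient.mk z

/-- The bigrading of `C = s H_+(K)`: `C_{r+1,j} = H_{r,j}(K)` for `r > 0`. (The piece `C_{1,j}` is
zero, since `Z_+(K)` meets `K_0` in zero.) -/
def suspDeg (𝒜 : ℕ → Submodule k R) {n : ℕ} (x : Fin n → R) : ℕ → ℕ → Submodule k (HPlus x)
  | 0, _ => ⊥
  | r + 1, j => Submodule.span k {c | ∃ z : koszulZPlus x,
      (z : Koszul R n) ∈ koszulDeg 𝒜 n r j ∧ c = cls x z}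

/-! ### The tensor algebra -/

section Peel

variable {C : Type u} [AddCommGroup C] [Module k C]

/-- The linear map `C → End (T(C) × (C ⊗ T(C)))`, `c ↦ ((t, u) ↦ (c t, c ⊗ t))`. -/
def peelAux : C →ₗ[k] Module.End k (TensorAlgebra k C × (C ⊗[k] TensorAlgebra k C)) :=
  LinearMap.mk₂ k
    (fun c p => (TensorAlgebra.ι k c * p.1, c ⊗ₜ[k] p.1))
    (fun c c' p => by simp [add_mul, TensorProduct.add_tmul])
    (fun a c p => by simp [TensorProduct.smul_tmul'])
    (fun c p q => by simp [mul_add, TensorProduct.tmul_add])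
    (fun a c p => by simp)

/-- The linear map `T(C) → C ⊗ T(C)` with `1 ↦ 0` and
`c_1 | c_2 | ⋯ | c_m ↦ c_1 ⊗ (c_2 | ⋯ | c_m)`. -/
def peel : TensorAlgebra k C →ₗ[k] C ⊗[k] TensorAlgebra k C :=
  LinearMap.snd k _ _ ∘ₗ
    (LinearMap.applyₗ ((1, 0) : TensorAlgebra k C × (C ⊗[k] TensorAlgebra k C))) ∘ₗ
    (TensorAlgebra.lift k (peelAux (k := k) (C := C))).toLinearMap

theorem peelAux_apply (c : C) (p : TensorAlgebra k C × (C ⊗[k] TensorAlgebra k C)) :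
    peelAux c p = (TensorAlgebra.ι k c * p.1, c ⊗ₜ[k] p.1) := rfl

theorem peel_one : peel (1 : TensorAlgebra k C) = 0 := by
  simp [peel]

theorem peel_fst (t : TensorAlgebra k C) :
    ∀ p, (TensorAlgebra.lift k (peelAux (k := k) (C := C)) t p).1 = t * p.1 := by
  induction t using TensorAlgebra.induction with
  | algebraMap r => intro p; simp [Algebra.smul_def]
  | ι c => intro p; simp [peelAux_apply]
  | mul a b ha hb => intro p; simp [ha, hb, mul_assoc]
  | add a b ha hb => intro p; simp [ha, hb, add_mul]

theorem peel_ι_mul (c : C) (t : TensorAlgebra k C) :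
    peel (TensorAlgebra.ι k c * t) = c ⊗ₜ[k] t := by
  have h := peel_fst t (1, 0)
  rw [mul_one] at h
  simp only [peel, LinearMap.comp_apply, AlgHom.toLinearMap_apply, map_mul,
    TensorAlgebra.lift_ι_apply, LinearMap.applyₗ_apply_apply, Module.End.mul_apply,
    LinearMap.snd_apply]
  rw [peelAux_apply, h]

/-- The bigrading of `T(C)` induced by a bigrading of `C`. -/
def tensorDeg (𝒞 : ℕ → ℕ → Submodule k C) (r j : ℕ) : Submodule k (TensorAlgebra k C) :=
  Submodule.span k {t | ∃ (m : ℕ) (c : Fin m → C) (p q : Fin m → ℕ),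
    (∀ i, c i ∈ 𝒞 (p i) (q i)) ∧ ∑ i, p i = r ∧ ∑ i, q i = j ∧ t = TensorAlgebra.tprod k C m c}

end Peel

/-! ### The complex `Y = K ⊗ T(C)` -/

/-- `Y = K ⊗ T(C)` with `C = s H_+(K)`. -/
abbrev Y (k : Type u) {R : Type u} [Field k] [CommRing R] [Algebra k R] {n : ℕ}
    (x : Fin n → R) : Type u :=
  Koszul R n ⊗[k] TensorAlgebra k (HPlus x)

/-- `x ↦ (-1)^{|x|} x` on the Koszul complex. -/
def signMap (R : Type u) [CommRing R] (n : ℕ) : Koszul R n →ₗ[R] Koszul R n :=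
  (CliffordAlgebra.involute (Q := (0 : QuadraticForm R (Fin n → R)))).toLinearMap

/-- The map `A ⊗ C → A`, `y ⊗ c ↦ σ(y) α(c)`. -/
def twist {A C : Type u} [Ring A] [Algebra R A] [Algebra k A] [IsScalarTower k R A]
    [AddCommGroup C] [Module k C] (σ : A →ₗ[R] A) (α : C →ₗ[k] A) : A ⊗[k] C →ₗ[R] A :=
  TensorProduct.AlgebraTensorModule.lift
    { toFun := fun y => LinearMap.mulLeft k (σ y) ∘ₗ α
      map_add' := fun y y' => by ext c; simp [add_mul]
      map_smul' := fun a y => by ext c; simp }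

/-- The differential of `Y` determined by `α : C → Z_+(K)`:
`d(x|c_1|⋯|c_m) = dx|c_1|⋯|c_m + (-1)^{|x|} x α(c_1)|c_2|⋯|c_m`. -/
def dY {n : ℕ} (x : Fin n → R) (α : HPlus x →ₗ[k] Koszul R n) : Y k x →ₗ[R] Y k x :=
  TensorProduct.AlgebraTensorModule.map (koszulD x) LinearMap.id +
  TensorProduct.AlgebraTensorModule.map (twist (signMap R n) α) LinearMap.id ∘ₗ
    (TensorProduct.AlgebraTensorModule.assoc k k R (Koszul R n) (HPlus x)
      (TensorAlgebra k (HPlus x))).symm.toLinearMap ∘ₗ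
    TensorProduct.AlgebraTensorModule.map LinearMap.id peel

theorem dY_tmul_one {n : ℕ} (x : Fin n → R) (α : HPlus x →ₗ[k] Koszul R n) (y : Koszul R n) :
    dY x α (y ⊗ₜ[k] 1) = koszulD x y ⊗ₜ[k] 1 := by
  simp [dY, peel_one]

theorem dY_tmul_ι_mul {n : ℕ} (x : Fin n → R) (α : HPlus x →ₗ[k] Koszul R n) (y : Koszul R n)
    (c : HPlus x) (t : TensorAlgebra k (HPlus x)) :
    dY x α (y ⊗ₜ[k] (TensorAlgebra.ι k c * t)) =
      koszulD x y ⊗ₜ[k] (TensorAlgebra.ι k c * t) + (signMap R n y * α c) ⊗ₜ[k] t := by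
  simp [dY, peel_ι_mul, twist]

/-- The bigrading of `Y = K ⊗ T(C)`. -/
def yDeg (𝒜 : ℕ → Submodule k R) {n : ℕ} (x : Fin n → R) (r j : ℕ) : Submodule k (Y k x) :=
  Submodule.span k {y | ∃ (p q p' q' : ℕ) (v : Koszul R n) (t : TensorAlgebra k (HPlus x)),
    p + p' = r ∧ q + q' = j ∧ v ∈ koszulDeg 𝒜 n p q ∧ t ∈ tensorDeg (suspDeg 𝒜 x) p' q' ∧
    y = v ⊗ₜ[k] t}

end Graded

end Golod

end

open Golod

/-!
The argument has three independent parts.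

*Exactness of `Y`.* The cycles `z i` together with `1` represent a basis of the homology of the
Koszul complex `K` over `k` (`koszulCycles_span`, `koszulCycles_independent`). The differential of
`Y = K ⊗ T(C)` acts on `K` and on the first letter of a word, so the operation that removes the last
letter of a word commutes with it. Hence, by induction on the length of the words, every cycle of
`Y` is, up to a boundary, of the form `v + ∑ a_i | c_i` with `v ∈ K` and `a_i ∈ k`. Its differential
is `dv + ∑ a_i z_i`, so the `a_i` vanish by independence, and `v` is a cycle of `K`, hence a boundary
of `Y` plus a scalar, because `z_i = d (1 | c_i)`. This is `IsWordComplex.exists_eq_d_add`; it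
replaces the usual spectral sequence and makes no use of the grading. That `d² = 0` is the Leibniz
rule together with `z_i z_{i'} = 0`.

*Minimality.* A bihomogeneous cycle of `K` of positive degree has its coefficients in `R_+`
(`mem_plusIdeal_smul_of_koszulD_eq_zero`): this is clear by degrees unless all the coefficients are
scalars, and then linear independence of the `x_i` shows that all the partial derivatives of the
cycle vanish, so it is zero.

*Poincaré series.* `Y` has an `R`-basis of elements `T_{i_1} ⋯ T_{i_r} | c_1 | ⋯ | c_m`, where the
`c_i` belong to the basis of `C` (`yBasis`). By minimality the differential of `k ⊗ Y` vanishes, so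
these elements count the dimension of `Tor`, and counting them gives the formulas: a word is empty
or a letter followed by a word (`gen_list`), and subsets of an `n`-element set give the numerator
(`gen_finset`). For the ungraded `Tor`, the pieces of homological degree `r` form a projective
resolution in the sense of Mathlib (`moduleResolution`). For an arbitrary graded free resolution,
the bigraded comparison theorem (`IsGradedFreeResolution.exists_lift` and
`IsGradedFreeResolution.exists_homotopy`) identifies the homology with that of `k ⊗ Y`
(`nonempty_biTor_equiv`). The generating series make sense because the homology of `K` is finitely
generated over `R` and killed by `R_+`, hence finite-dimensional (`finite_koszulHomology`).
-/

noncomputable section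

namespace Golod

/-! ### Modules with a bihomogeneous basis -/

section GradedBasis

variable {k R : Type u} [Field k] [CommRing R] [Algebra k R]
variable (𝒜 : ℕ → Submodule k R) [GradedAlgebra 𝒜]
variable {M : Type u} [AddCommGroup M] [Module k M] [Module R M] [IsScalarTower k R M]
variable {β : Type*} (e : Module.Basis β R M) (h g : β → ℕ)

/-- The piece of bidegree `(r, j)` of a free module with a basis `e` whose element `e b` has
homological degree `h b` and internal degree `g b`. -/
def gradedPiece (r j : ℕ) : Submodule k M :=
  Submodule.span k
    {y | ∃ (b : β) (p : ℕ) (a : R), h b = r ∧ p + g b = j ∧ a ∈ 𝒜 p ∧ y = a • e b}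

/-- The projection onto the piece of bidegree `(r, j)`. -/
def gradedProj (r j : ℕ) : M →ₗ[k] M :=
  (Finsupp.lsum k fun b => if h b = r ∧ g b ≤ j then
    ((LinearMap.toSpanSingleton R M (e b)).restrictScalars k) ∘ₗ GradedAlgebra.proj 𝒜 (j - g b)
    else 0) ∘ₗ (e.repr.toLinearMap.restrictScalars k)

variable {h g}

omit [GradedAlgebra 𝒜] [IsScalarTower k R M] in
theorem smul_mem_gradedPiece {b : β} {p r j : ℕ} {a : R} (ha : a ∈ 𝒜 p) (hr : h b = r)
    (hj : p + g b = j) : a • e b ∈ gradedPiece 𝒜 e h g r j :=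
  Submodule.subset_span ⟨b, p, a, hr, hj, ha, rfl⟩

omit [IsScalarTower k R M] in
theorem basis_mem_gradedPiece (b : β) : e b ∈ gradedPiece 𝒜 e h g (h b) (g b) := by
  simpa using smul_mem_gradedPiece 𝒜 e (h := h) (g := g) (b := b)
    (SetLike.GradedOne.one_mem (A := 𝒜)) rfl (zero_add _)

variable {𝒜} in
theorem proj_of_mem {p : ℕ} {a : R} (ha : a ∈ 𝒜 p) (q : ℕ) :
    GradedAlgebra.proj 𝒜 q a = if p = q then a else 0 := by
  rw [GradedAlgebra.proj_apply]
  split_ifs with hpq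
  · subst hpq; exact DirectSum.decompose_of_mem_same 𝒜 ha
  · exact DirectSum.decompose_of_mem_ne 𝒜 ha hpq

theorem gradedProj_smul {b : β} {p : ℕ} {a : R} (ha : a ∈ 𝒜 p) (r j : ℕ) :
    gradedProj 𝒜 e h g r j (a • e b) = if h b = r ∧ p + g b = j then a • e b else 0 := by
  simp only [gradedProj, LinearMap.comp_apply, LinearMap.restrictScalars_apply,
    LinearEquiv.coe_coe, map_smul, Module.Basis.repr_self, Finsupp.smul_single, smul_eq_mul,
    mul_one, Finsupp.coe_lsum]
  rw [Finsupp.sum_single_index (by simp)]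
  by_cases hr : h b = r
  · by_cases hj : g b ≤ j
    · have : p = j - g b ↔ p + g b = j := by omega
      simp [hr, hj, proj_of_mem ha, this, ite_smul]
    · have : ¬ p + g b = j := by omega
      simp [hr, hj, this]
  · simp [hr]

theorem gradedProj_of_mem {r j : ℕ} {y : M} (hy : y ∈ gradedPiece 𝒜 e h g r j) :
    gradedProj 𝒜 e h g r j y = y := by
  induction hy using Submodule.span_induction with
  | mem y hy => obtain ⟨b, p, a, rfl, rfl, ha, rfl⟩ := hy; simp [gradedProj_smul 𝒜 e ha]
  | zero => simp
  | add y y' _ _ h1 h2 => rw [map_add, h1, h2]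
  | smul c y _ h1 => rw [map_smul, h1]

theorem gradedProj_of_mem_ne {r j r' j' : ℕ} {y : M} (hy : y ∈ gradedPiece 𝒜 e h g r' j')
    (hne : ¬ (r' = r ∧ j' = j)) : gradedProj 𝒜 e h g r j y = 0 := by
  induction hy using Submodule.span_induction with
  | mem y hy =>
    obtain ⟨b, p, a, rfl, rfl, ha, rfl⟩ := hy
    rw [gradedProj_smul 𝒜 e ha, if_neg hne]
  | zero => simp
  | add y y' _ _ h1 h2 => rw [map_add, h1, h2, add_zero]
  | smul c y _ h1 => rw [map_smul, h1, smul_zero]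

omit [Module k M] [IsScalarTower k R M] in
/-- A property that is additive and holds on all bigraded pieces holds everywhere. -/
theorem gradedPiece_induction {P : M → Prop} (hzero : P 0)
    (hadd : ∀ y y', P y → P y' → P (y + y'))
    (hmem : ∀ (b : β) (p : ℕ), ∀ a ∈ 𝒜 p, P (a • e b)) (y : M) : P y := by
  rw [← e.linearCombination_repr y]
  induction e.repr y using Finsupp.induction_linear with
  | zero => simpa using hzero
  | add y y' h1 h2 => rw [map_add]; exact hadd _ _ h1 h2
  | single b a =>
    rw [Finsupp.linearCombination_single]
    induction a using DirectSum.Decomposition.inductionOn 𝒜 with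
    | zero => simpa using hzero
    | homogeneous a => exact hmem b _ a a.2
    | add a a' h1 h2 => rw [add_smul]; exact hadd _ _ h1 h2

theorem gradedProj_mem (r j : ℕ) (y : M) :
    gradedProj 𝒜 e h g r j y ∈ gradedPiece 𝒜 e h g r j := by
  induction y using gradedPiece_induction 𝒜 e with
  | hzero => simp
  | hadd y y' h1 h2 => rw [map_add]; exact add_mem h1 h2
  | hmem b p a ha =>
    rw [gradedProj_smul 𝒜 e ha]
    split_ifs with hb
    · exact smul_mem_gradedPiece 𝒜 e ha hb.1 hb.2
    · exact zero_mem _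

/-- A map of bidegree `(-1, 0)` commutes with the projections. -/
theorem gradedProj_comm {d : M →ₗ[R] M}
    (hsucc : ∀ r j, ∀ y ∈ gradedPiece 𝒜 e h g (r + 1) j, d y ∈ gradedPiece 𝒜 e h g r j)
    (hzero : ∀ j, ∀ y ∈ gradedPiece 𝒜 e h g 0 j, d y = 0) (r j : ℕ) (y : M) :
    gradedProj 𝒜 e h g r j (d y) = d (gradedProj 𝒜 e h g (r + 1) j y) := by
  induction y using gradedPiece_induction 𝒜 e with
  | hzero => simp
  | hadd y y' h1 h2 => simp only [map_add, h1, h2]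
  | hmem b p a ha =>
    have hmem : a • e b ∈ gradedPiece 𝒜 e h g (h b) (p + g b) :=
      smul_mem_gradedPiece 𝒜 e ha rfl rfl
    by_cases hb : h b = r + 1 ∧ p + g b = j
    · rw [hb.1, hb.2] at hmem
      rw [gradedProj_of_mem 𝒜 e hmem, gradedProj_of_mem 𝒜 e (hsucc _ _ _ hmem)]
    · rw [gradedProj_of_mem_ne 𝒜 e hmem hb, map_zero]
      rcases hr : h b with _ | s
      · rw [hr] at hmem
        rw [hzero _ _ hmem, map_zero]
      · rw [hr] at hmem
        exact gradedProj_of_mem_ne 𝒜 e (hsucc _ _ _ hmem) (by omega)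

/-- A linear map sends bigraded pieces to bigraded pieces as soon as it does so on the basis. -/
theorem map_mem_gradedPiece {M' : Type u} [AddCommGroup M'] [Module k M'] [Module R M']
    [IsScalarTower k R M'] {β' : Type*} (e' : Module.Basis β' R M') {h' g' : β' → ℕ}
    (f : M →ₗ[R] M') {r j r' : ℕ}
    (hf : ∀ b, h b = r → f (e b) ∈ gradedPiece 𝒜 e' h' g' r' (g b)) {y : M}
    (hy : y ∈ gradedPiece 𝒜 e h g r j) : f y ∈ gradedPiece 𝒜 e' h' g' r' j := by
  have hsmul : ∀ (p : ℕ) (a : R), a ∈ 𝒜 p → ∀ i, ∀ y ∈ gradedPiece 𝒜 e' h' g' r' i,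
      a • y ∈ gradedPiece 𝒜 e' h' g' r' (p + i) := by
    intro p a ha i y hy
    induction hy using Submodule.span_induction with
    | mem y hy =>
      obtain ⟨b, q, a', rfl, rfl, ha', rfl⟩ := hy
      rw [smul_smul]
      exact smul_mem_gradedPiece 𝒜 e' (SetLike.GradedMul.mul_mem ha ha') rfl (by omega)
    | zero => simp
    | add y y' _ _ h1 h2 => rw [smul_add]; exact add_mem h1 h2
    | smul c y _ h1 => rw [smul_comm]; exact Submodule.smul_mem _ _ h1
  have hk : ∀ (c : k) (y : M), f (c • y) = c • f y := fun c y => by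
    rw [← algebraMap_smul R c y, map_smul, algebraMap_smul]
  induction hy using Submodule.span_induction with
  | mem y hy =>
    obtain ⟨b, p, a, hr, rfl, ha, rfl⟩ := hy
    rw [map_smul]
    exact hsmul p a ha _ _ (hf b hr)
  | zero => simp
  | add y y' _ _ h1 h2 => rw [map_add]; exact add_mem h1 h2
  | smul c y _ h1 => rw [hk]; exact Submodule.smul_mem _ _ h1

end GradedBasis

section HomPiece

variable {R : Type u} [CommRing R] {M : Type u} [AddCommGroup M] [Module R M]
variable {β : Type*} (e : Module.Basis β R M) (h : β → ℕ)

/-- The piece of homological degree `r` of a free module with a basis `e` whose element `e b` has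
homological degree `h b`. -/
def homPiece (r : ℕ) : Submodule R M := Submodule.span R (e '' {b | h b = r})

/-- The projection onto the piece of homological degree `r`. -/
def homProj (r : ℕ) : M →ₗ[R] M := e.constr ℕ fun b => if h b = r then e b else 0

variable {h}

theorem basis_mem_homPiece {b : β} {r : ℕ} (hb : h b = r) : e b ∈ homPiece e h r :=
  Submodule.subset_span ⟨b, hb, rfl⟩

theorem homPiece_le_iff {r : ℕ} {N : Submodule R M} :
    homPiece e h r ≤ N ↔ ∀ b, h b = r → e b ∈ N :=
  Submodule.span_le.trans (by rw [Set.image_subset_iff]; rfl)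

theorem homProj_basis (r : ℕ) (b : β) : homProj e h r (e b) = if h b = r then e b else 0 :=
  e.constr_basis ℕ _ b

theorem homProj_mem (r : ℕ) (y : M) : homProj e h r y ∈ homPiece e h r := by
  induction e.mem_span y using Submodule.span_induction with
  | mem y hy =>
    obtain ⟨b, rfl⟩ := hy
    rw [homProj_basis]
    split_ifs with hb
    · exact basis_mem_homPiece e hb
    · exact zero_mem _
  | zero => simp
  | add y y' _ _ h1 h2 => rw [map_add]; exact add_mem h1 h2
  | smul c y _ h1 => rw [map_smul]; exact Submodule.smul_mem _ _ h1

theorem homProj_of_mem {r : ℕ} : ∀ y ∈ homPiece e h r, homProj e h r y = y :=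
  (homPiece_le_iff e (N := LinearMap.eqLocus (homProj e h r) LinearMap.id)).2 fun b hb =>
    (homProj_basis e r b).trans (if_pos hb)

theorem homProj_of_mem_ne {r s : ℕ} (hrs : s ≠ r) :
    ∀ y ∈ homPiece e h s, homProj e h r y = 0 :=
  (homPiece_le_iff e (N := LinearMap.ker (homProj e h r))).2 fun b hb =>
    (homProj_basis e r b).trans (if_neg fun h' => hrs (hb.symm.trans h'))

/-- A map of degree `-1` commutes with the projections. -/
theorem homProj_comm {d : M →ₗ[R] M}
    (hsucc : ∀ r, ∀ y ∈ homPiece e h (r + 1), d y ∈ homPiece e h r)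
    (hzero : ∀ y ∈ homPiece e h 0, d y = 0) (r : ℕ) :
    ∀ y, homProj e h r (d y) = d (homProj e h (r + 1) y) := by
  refine LinearMap.congr_fun (f := homProj e h r ∘ₗ d) (g := d ∘ₗ homProj e h (r + 1))
    (e.ext fun b => ?_)
  simp only [LinearMap.comp_apply]
  rcases hb : h b with _ | t
  · rw [hzero _ (basis_mem_homPiece e hb), homProj_basis, if_neg (by omega)]; simp
  · have h1 := hsucc t _ (basis_mem_homPiece e hb)
    rw [homProj_basis, hb]
    by_cases hrt : t = r
    · subst hrt; rw [if_pos rfl, homProj_of_mem e _ h1]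
    · rw [homProj_of_mem_ne e hrt _ h1, if_neg (by omega), map_zero]

theorem gradedPiece_le_homPiece {k : Type u} [Field k] [Algebra k R] [Module k M]
    [IsScalarTower k R M] (𝒜 : ℕ → Submodule k R) (g : β → ℕ) (r j : ℕ) :
    gradedPiece 𝒜 e h g r j ≤ (homPiece e h r).restrictScalars k := by
  refine Submodule.span_le.2 ?_
  rintro _ ⟨b, p, a, hb, -, -, rfl⟩
  exact Submodule.smul_mem _ _ (basis_mem_homPiece e hb)

end HomPiece

/-! ### Homology of complexes given by a family of subspaces -/

section Homology

variable {k : Type u} [Field k] {M M' : Type u} [AddCommGroup M] [Module k M]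
  [AddCommGroup M'] [Module k M']

/-- Chain maps that are inverse to each other up to boundaries on cycles of degree `r` induce an
isomorphism on the homology of degree `r`. -/
theorem nonempty_homology_equiv {N : ℕ → Submodule k M} {d : M →ₗ[k] M}
    {N' : ℕ → Submodule k M'} {d' : M' →ₗ[k] M'} (f : M →ₗ[k] M') (g : M' →ₗ[k] M) (r : ℕ)
    (hf : ∀ s, ∀ y ∈ N s, f y ∈ N' s) (hg : ∀ s, ∀ y ∈ N' s, g y ∈ N s)
    (hfd : ∀ y, f (d y) = d' (f y)) (hgd : ∀ y, g (d' y) = d (g y))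
    (hgf : ∀ y ∈ N r, d y = 0 → ∃ w ∈ N (r + 1), d w = g (f y) - y)
    (hfg : ∀ y ∈ N' r, d' y = 0 → ∃ w ∈ N' (r + 1), d' w = f (g y) - y) :
    Nonempty (Homology N d r ≃ₗ[k] Homology N' d' r) := by
  have hf' : ∀ y ∈ N r ⊓ LinearMap.ker d, f y ∈ N' r ⊓ LinearMap.ker d' := fun y hy =>
    ⟨hf _ _ hy.1, (hfd y).symm.trans (by rw [LinearMap.mem_ker.1 hy.2, map_zero])⟩
  have hg' : ∀ y ∈ N' r ⊓ LinearMap.ker d', g y ∈ N r ⊓ LinearMap.ker d := fun y hy =>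
    ⟨hg _ _ hy.1, (hgd y).symm.trans (by rw [LinearMap.mem_ker.1 hy.2, map_zero])⟩
  refine ⟨LinearEquiv.ofLinearMap
    (Submodule.mapQ _ _ (f.restrict hf') ?_) (Submodule.mapQ _ _ (g.restrict hg') ?_) ?_ ?_⟩
  · rintro ⟨y, hy⟩ hyB
    obtain ⟨w, hw, rfl⟩ := hyB
    exact ⟨f w, hf _ _ hw, (hfd w).symm⟩
  · rintro ⟨y, hy⟩ hyB
    obtain ⟨w, hw, rfl⟩ := hyB
    exact ⟨g w, hg _ _ hw, (hgd w).symm⟩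
  · refine Submodule.linearMap_qext _ (LinearMap.ext fun y => ?_)
    refine (Submodule.Quotient.eq _).2 ?_
    obtain ⟨w, hw, hwy⟩ := hfg y y.2.1 y.2.2
    exact ⟨w, hw, hwy⟩
  · refine Submodule.linearMap_qext _ (LinearMap.ext fun y => ?_)
    refine (Submodule.Quotient.eq _).2 ?_
    obtain ⟨w, hw, hwy⟩ := hgf y y.2.1 y.2.2
    exact ⟨w, hw, hwy⟩

/-- If the cycles `z i` represent a basis of the total homology `ker d / im d`, and each of them
is either in the graded piece of degree `r` or has no component there, then the former represent
a basis of the homology of degree `r`. Here `p` and `p'` are the projections onto the pieces of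
degrees `r` and `r + 1`. -/
theorem nonempty_homology_basis {N : ℕ → Submodule k M} {d : M →ₗ[k] M} (r : ℕ)
    (p p' : M →ₗ[k] M) (hp : ∀ y ∈ N r, p y = y)
    (hp' : ∀ y, p' y ∈ N (r + 1)) (hpd : ∀ y, p (d y) = d (p' y))
    {J : Type*} (z : J → M) (hz : ∀ i, d (z i) = 0)
    (hspan : ∀ y, d y = 0 → ∃ c w, y = d w + Finsupp.linearCombination k z c)
    (hind : ∀ c w, Finsupp.linearCombination k z c = d w → c = 0)
    (S : Set J) (hS : ∀ i ∈ S, z i ∈ N r) (hS' : ∀ i ∉ S, p (z i) = 0) :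
    Nonempty (Module.Basis S k (Homology N d r)) := by
  classical
  let zS : S → ↥(N r ⊓ LinearMap.ker d) := fun i => ⟨z i, hS i i.2, hz i⟩
  let φ : (S →₀ k) →ₗ[k] Homology N d r :=
    Submodule.mkQ _ ∘ₗ Finsupp.linearCombination k zS
  have hval : ∀ c : S →₀ k, ((Finsupp.linearCombination k zS c : ↥(N r ⊓ LinearMap.ker d)) : M) =
      Finsupp.linearCombination k z (c.mapDomain Subtype.val) := by
    intro c
    rw [Finsupp.linearCombination_mapDomain, Finsupp.linearCombination_apply,
      Finsupp.linearCombination_apply, Finsupp.sum, Finsupp.sum, Submodule.coe_sum]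
    rfl
  refine ⟨.ofRepr (LinearEquiv.ofBijective φ ⟨?_, ?_⟩).symm⟩
  · rw [← LinearMap.ker_eq_bot, LinearMap.ker_eq_bot']
    intro c hc
    obtain ⟨w, -, hw⟩ := (Submodule.Quotient.mk_eq_zero _).1 hc
    have h0 := hind (c.mapDomain Subtype.val) w ((hval c).symm.trans hw.symm)
    exact Finsupp.mapDomain_injective Subtype.val_injective (by rw [h0, Finsupp.mapDomain_zero])
  · intro y
    obtain ⟨⟨y, hy⟩, rfl⟩ := Submodule.mkQ_surjective _ y
    obtain ⟨c, w, hc⟩ := hspan y hy.2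
    have h1 : y = d (p' w) + p (Finsupp.linearCombination k z c) := by
      rw [← hpd, ← map_add, ← hc, hp y hy.1]
    have h2 : ∃ c' : S →₀ k, p (Finsupp.linearCombination k z c) =
        Finsupp.linearCombination k z (c'.mapDomain Subtype.val) := by
      clear hc h1
      induction c using Finsupp.induction_linear with
      | zero => exact ⟨0, by simp⟩
      | add c c' h1 h2 =>
        obtain ⟨c₁, h1⟩ := h1
        obtain ⟨c₂, h2⟩ := h2
        exact ⟨c₁ + c₂, by rw [map_add, map_add, h1, h2, Finsupp.mapDomain_add, map_add]⟩
      | single i a =>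
        rw [Finsupp.linearCombination_single, map_smul]
        by_cases hi : i ∈ S
        · refine ⟨Finsupp.single ⟨i, hi⟩ a, ?_⟩
          rw [Finsupp.mapDomain_single, Finsupp.linearCombination_single, hp _ (hS i hi)]
        · exact ⟨0, by rw [hS' i hi, smul_zero, Finsupp.mapDomain_zero, map_zero]⟩
    obtain ⟨c', h2⟩ := h2
    refine ⟨c', (Submodule.Quotient.eq _).2 ⟨-p' w, neg_mem (hp' w), ?_⟩⟩
    rw [map_neg]
    change _ = ((Finsupp.linearCombination k zS _ : ↥(N r ⊓ LinearMap.ker d)) : M) - y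
    rw [hval, ← h2, neg_eq_iff_add_eq_zero, ← add_sub_assoc, sub_eq_zero, ← h1]

end Homology

/-! ### The comparison theorem for graded free resolutions -/

section Comparison

variable {k R : Type u} [Field k] [CommRing R] [Algebra k R]
variable {M : Type u} [AddCommGroup M] [Module k M] [Module R M] [IsScalarTower k R M]
variable {M' : Type u} [AddCommGroup M'] [Module k M'] [Module R M'] [IsScalarTower k R M']

omit [Module k M] [IsScalarTower k R M] [Module k M'] [IsScalarTower k R M'] in
/-- Construction of a linear map by recursion on the degree `h b` of the basis elements: the
condition `S b φ v` on the value `v` at `e b` depends only on the values of `φ` in smaller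
degrees. -/
theorem exists_linearMap_of_recursion {β : Type*} (e : Module.Basis β R M) (h : β → ℕ)
    (S : β → (M →ₗ[R] M') → M' → Prop)
    (hcongr : ∀ b φ ψ v, (∀ b', h b' < h b → φ (e b') = ψ (e b')) → S b φ v → S b ψ v)
    (hex : ∀ φ b, (∀ b', h b' < h b → S b' φ (φ (e b'))) → ∃ v, S b φ v) :
    ∃ φ : M →ₗ[R] M', ∀ b, S b φ (φ (e b)) := by
  classical
  let next : (M →ₗ[R] M') → M →ₗ[R] M' := fun φ => e.constr ℕ fun b =>
    if hb : ∃ v, S b φ v then hb.choose else 0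
  have hnext : ∀ φ b, (∃ v, S b φ v) → S b φ (next φ (e b)) := by
    intro φ b hb
    simp only [next, Module.Basis.constr_basis, dif_pos hb]
    exact hb.choose_spec
  have hdep : ∀ φ ψ b, (∀ b', h b' < h b → φ (e b') = ψ (e b')) →
      next φ (e b) = next ψ (e b) := by
    intro φ ψ b hφ
    have : S b φ = S b ψ := funext fun v => propext
      ⟨hcongr b φ ψ v hφ, hcongr b ψ φ v fun b' hb' => (hφ b' hb').symm⟩
    simp only [next, Module.Basis.constr_basis, this]
  let Φ : ℕ → M →ₗ[R] M' := fun N => next^[N] 0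
  have hΦ : ∀ N, Φ (N + 1) = next (Φ N) := fun N => Function.iterate_succ_apply' _ _ _
  -- the value of the `N`-th approximation at `e b` is stationary once `h b < N`
  have hstat : ∀ m b, h b = m → ∀ N, m < N → Φ N (e b) = Φ (m + 1) (e b) := by
    intro m
    induction m using Nat.strong_induction_on with
    | _ m ih =>
      intro b hb N hN
      obtain ⟨N, rfl⟩ := Nat.exists_eq_add_one_of_ne_zero (Nat.ne_zero_of_lt hN)
      rw [hΦ, hΦ]
      refine hdep _ _ _ fun b' hb' => ?_
      rw [ih (h b') (hb ▸ hb') b' rfl N (by omega), ih (h b') (hb ▸ hb') b' rfl m (by omega)]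
  let φ : M →ₗ[R] M' := e.constr ℕ fun b => Φ (h b + 1) (e b)
  have hφ : ∀ b N, h b < N → Φ N (e b) = φ (e b) := by
    intro b N hN
    rw [hstat (h b) b rfl N hN]
    simp [φ]
  refine ⟨φ, fun b => ?_⟩
  induction hm : h b using Nat.strong_induction_on generalizing b with
  | _ m ih =>
    subst hm
    have hval : φ (e b) = next φ (e b) := by
      rw [← hφ b (h b + 1) (Nat.lt_succ_self _), hΦ]
      exact hdep _ _ _ fun b' hb' => hφ b' _ hb'
    rw [hval]
    exact hnext φ b (hex φ b fun b' hb' => ih (h b') hb' b' rfl)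

variable (𝒜 : ℕ → Submodule k R) [GradedAlgebra 𝒜]

/-- An augmentation `M → k` of bidegree `(0, 0)` that makes a graded free resolution exact in
degree `0`. -/
structure IsAugmentation (ℳ : ℕ → ℕ → Submodule k M) (d : M →ₗ[R] M)
    (ε : M →ₗ[R] Residue 𝒜) : Prop where
  surjective : Function.Surjective ε
  comp_d : ε ∘ₗ d = 0
  eq_zero : ∀ r j, (r, j) ≠ (0, 0) → ∀ y ∈ ℳ r j, ε y = 0
  exact_zero : ∀ j, ∀ y ∈ ℳ 0 j, ε y = 0 → ∃ w ∈ ℳ 1 j, d w = y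

variable {𝒜} {ℳ : ℕ → ℕ → Submodule k M} {d : M →ₗ[R] M}
  {ℳ' : ℕ → ℕ → Submodule k M'} {d' : M' →ₗ[R] M'}

omit [IsScalarTower k R M] in
theorem IsGradedFreeResolution.exists_isAugmentation (hM : IsGradedFreeResolution 𝒜 ℳ d) :
    ∃ ε, IsAugmentation 𝒜 ℳ d ε := by
  obtain ⟨ε, h1, h2, h3, h4⟩ := hM.augmentation
  exact ⟨ε, h1, h2, h3, h4⟩

omit [IsScalarTower k R M] in
theorem IsGradedFreeResolution.exists_boundary (hM : IsGradedFreeResolution 𝒜 ℳ d)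
    {ε : M →ₗ[R] Residue 𝒜} (hε : IsAugmentation 𝒜 ℳ d ε) {r j : ℕ} {y : M} (hy : y ∈ ℳ r j)
    (hdy : d y = 0) (hεy : r = 0 → ε y = 0) : ∃ w ∈ ℳ (r + 1) j, d w = y := by
  rcases r with _ | r
  · exact hε.exact_zero j y hy (hεy rfl)
  · exact hM.exact_succ r j y hy hdy

omit [IsScalarTower k R M] in
theorem IsGradedFreeResolution.d_d (hM : IsGradedFreeResolution 𝒜 ℳ d) (y : M) : d (d y) = 0 :=
  LinearMap.congr_fun hM.d_comp_d y

omit [IsScalarTower k R M] in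
theorem IsAugmentation.apply_d {ε : M →ₗ[R] Residue 𝒜} (hε : IsAugmentation 𝒜 ℳ d ε) (y : M) :
    ε (d y) = 0 :=
  LinearMap.congr_fun hε.comp_d y

omit [GradedAlgebra 𝒜] in
/-- Two linear maps that agree on the basis elements of homological degree `r` agree on the
pieces of homological degree `r`. -/
theorem eq_of_mem_gradedPiece {β : Type*} {e : Module.Basis β R M} {h g : β → ℕ} {r j : ℕ}
    {M' : Type*} [AddCommGroup M'] [Module R M'] {φ ψ : M →ₗ[R] M'}
    (hφ : ∀ b, h b = r → φ (e b) = ψ (e b)) {y : M}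
    (hy : y ∈ gradedPiece 𝒜 e h g r j) : φ y = ψ y := by
  have hk : ∀ (c : k) (y : M), c • y = algebraMap k R c • y := fun c y =>
    (algebraMap_smul R c y).symm
  induction hy using Submodule.span_induction with
  | mem y hy =>
    obtain ⟨b, p, a, hr, -, -, rfl⟩ := hy
    rw [map_smul, map_smul, hφ b hr]
  | zero => simp
  | add y y' _ _ h1 h2 => rw [map_add, map_add, h1, h2]
  | smul c y _ h1 => rw [hk, map_smul, map_smul, h1]

/-- The identity of `k` lifts to a bigraded chain map between graded free resolutions. -/
theorem IsGradedFreeResolution.exists_lift (hM : IsGradedFreeResolution 𝒜 ℳ d)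
    (hM' : IsGradedFreeResolution 𝒜 ℳ' d') {ε : M →ₗ[R] Residue 𝒜} {ε' : M' →ₗ[R] Residue 𝒜}
    (hε : IsAugmentation 𝒜 ℳ d ε) (hε' : IsAugmentation 𝒜 ℳ' d' ε') :
    ∃ f : M →ₗ[R] M', (∀ r j, ∀ y ∈ ℳ r j, f y ∈ ℳ' r j) ∧ (∀ y, f (d y) = d' (f y)) ∧
      ∀ y, ε' (f y) = ε y := by
  obtain ⟨β, e, h, g, hfree⟩ := hM.free
  obtain ⟨β', e', h', g', hfree'⟩ := hM'.free
  obtain rfl : ℳ = gradedPiece 𝒜 e h g := funext fun r => funext fun j => hfree r j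
  obtain rfl : ℳ' = gradedPiece 𝒜 e' h' g' := funext fun r => funext fun j => hfree' r j
  clear hfree hfree'
  have hd : ∀ b, (h b = 0 ∧ d (e b) = 0) ∨
      ∃ r, h b = r + 1 ∧ d (e b) ∈ gradedPiece 𝒜 e h g r (g b) := by
    intro b
    have hb := basis_mem_gradedPiece 𝒜 e (h := h) (g := g) b
    rcases hr : h b with _ | r
    · rw [hr] at hb; exact .inl ⟨rfl, hM.map_zero _ _ hb⟩
    · rw [hr] at hb; exact .inr ⟨r, rfl, hM.map_succ _ _ _ hb⟩
  have hproj : ∀ y, ε' (gradedProj 𝒜 e' h' g' 0 0 y) = ε' y := by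
    intro y
    induction y using gradedPiece_induction 𝒜 e' with
    | hzero => simp
    | hadd y y' h1 h2 => simp only [map_add, h1, h2]
    | hmem b p a ha =>
      have hmem := smul_mem_gradedPiece 𝒜 e' ha (h := h') (g := g') (b := b) rfl rfl
      by_cases hb : h' b = 0 ∧ p + g' b = 0
      · rw [hb.1, hb.2] at hmem
        rw [gradedProj_of_mem _ _ hmem]
      · rw [gradedProj_of_mem_ne 𝒜 e' hmem hb, _root_.map_zero, hε'.eq_zero _ _ _ _ hmem]
        simpa using hb
  refine (exists_linearMap_of_recursion e h
    (fun b (f : M →ₗ[R] M') v => v ∈ gradedPiece 𝒜 e' h' g' (h b) (g b) ∧ d' v = f (d (e b)) ∧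
      (h b = 0 → ε' v = ε (e b))) ?_ ?_).elim fun f hf => ?_
  · rintro b φ ψ v hφ ⟨h1, h2, h3⟩
    refine ⟨h1, h2.trans ?_, h3⟩
    obtain ⟨-, h0⟩ | ⟨r, hr, hr'⟩ := hd b
    · simp [h0]
    · exact eq_of_mem_gradedPiece (fun b' hb' => hφ b' (by omega)) hr'
  · intro f b hf
    obtain ⟨h0, h0'⟩ | ⟨r, hr, hr'⟩ := hd b
    · by_cases hg : g b = 0
      · obtain ⟨w, hw⟩ := hε'.surjective (ε (e b))
        have hmem := gradedProj_mem 𝒜 e' (h := h') (g := g') 0 0 w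
        exact ⟨_, by rwa [h0, hg], by rw [hM'.map_zero _ _ hmem, h0', _root_.map_zero],
          fun _ => by rw [hproj, hw]⟩
      · refine ⟨0, zero_mem _, by simp [h0'], fun _ => ?_⟩
        rw [_root_.map_zero, hε.eq_zero _ _ (by simp [hg]) _
          (basis_mem_gradedPiece 𝒜 e (h := h) (g := g) b)]
    · have h1 := eq_of_mem_gradedPiece (φ := d' ∘ₗ f) (ψ := f ∘ₗ d)
        (fun b' hb' => (hf b' (by omega)).2.1) hr'
      have h2 : r = 0 → ε' (f (d (e b))) = 0 := by
        rintro rfl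
        have := eq_of_mem_gradedPiece (φ := ε' ∘ₗ f) (ψ := ε)
          (fun b' hb' => (hf b' (by omega)).2.2 hb') hr'
        exact this.trans (hε.apply_d _)
      obtain ⟨w, hw, hdw⟩ := hM'.exists_boundary hε' (r := r) (j := g b) (y := f (d (e b)))
        (map_mem_gradedPiece 𝒜 e e' f
          (by rintro b' rfl; exact (hf b' (by omega)).1) hr') (by simpa [hM.d_d] using h1) h2
      exact ⟨w, by rwa [hr], hdw, by omega⟩
  · refine ⟨f, fun r j y hy => map_mem_gradedPiece 𝒜 e e' f ?_ hy, fun y => ?_, fun y => ?_⟩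
    · rintro b rfl; exact (hf b).1
    · have : f ∘ₗ d = d' ∘ₗ f := e.ext fun b => (hf b).2.1.symm
      exact LinearMap.congr_fun this y
    · have : ε' ∘ₗ f = ε := e.ext fun b => by
        by_cases hb : h b = 0
        · exact (hf b).2.2 hb
        · rw [hε.eq_zero _ _ (by simp [hb]) _ (basis_mem_gradedPiece 𝒜 e (h := h) (g := g) b)]
          exact hε'.eq_zero _ _ (by simp [hb]) _ (hf b).1
      exact LinearMap.congr_fun this y

/-- A bigraded chain map between graded free resolutions that induces zero on `k` is homotopic
to zero. -/
theorem IsGradedFreeResolution.exists_homotopy (hM : IsGradedFreeResolution 𝒜 ℳ d)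
    (hM' : IsGradedFreeResolution 𝒜 ℳ' d') {ε' : M' →ₗ[R] Residue 𝒜}
    (hε' : IsAugmentation 𝒜 ℳ' d' ε') (f : M →ₗ[R] M')
    (hf : ∀ r j, ∀ y ∈ ℳ r j, f y ∈ ℳ' r j) (hfd : ∀ y, f (d y) = d' (f y))
    (hεf : ∀ y, ε' (f y) = 0) :
    ∃ s : M →ₗ[R] M', (∀ r j, ∀ y ∈ ℳ r j, s y ∈ ℳ' (r + 1) j) ∧
      f = d' ∘ₗ s + s ∘ₗ d := by
  obtain ⟨β, e, h, g, hfree⟩ := hM.free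
  obtain ⟨β', e', h', g', hfree'⟩ := hM'.free
  obtain rfl : ℳ = gradedPiece 𝒜 e h g := funext fun r => funext fun j => hfree r j
  obtain rfl : ℳ' = gradedPiece 𝒜 e' h' g' := funext fun r => funext fun j => hfree' r j
  clear hfree hfree'
  have hd : ∀ b, (h b = 0 ∧ d (e b) = 0) ∨
      ∃ r, h b = r + 1 ∧ d (e b) ∈ gradedPiece 𝒜 e h g r (g b) := by
    intro b
    have hb := basis_mem_gradedPiece 𝒜 e (h := h) (g := g) b
    rcases hr : h b with _ | r
    · rw [hr] at hb; exact .inl ⟨rfl, hM.map_zero _ _ hb⟩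
    · rw [hr] at hb; exact .inr ⟨r, rfl, hM.map_succ _ _ _ hb⟩
  refine (exists_linearMap_of_recursion e h
    (fun b (s : M →ₗ[R] M') v => v ∈ gradedPiece 𝒜 e' h' g' (h b + 1) (g b) ∧
      d' v = f (e b) - s (d (e b))) ?_ ?_).elim fun s hs => ?_
  · rintro b φ ψ v hφ ⟨h1, h2⟩
    refine ⟨h1, h2.trans (congrArg _ ?_)⟩
    obtain ⟨-, h0⟩ | ⟨r, hr, hr'⟩ := hd b
    · simp [h0]
    · exact eq_of_mem_gradedPiece (fun b' hb' => hφ b' (by omega)) hr'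
  · intro s b hs
    have hfb := hf _ _ _ (basis_mem_gradedPiece 𝒜 e (h := h) (g := g) b)
    refine hM'.exists_boundary hε' (r := h b) (j := g b) ?_ ?_ ?_
    · obtain ⟨h0, h0'⟩ | ⟨r, hr, hr'⟩ := hd b
      · simpa [h0'] using hfb
      · refine sub_mem hfb ?_
        rw [hr]
        exact map_mem_gradedPiece 𝒜 e e' s (by rintro b' rfl; exact (hs b' (by omega)).1) hr'
    · obtain ⟨h0, h0'⟩ | ⟨r, hr, hr'⟩ := hd b
      · rw [h0', _root_.map_zero, sub_zero, ← hfd, h0', _root_.map_zero]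
      · have := eq_of_mem_gradedPiece (𝒜 := 𝒜) (φ := d' ∘ₗ s) (ψ := f - s ∘ₗ d)
          (fun b' hb' => (hs b' (by omega)).2) hr'
        rw [map_sub, ← hfd, sub_eq_zero]
        simpa [hM.d_d] using this.symm
    · intro h0
      obtain ⟨h0, h0'⟩ | ⟨r, hr, hr'⟩ := hd b
      · rw [h0', _root_.map_zero, sub_zero, hεf]
      · omega
  · refine ⟨s, fun r j y hy => map_mem_gradedPiece 𝒜 e e' s ?_ hy, e.ext fun b => ?_⟩
    · rintro b rfl; exact (hs b).1
    · simp [(hs b).2]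

theorem lTensor_mem_residueDeg (φ : M →ₗ[R] M') {r r' j j' : ℕ}
    (hφ : ∀ y ∈ ℳ r j, φ y ∈ ℳ' r' j') :
    ∀ y ∈ residueDeg 𝒜 ℳ r j, φ.lTensor (Residue 𝒜) y ∈ residueDeg 𝒜 ℳ' r' j' := by
  rintro _ ⟨y, hy, rfl⟩
  exact ⟨φ y, hφ y hy, rfl⟩

omit [Module k M] [IsScalarTower k R M] [Module k M'] [IsScalarTower k R M'] in
theorem lTensor_comm (φ : M →ₗ[R] M') (hφ : ∀ y, φ (d y) = d' (φ y))
    (y : Residue 𝒜 ⊗[R] M) : φ.lTensor (Residue 𝒜) (d.lTensor (Residue 𝒜) y) =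
      d'.lTensor (Residue 𝒜) (φ.lTensor (Residue 𝒜) y) := by
  rw [← LinearMap.lTensor_comp_apply, ← LinearMap.lTensor_comp_apply]
  exact congrArg (fun ψ => LinearMap.lTensor (Residue 𝒜) ψ y) (LinearMap.ext hφ)

omit [Module k M] [IsScalarTower k R M] [Module k M'] [IsScalarTower k R M'] in
theorem lTensor_homotopy (f : M →ₗ[R] M') (g : M' →ₗ[R] M) (s : M →ₗ[R] M)
    (hs : g ∘ₗ f - LinearMap.id = d ∘ₗ s + s ∘ₗ d) (y : Residue 𝒜 ⊗[R] M)
    (hy : d.lTensor (Residue 𝒜) y = 0) : d.lTensor (Residue 𝒜) (s.lTensor (Residue 𝒜) y) =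
      g.lTensor (Residue 𝒜) (f.lTensor (Residue 𝒜) y) - y := by
  have h := congrArg (fun φ => LinearMap.lTensor (Residue 𝒜) φ y) hs
  simp only [LinearMap.lTensor_sub, LinearMap.lTensor_add, LinearMap.lTensor_comp,
    LinearMap.lTensor_id, LinearMap.sub_apply, LinearMap.add_apply, LinearMap.comp_apply,
    LinearMap.id_apply] at h
  rw [hy, _root_.map_zero, add_zero] at h
  exact h.symm

/-- `Tor_{r,j}^R(k, k)` does not depend on the graded free resolution. -/
theorem nonempty_biTor_equiv (hM : IsGradedFreeResolution 𝒜 ℳ d)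
    (hM' : IsGradedFreeResolution 𝒜 ℳ' d') (r j : ℕ) :
    Nonempty (BiTor 𝒜 ℳ d r j ≃ₗ[k] BiTor 𝒜 ℳ' d' r j) := by
  obtain ⟨ε, hε⟩ := hM.exists_isAugmentation
  obtain ⟨ε', hε'⟩ := hM'.exists_isAugmentation
  obtain ⟨f, hf, hfd, hfε⟩ := hM.exists_lift hM' hε hε'
  obtain ⟨g, hg, hgd, hgε⟩ := hM'.exists_lift hM hε' hε
  obtain ⟨s, hs, hsd⟩ := hM.exists_homotopy hM hε (g ∘ₗ f - LinearMap.id)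
    (fun r j y hy => sub_mem (hg _ _ _ (hf _ _ _ hy)) hy) (by simp [hfd, hgd])
    (by simp [hfε, hgε])
  obtain ⟨s', hs', hsd'⟩ := hM'.exists_homotopy hM' hε' (f ∘ₗ g - LinearMap.id)
    (fun r j y hy => sub_mem (hf _ _ _ (hg _ _ _ hy)) hy) (by simp [hfd, hgd])
    (by simp [hfε, hgε])
  exact nonempty_homology_equiv (N := fun s => residueDeg 𝒜 ℳ s j)
    (N' := fun s => residueDeg 𝒜 ℳ' s j)
    ((f.lTensor (Residue 𝒜)).restrictScalars k)
    ((g.lTensor (Residue 𝒜)).restrictScalars k) r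
    (fun r => lTensor_mem_residueDeg f (hf r j)) (fun r => lTensor_mem_residueDeg g (hg r j))
    (lTensor_comm f hfd) (lTensor_comm g hgd)
    (fun y hy hdy => ⟨s.lTensor _ y, lTensor_mem_residueDeg s (hs r j) y hy,
      lTensor_homotopy f g s hsd y hdy⟩)
    (fun y hy hdy => ⟨s'.lTensor _ y, lTensor_mem_residueDeg s' (hs' r j) y hy,
      lTensor_homotopy g f s' hsd' y hdy⟩)

end Comparison

/-! ### Tor from a minimal resolution -/

section Tor

open CategoryTheory

variable {R : Type u} [CommRing R] (N : ℕ → Type u) [∀ i, AddCommGroup (N i)]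
  [∀ i, Module R (N i)] (d : ∀ i, N (i + 1) →ₗ[R] N i)

/-- The chain complex of modules with terms `N i` and differentials `d i`. -/
def moduleComplex (hdd : ∀ i, d i ∘ₗ d (i + 1) = 0) : ChainComplex (ModuleCat.{u} R) ℕ :=
  ChainComplex.of (fun i => ModuleCat.of R (N i)) (fun i => ModuleCat.ofHom (d i))
    (fun i => by rw [← ModuleCat.ofHom_comp, hdd]; rfl)

theorem moduleComplex_d (hdd : ∀ i, d i ∘ₗ d (i + 1) = 0) (i : ℕ) :
    (moduleComplex N d hdd).d (i + 1) i = ModuleCat.ofHom (d i) :=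
  ChainComplex.of_d (fun i => ModuleCat.of R (N i)) (fun i => ModuleCat.ofHom (d i)) i

/-- An exact sequence `⋯ → N 1 → N 0 → A → 0` of modules with projective `N i` as a projective
resolution. -/
def moduleResolution {A : Type u} [AddCommGroup A] [Module R A] [∀ i, Module.Projective R (N i)]
    (hdd : ∀ i, d i ∘ₗ d (i + 1) = 0) (ε : N 0 →ₗ[R] A) (hε : Function.Surjective ε)
    (hex : ∀ i, LinearMap.range (d (i + 1)) = LinearMap.ker (d i))
    (hex0 : LinearMap.range (d 0) = LinearMap.ker ε) :
    ProjectiveResolution (ModuleCat.of R A) where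
  complex := moduleComplex N d hdd
  projective i := (IsProjective.iff_projective (N i)).1 inferInstance
  π := (ChainComplex.toSingle₀Equiv (moduleComplex N d hdd) (ModuleCat.of R A)).symm
    ⟨ModuleCat.ofHom ε, by
      rw [moduleComplex_d]
      ext y
      exact (hex0.le ⟨y, rfl⟩ : d 0 y ∈ LinearMap.ker ε)⟩
  quasiIso := ⟨fun i => by
    rcases i with _ | i
    · rw [ChainComplex.quasiIsoAt₀_iff, ShortComplex.quasiIso_iff_of_zeros' _ rfl rfl rfl]
      constructor
      · rw [ShortComplex.moduleCat_exact_iff_range_eq_ker]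
        simpa [ChainComplex.toSingle₀Equiv, moduleComplex_d] using! hex0
      · rw [ModuleCat.epi_iff_surjective]
        intro a
        obtain ⟨y, hy⟩ := hε a
        exact ⟨y, by simpa [ChainComplex.toSingle₀Equiv] using! hy⟩
    · rw [quasiIsoAt_iff_exactAt' (hL := ChainComplex.exactAt_succ_single_obj ..),
        HomologicalComplex.exactAt_iff' _ (i + 2) (i + 1) i (by simp) (by simp),
        ShortComplex.moduleCat_exact_iff_range_eq_ker]
      simpa [moduleComplex_d] using! hex i⟩

/-- If the differentials of a projective resolution `N` of `A` vanish after tensoring with `B`,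
then `Tor_r(B, A) = B ⊗ N_r`. -/
theorem nonempty_tor_equiv {A B : Type u} [AddCommGroup A] [Module R A] [AddCommGroup B]
    [Module R B] [∀ i, Module.Projective R (N i)]
    (hdd : ∀ i, d i ∘ₗ d (i + 1) = 0) (ε : N 0 →ₗ[R] A) (hε : Function.Surjective ε)
    (hex : ∀ i, LinearMap.range (d (i + 1)) = LinearMap.ker (d i))
    (hex0 : LinearMap.range (d 0) = LinearMap.ker ε) (hB : ∀ i, (d i).lTensor B = 0) (r : ℕ) :
    Nonempty ((((CategoryTheory.Tor (ModuleCat.{u} R) r).obj (ModuleCat.of R B)).obj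
      (ModuleCat.of R A)) ≃ₗ[R] B ⊗[R] N r) := by
  let P := moduleResolution N d hdd ε hε hex hex0
  let K := (((MonoidalCategory.tensoringLeft (ModuleCat.{u} R)).obj
    (ModuleCat.of R B)).mapHomologicalComplex (ComplexShape.down ℕ)).obj P.complex
  have hK : ∀ i, K.d (i + 1) i = 0 := by
    intro i
    change MonoidalCategory.whiskerLeft (ModuleCat.of R B) ((moduleComplex N d hdd).d (i + 1) i)
      = 0
    rw [moduleComplex_d]
    exact ModuleCat.hom_ext (hB i)
  have hprev : K.d ((ComplexShape.down ℕ).prev r) r = 0 := by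
    rw [ChainComplex.prev]; exact hK r
  have hnext : K.d r ((ComplexShape.down ℕ).next r) = 0 := by
    rcases r with _ | r
    · exact K.shape _ _ (by simp)
    · rw [ChainComplex.next_nat_succ]; exact hK r
  have : IsIso (K.homologyπ r) := K.isIso_homologyπ _ r rfl hprev
  exact ⟨((P.isoLeftDerivedObj _ r) ≪≫ (asIso (K.homologyπ r)).symm ≪≫
    K.iCyclesIso r _ rfl hnext).toLinearEquiv⟩

end Tor

section Minimal

variable {k R : Type u} [Field k] [CommRing R] [Algebra k R]
variable {𝒜 : ℕ → Submodule k R} [GradedAlgebra 𝒜]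
variable {M : Type u} [AddCommGroup M] [Module k M] [Module R M] [IsScalarTower k R M]
variable {β : Type u} (e : Module.Basis β R M) {h g : β → ℕ} {d : M →ₗ[R] M}

theorem mem_plusIdeal_iff {a : R} : a ∈ plusIdeal 𝒜 ↔ GradedAlgebra.proj 𝒜 0 a = 0 :=
  HomogeneousIdeal.mem_irrelevant_iff 𝒜 a

theorem mem_plusIdeal_of_mem {a : R} {p : ℕ} (ha : a ∈ 𝒜 p) (hp : p ≠ 0) : a ∈ plusIdeal 𝒜 := by
  rw [mem_plusIdeal_iff, proj_of_mem ha, if_neg hp]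

theorem IsStandardGraded.algebraMap_residue_bijective (hR : IsStandardGraded 𝒜) :
    Function.Bijective (algebraMap k (Residue 𝒜)) := by
  have := hR.nontrivial
  have : Nontrivial (Residue 𝒜) := by
    refine Ideal.Quotient.nontrivial_iff.2 ((Ideal.ne_top_iff_one _).2 fun h1 => ?_)
    rw [mem_plusIdeal_iff, proj_of_mem (SetLike.GradedOne.one_mem (A := 𝒜)), if_pos rfl] at h1
    exact one_ne_zero h1
  refine ⟨(algebraMap k (Residue 𝒜)).injective, fun y => ?_⟩
  obtain ⟨a, rfl⟩ := Ideal.Quotient.mk_surjective y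
  have h0 : GradedAlgebra.proj 𝒜 0 a ∈ 𝒜 0 := by
    rw [GradedAlgebra.proj_apply]; exact SetLike.coe_mem _
  have h1 := h0
  rw [hR.zero_eq] at h1
  obtain ⟨c, hc⟩ := Submodule.mem_one.1 h1
  refine ⟨c, ?_⟩
  change Ideal.Quotient.mk _ (algebraMap k R c) = _
  rw [hc, Ideal.Quotient.eq, mem_plusIdeal_iff, map_sub, proj_of_mem h0, if_pos rfl, sub_self]

/-- A basis of `M` over `R` gives a basis of `k ⊗_R M` over `k`. -/
def residueBasis (hR : IsStandardGraded 𝒜) : Module.Basis β k (Residue 𝒜 ⊗[R] M) :=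
  (Algebra.TensorProduct.basis (Residue 𝒜) e).mapCoeffs
    (RingEquiv.ofBijective _ hR.algebraMap_residue_bijective).symm (fun c y => by
      obtain ⟨c, rfl⟩ := (RingEquiv.ofBijective _ hR.algebraMap_residue_bijective).surjective c
      rw [RingEquiv.symm_apply_apply, RingEquiv.coe_ofBijective, algebraMap_smul])

omit [Module k M] [IsScalarTower k R M] in
theorem residueBasis_apply (hR : IsStandardGraded 𝒜) (b : β) :
    residueBasis e hR b = 1 ⊗ₜ e b :=
  (Module.Basis.mapCoeffs_apply _ _ _ b).trans (Algebra.TensorProduct.basis_apply e b)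

omit [Module k M] [IsScalarTower k R M] in
/-- The differential of a minimal complex vanishes after tensoring with `k`. -/
theorem lTensor_residue_eq_zero {M' : Type u} [AddCommGroup M'] [Module R M'] {d : M' →ₗ[R] M}
    (hd : LinearMap.range d ≤ plusIdeal 𝒜 • (⊤ : Submodule R M)) :
    d.lTensor (Residue 𝒜) = 0 := by
  refine TensorProduct.ext' fun c y => ?_
  rw [LinearMap.lTensor_tmul, LinearMap.zero_apply]
  have hy := hd ⟨y, rfl⟩
  generalize d y = m at hy
  induction hy using Submodule.smul_induction_on' with
  | smul a ha m hm =>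
    obtain ⟨c, rfl⟩ := Ideal.Quotient.mk_surjective c
    rw [← TensorProduct.smul_tmul]
    change Ideal.Quotient.mk _ (a * c) ⊗ₜ[R] m = 0
    rw [Ideal.Quotient.eq_zero_iff_mem.2 (Ideal.mul_mem_right _ _ ha), TensorProduct.zero_tmul]
  | add y _ y' _ h1 h2 => rw [TensorProduct.tmul_add, h1, h2, add_zero]

/-- Only the basis elements themselves contribute to the graded pieces of `k ⊗_R M`, since `R_+` acts
as zero. -/
theorem residueDeg_eq_span (hR : IsStandardGraded 𝒜) (r j : ℕ) :
    residueDeg 𝒜 (gradedPiece 𝒜 e h g) r j =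
      Submodule.span k (residueBasis e hR '' {b | h b = r ∧ g b = j}) := by
  refine le_antisymm ?_ (Submodule.span_le.2 ?_)
  · refine Submodule.map_le_iff_le_comap.2 (Submodule.span_le.2 ?_)
    rintro _ ⟨b, q, a, hb, hq, ha, rfl⟩
    rw [SetLike.mem_coe, Submodule.mem_comap]
    change (1 : Residue 𝒜) ⊗ₜ[R] (a • e b) ∈
      Submodule.span k (residueBasis e hR '' {b | h b = r ∧ g b = j})
    rcases eq_or_ne q 0 with rfl | hq0
    · rw [hR.zero_eq] at ha
      obtain ⟨c, rfl⟩ := Submodule.mem_one.1 ha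
      rw [TensorProduct.tmul_smul, algebraMap_smul, ← residueBasis_apply e hR]
      exact Submodule.smul_mem _ _ (Submodule.subset_span ⟨b, ⟨hb, by omega⟩, rfl⟩)
    · rw [← TensorProduct.smul_tmul, Algebra.smul_def, mul_one]
      have h0 : (algebraMap R (Residue 𝒜)) a = 0 :=
        Ideal.Quotient.eq_zero_iff_mem.2 (mem_plusIdeal_of_mem ha hq0)
      rw [h0, TensorProduct.zero_tmul]
      exact zero_mem _
  · rintro _ ⟨b, ⟨rfl, rfl⟩, rfl⟩
    exact ⟨e b, basis_mem_gradedPiece 𝒜 e b, (residueBasis_apply e hR b).symm⟩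

/-- The homology of a complex with zero differential whose pieces are spanned by parts of a
basis. -/
theorem nonempty_homology_basis_of_zero {V : Type u} [AddCommGroup V] [Module k V]
    (z : Module.Basis β k V) (S : ℕ → Set β) (N : ℕ → Submodule k V)
    (hN : ∀ r, N r = Submodule.span k (z '' S r)) (r : ℕ) :
    Nonempty (Module.Basis (S r) k (Homology N 0 r)) := by
  classical
  let p : ℕ → V →ₗ[k] V := fun s => z.constr k fun b => if b ∈ S s then z b else 0
  have hpz : ∀ s b, p s (z b) = if b ∈ S s then z b else 0 := fun s b => z.constr_basis k _ b
  have hzN : ∀ s, ∀ b ∈ S s, z b ∈ N s := fun s b hb => by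
    rw [hN]; exact Submodule.subset_span ⟨b, hb, rfl⟩
  refine nonempty_homology_basis r (p r) (p (r + 1)) ?_ ?_ (by simp) z (by simp) ?_ ?_ _
    (hzN r) (fun b hb => (hpz r b).trans (if_neg hb))
  · rw [hN]
    refine (Submodule.span_le (p := LinearMap.eqLocus (p r) LinearMap.id)).2 ?_
    rintro _ ⟨b, hb, rfl⟩
    exact (hpz r b).trans (if_pos hb)
  · intro y
    induction z.mem_span y using Submodule.span_induction with
    | mem y hy =>
      obtain ⟨b, rfl⟩ := hy
      rw [hpz]
      split_ifs with hb
      · exact hzN _ b hb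
      · exact zero_mem _
    | zero => simp
    | add y y' _ _ h1 h2 => rw [map_add]; exact add_mem h1 h2
    | smul c y _ h1 => rw [map_smul]; exact Submodule.smul_mem _ _ h1
  · intro y _
    exact ⟨z.repr y, 0, by rw [z.linearCombination_repr, map_zero, zero_add]⟩
  · intro c w hc
    exact linearIndependent_iff.1 z.linearIndependent c hc

/-- For a minimal complex `M` over `R`, the basis elements of bidegree `(r, j)` give a basis of
`H_{r,j}(k ⊗_R M)`. -/
theorem nonempty_biTor_basis (hR : IsStandardGraded 𝒜)
    (hd : LinearMap.range d ≤ plusIdeal 𝒜 • (⊤ : Submodule R M)) (r j : ℕ) :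
    Nonempty (Module.Basis {b | h b = r ∧ g b = j} k
      (BiTor 𝒜 (gradedPiece 𝒜 e h g) d r j)) := by
  have h0 : (d.lTensor (Residue 𝒜)).restrictScalars k = 0 := by
    rw [lTensor_residue_eq_zero hd]; rfl
  change Nonempty (Module.Basis _ k (Homology (fun s => residueDeg 𝒜 (gradedPiece 𝒜 e h g) s j)
    ((d.lTensor (Residue 𝒜)).restrictScalars k) r))
  rw [h0]
  exact nonempty_homology_basis_of_zero (residueBasis e hR) (fun s => {b | h b = s ∧ g b = j})
    (fun s => residueDeg 𝒜 (gradedPiece 𝒜 e h g) s j) (fun s => residueDeg_eq_span e hR s j) r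

/-- For a minimal free resolution `M` of `k` over `R`, the basis elements of homological degree
`r` give a basis of `Tor_r(k, k)`. -/
theorem nonempty_tor_basis (hR : IsStandardGraded 𝒜)
    (hd : LinearMap.range d ≤ plusIdeal 𝒜 • (⊤ : Submodule R M))
    (hsucc : ∀ r j, ∀ y ∈ gradedPiece 𝒜 e h g (r + 1) j, d y ∈ gradedPiece 𝒜 e h g r j)
    (hzero : ∀ j, ∀ y ∈ gradedPiece 𝒜 e h g 0 j, d y = 0) (hdd : ∀ y, d (d y) = 0)
    (ε : M →ₗ[R] Residue 𝒜) (hε : Function.Surjective ε) (hεd : ∀ y, ε (d y) = 0)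
    (hεh : ∀ b, h b ≠ 0 → ε (e b) = 0)
    (hex : ∀ y, d y = 0 → ε y = 0 → ∃ w, d w = y) (r : ℕ) :
    Nonempty (Module.Basis {b | h b = r} k (TorKK 𝒜 r)) := by
  classical
  have hd1 : ∀ r, ∀ y ∈ homPiece e h (r + 1), d y ∈ homPiece e h r := fun r =>
    (homPiece_le_iff e (N := (homPiece e h r).comap d)).2 fun b hb => by
      have hmem := basis_mem_gradedPiece 𝒜 e (h := h) (g := g) b
      rw [hb] at hmem
      exact gradedPiece_le_homPiece e 𝒜 g _ _ (hsucc _ _ _ hmem)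
  have hd0 : ∀ y ∈ homPiece e h 0, d y = 0 :=
    (homPiece_le_iff e (N := LinearMap.ker d)).2 fun b hb => by
      have hmem := basis_mem_gradedPiece 𝒜 e (h := h) (g := g) b
      rw [hb] at hmem
      exact hzero _ _ hmem
  have hpd := homProj_comm e hd1 hd0
  have hεp : ∀ y, ε (homProj e h 0 y) = ε y := by
    refine LinearMap.congr_fun (f := ε ∘ₗ homProj e h 0) (g := ε) (e.ext fun b => ?_)
    rw [LinearMap.comp_apply, homProj_basis]
    split_ifs with hb
    · rfl
    · rw [map_zero, hεh b hb]
  have hεN : ∀ r, ∀ y ∈ homPiece e h (r + 1), ε y = 0 := fun r =>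
    (homPiece_le_iff e (N := LinearMap.ker ε)).2 fun b hb => hεh b (by omega)
  let eN : ∀ r, Module.Basis {b | h b = r} R (homPiece e h r) := fun r =>
    (Module.Basis.span (e.linearIndependent.comp (Subtype.val : {b | h b = r} → β)
      Subtype.val_injective)).map (LinearEquiv.ofEq _ _ (by
        rw [Set.range_comp, Subtype.range_val, homPiece]))
  have : ∀ i, Module.Projective R (homPiece e h i) := fun i => Module.Projective.of_basis (eN i)
  let dN : ∀ i, homPiece e h (i + 1) →ₗ[R] homPiece e h i := fun i => d.restrict (hd1 i)
  have hmin : ∀ i, LinearMap.range (dN i) ≤ plusIdeal 𝒜 • (⊤ : Submodule R (homPiece e h i)) := by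
    rintro i _ ⟨y, rfl⟩
    have hy : homProj e h i (d y) ∈ plusIdeal 𝒜 • homPiece e h i := by
      have := Submodule.mem_map_of_mem (f := homProj e h i) (hd ⟨y, rfl⟩)
      rw [Submodule.map_smul''] at this
      refine Submodule.smul_mono le_rfl ?_ this
      rintro _ ⟨y, -, rfl⟩
      exact homProj_mem e i y
    rw [homProj_of_mem e _ (hd1 i _ y.2)] at hy
    have : (plusIdeal 𝒜 • (⊤ : Submodule R (homPiece e h i))).map (homPiece e h i).subtype =
        plusIdeal 𝒜 • homPiece e h i := by
      rw [Submodule.map_smul'', Submodule.map_subtype_top]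
    rw [← this] at hy
    obtain ⟨y', hy', hyy'⟩ := hy
    have : dN i y = y' := Subtype.ext hyy'.symm
    rwa [this]
  have hsurj : Function.Surjective (ε ∘ₗ (homPiece e h 0).subtype) := fun c => by
    obtain ⟨y, rfl⟩ := hε c
    exact ⟨⟨homProj e h 0 y, homProj_mem e 0 y⟩, hεp y⟩
  have hexN : ∀ i, LinearMap.range (dN (i + 1)) = LinearMap.ker (dN i) := by
    refine fun i => le_antisymm ?_ ?_
    · rintro _ ⟨y, rfl⟩; exact Subtype.ext (hdd y)
    · intro y hy
      obtain ⟨w, hw⟩ := hex y (congrArg Subtype.val hy) (hεN i y y.2)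
      refine ⟨⟨homProj e h (i + 2) w, homProj_mem e _ w⟩, Subtype.ext ?_⟩
      change d (homProj e h (i + 1 + 1) w) = y
      rw [← hpd, hw, homProj_of_mem e _ y.2]
  have hex0 : LinearMap.range (dN 0) = LinearMap.ker (ε ∘ₗ (homPiece e h 0).subtype) := by
    refine le_antisymm ?_ ?_
    · rintro _ ⟨y, rfl⟩; exact hεd y
    · intro y hy
      obtain ⟨w, hw⟩ := hex y (hd0 y y.2) hy
      refine ⟨⟨homProj e h 1 w, homProj_mem e _ w⟩, Subtype.ext ?_⟩
      change d (homProj e h (0 + 1) w) = y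
      rw [← hpd, hw, homProj_of_mem e _ y.2]
  obtain ⟨φ⟩ := nonempty_tor_equiv (A := Residue 𝒜) (B := Residue 𝒜) (fun i => homPiece e h i) dN
    (fun i => LinearMap.ext fun y => Subtype.ext (hdd y)) (ε ∘ₗ (homPiece e h 0).subtype) hsurj
    hexN hex0 (fun i => lTensor_residue_eq_zero (hmin i)) r
  refine ⟨(residueBasis (eN r) hR).map
    ({ φ.symm.toAddEquiv with map_smul' := fun c y => ?_ } :
      (Residue 𝒜 ⊗[R] homPiece e h r) ≃ₗ[k] TorKK 𝒜 r)⟩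
  change φ.symm (c • y) = algebraMap k R c • φ.symm y
  rw [← map_smul, algebraMap_smul]

end Minimal

/-! ### The Koszul complex as a bigraded complex -/

section Koszul

theorem ιMulti_single_eq_prod {R : Type u} [CommRing R] {n r : ℕ} (f : Fin r → Fin n) :
    ExteriorAlgebra.ιMulti R r (fun s => Pi.single (f s) (1 : R)) =
      (List.ofFn fun s => T R (f s)).prod := by
  rw [ExteriorAlgebra.ιMulti_apply]; rfl

/-- The basis of the Koszul complex consisting of the products of distinct `T_i`. -/
def koszulBasis (R : Type u) [CommRing R] (n : ℕ) :
    Module.Basis (Finset (Fin n)) R (Koszul R n) :=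
  (Pi.basisFun R (Fin n)).ExteriorAlgebra

/-- The indices of the factors of a basis element do not depend on the ring, which allows passing
between `R` and `k`. -/
theorem koszulBasis_eq (n : ℕ) (s : Finset (Fin n)) : ∃ f : Fin s.card → Fin n,
    ∀ (R : Type u) [CommRing R], koszulBasis R n s = (List.ofFn fun i => T R (f i)).prod := by
  refine ⟨Set.powersetCard.ofFinEmbEquiv.symm (Set.powersetCard.ofCard rfl), fun R _ => ?_⟩
  rw [koszulBasis, ExteriorAlgebra.basis_apply_ofCard _ rfl, ← ιMulti_single_eq_prod]
  change ExteriorAlgebra.ιMulti R _ _ = _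
  congr 1
  funext i
  exact Pi.basisFun_apply R (Fin n) _

theorem koszulBasis_empty (R : Type u) [CommRing R] (n : ℕ) : koszulBasis R n ∅ = 1 := by
  obtain ⟨f, hf⟩ := koszulBasis_eq n ∅
  rw [hf R, List.ofFn_congr Finset.card_empty, List.ofFn_zero, List.prod_nil]

variable {k R : Type u} [Field k] [CommRing R] [Algebra k R] {n : ℕ}

/-- The inclusion of the exterior algebra over `k` into the Koszul complex. -/
def koszulIncl (k R : Type u) [Field k] [CommRing R] [Algebra k R] (n : ℕ) :
    Koszul k n →ₐ[k] Koszul R n :=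
  ExteriorAlgebra.lift k
    ⟨(ExteriorAlgebra.ι R).restrictScalars k ∘ₗ (Algebra.linearMap k R).compLeft (Fin n),
      fun _ => ExteriorAlgebra.ι_sq_zero _⟩

theorem koszulIncl_ι (m : Fin n → k) : koszulIncl k R n (ExteriorAlgebra.ι k m) =
    ExteriorAlgebra.ι R fun i => algebraMap k R (m i) :=
  ExteriorAlgebra.lift_ι_apply _ _ _ _

theorem koszulIncl_T (i : Fin n) : koszulIncl k R n (T k i) = T R i := by
  rw [T, koszulIncl_ι, T]
  congr 1
  funext j
  by_cases hij : j = i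
  · subst hij; simp
  · simp [hij]

theorem koszulIncl_prod {r : ℕ} (f : Fin r → Fin n) :
    koszulIncl k R n (List.ofFn fun s => T k (f s)).prod = (List.ofFn fun s => T R (f s)).prod := by
  rw [map_list_prod, List.map_ofFn]
  congr 2
  funext s
  exact koszulIncl_T (f s)

theorem koszulIncl_basis (s : Finset (Fin n)) :
    koszulIncl k R n (koszulBasis k n s) = koszulBasis R n s := by
  obtain ⟨f, hf⟩ := koszulBasis_eq n s
  rw [hf k, hf R, koszulIncl_prod]

theorem prod_T_mem_exteriorPower {r : ℕ} (f : Fin r → Fin n) :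
    (List.ofFn fun s => T R (f s)).prod ∈ ⋀[R]^r (Fin n → R) := by
  rw [← ιMulti_single_eq_prod]
  exact ExteriorAlgebra.ιMulti_range R r ⟨_, rfl⟩

theorem koszulBasis_mem_exteriorPower (s : Finset (Fin n)) :
    koszulBasis R n s ∈ ⋀[R]^s.card (Fin n → R) := by
  obtain ⟨f, hf⟩ := koszulBasis_eq n s
  rw [hf R]
  exact prod_T_mem_exteriorPower f

theorem exteriorPower_eq_homPiece (R : Type u) [CommRing R] (n r : ℕ) :
    ⋀[R]^r (Fin n → R) = homPiece (koszulBasis R n) Finset.card r := by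
  refine le_antisymm ?_ ((homPiece_le_iff _).2 fun s hs => hs ▸ koszulBasis_mem_exteriorPower s)
  intro y hy
  have h := ((Pi.basisFun R (Fin n)).exteriorPower r).mem_span ⟨y, hy⟩
  have h' := Submodule.mem_map_of_mem (f := (⋀[R]^r (Fin n → R)).subtype) h
  rw [Submodule.map_span] at h'
  refine Submodule.span_mono ?_ h'
  rintro _ ⟨_, ⟨s, rfl⟩, rfl⟩
  exact ⟨s, s.2, ExteriorAlgebra.basis_eq_coe_basis (Pi.basisFun R (Fin n)) s⟩

/-- A product of `r` of the `T_i` is a linear combination over `k` of basis elements. -/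
theorem prod_T_mem_span {r : ℕ} (f : Fin r → Fin n) :
    (List.ofFn fun s => T R (f s)).prod ∈
      Submodule.span k (koszulBasis R n '' {s | s.card = r}) := by
  have h := prod_T_mem_exteriorPower (R := k) f
  rw [exteriorPower_eq_homPiece] at h
  have h' := Submodule.mem_map_of_mem (f := (koszulIncl k R n).toLinearMap) h
  rw [homPiece, Submodule.map_span, ← Set.image_comp] at h'
  rw [← koszulIncl_prod (k := k)]
  have hfun : ⇑(koszulIncl k R n).toLinearMap ∘ ⇑(koszulBasis k n) = koszulBasis R n :=
    funext fun s => koszulIncl_basis s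
  rwa [hfun] at h'

variable (𝒜 : ℕ → Submodule k R) [GradedAlgebra 𝒜]

omit [GradedAlgebra 𝒜] in
/-- The products of `r` of the `T_i` in the definition of the bigrading may be replaced by products of
distinct `T_i`, which form a basis. -/
theorem koszulDeg_eq (r j : ℕ) :
    koszulDeg 𝒜 n r j = gradedPiece 𝒜 (koszulBasis R n) Finset.card Finset.card r j := by
  refine le_antisymm (Submodule.span_le.2 ?_) (Submodule.span_le.2 ?_)
  · rintro _ ⟨p, a, f, rfl, ha, rfl⟩
    have h := prod_T_mem_span (k := k) (R := R) f
    generalize (List.ofFn fun s => T R (f s)).prod = y at h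
    induction h using Submodule.span_induction with
    | mem y hy =>
      obtain ⟨s, rfl, rfl⟩ := hy
      exact smul_mem_gradedPiece 𝒜 _ ha rfl rfl
    | zero => simp
    | add y y' _ _ h1 h2 => rw [smul_add]; exact add_mem h1 h2
    | smul c y _ h1 => rw [smul_comm]; exact Submodule.smul_mem _ _ h1
  · rintro _ ⟨s, p, a, rfl, rfl, ha, rfl⟩
    obtain ⟨f, hf⟩ := koszulBasis_eq n s
    exact Submodule.subset_span ⟨p, a, f, rfl, ha, by rw [hf R]⟩

omit [GradedAlgebra 𝒜] in
theorem T_mul_mem_koszulDeg (i : Fin n) {r j : ℕ} {y : Koszul R n} (hy : y ∈ koszulDeg 𝒜 n r j) :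
    T R i * y ∈ koszulDeg 𝒜 n (r + 1) (j + 1) := by
  induction hy using Submodule.span_induction with
  | mem y hy =>
    obtain ⟨p, a, f, rfl, ha, rfl⟩ := hy
    refine Submodule.subset_span ⟨p, a, Fin.cons i f, rfl, ha, ?_⟩
    rw [List.ofFn_succ, List.prod_cons, mul_smul_comm]
    simp
  | zero => simp
  | add y y' _ _ h1 h2 => rw [mul_add]; exact add_mem h1 h2
  | smul c y _ h1 => rw [mul_smul_comm]; exact Submodule.smul_mem _ _ h1

theorem smul_mem_koszulDeg {p : ℕ} {a : R} (ha : a ∈ 𝒜 p) {r j : ℕ} {y : Koszul R n}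
    (hy : y ∈ koszulDeg 𝒜 n r j) {j' : ℕ} (hj : p + j = j') : a • y ∈ koszulDeg 𝒜 n r j' := by
  subst hj
  induction hy using Submodule.span_induction with
  | mem y hy =>
    obtain ⟨q, a', f, rfl, ha', rfl⟩ := hy
    rw [smul_smul]
    exact Submodule.subset_span ⟨p + q, _, f, by omega, SetLike.GradedMul.mul_mem ha ha', rfl⟩
  | zero => simp
  | add y y' _ _ h1 h2 => rw [smul_add]; exact add_mem h1 h2
  | smul c y _ h1 => rw [smul_comm]; exact Submodule.smul_mem _ _ h1

theorem prod_T_mem_koszulDeg {r : ℕ} (f : Fin r → Fin n) :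
    (List.ofFn fun s => T R (f s)).prod ∈ koszulDeg 𝒜 n r r :=
  Submodule.subset_span ⟨0, 1, f, zero_add _, SetLike.GradedOne.one_mem, (one_smul _ _).symm⟩

variable {𝒜} {x : Fin n → R}

theorem koszulD_prod_mem (hx : ∀ i, x i ∈ 𝒜 1) {r : ℕ} (f : Fin (r + 1) → Fin n) :
    koszulD x (List.ofFn fun s => T R (f s)).prod ∈ koszulDeg 𝒜 n r (r + 1) := by
  induction r with
  | zero =>
    rw [List.ofFn_succ, List.prod_cons, koszulD_T_mul, List.ofFn_zero, List.prod_nil,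
      koszulD_one, mul_zero, sub_zero]
    exact smul_mem_koszulDeg 𝒜 (hx _) (prod_T_mem_koszulDeg 𝒜 (n := n) (r := 0) Fin.elim0) rfl
  | succ r ih =>
    rw [List.ofFn_succ, List.prod_cons, koszulD_T_mul]
    exact sub_mem (smul_mem_koszulDeg 𝒜 (hx _) (prod_T_mem_koszulDeg 𝒜 _) (add_comm _ _))
      (T_mul_mem_koszulDeg 𝒜 _ (ih _))

theorem koszulD_mem_koszulDeg (hx : ∀ i, x i ∈ 𝒜 1) (r j : ℕ) :
    ∀ y ∈ koszulDeg 𝒜 n (r + 1) j, koszulD x y ∈ koszulDeg 𝒜 n r j := by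
  intro y hy
  rw [koszulDeg_eq] at hy ⊢
  refine map_mem_gradedPiece 𝒜 _ _ _ (fun s hs => ?_) hy
  rw [← koszulDeg_eq]
  obtain ⟨f, hf⟩ := koszulBasis_eq n s
  rw [hf R]
  revert f
  rw [hs]
  exact fun f _ => koszulD_prod_mem hx f

omit [GradedAlgebra 𝒜] in
theorem koszulD_of_mem_zero {j : ℕ} : ∀ y ∈ koszulDeg 𝒜 n 0 j, koszulD x y = 0 := by
  intro y hy
  rw [koszulDeg_eq] at hy
  refine (eq_of_mem_gradedPiece (φ := koszulD x) (ψ := 0) (fun s hs => ?_) hy).trans rfl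
  rw [Finset.card_eq_zero.1 hs, koszulBasis_empty, koszulD_one, LinearMap.zero_apply]

theorem koszulD_koszulD (x : Fin n → R) (y : Koszul R n) : koszulD x (koszulD x y) = 0 :=
  CliffordAlgebra.contractLeft_contractLeft _ _

theorem koszulD_ι_mul (x m : Fin n → R) (y : Koszul R n) :
    koszulD x (ExteriorAlgebra.ι R m * y) =
      (Fintype.linearCombination R x m) • y - ExteriorAlgebra.ι R m * koszulD x y :=
  CliffordAlgebra.contractLeft_ι_mul (Q := (0 : QuadraticForm R (Fin n → R)))
    (Fintype.linearCombination R x) m y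

theorem koszulD_algebraMap (x : Fin n → R) (a : R) :
    koszulD x (algebraMap R (Koszul R n) a) = 0 := by
  rw [Algebra.algebraMap_eq_smul_one, map_smul, koszulD_one, smul_zero]

/-- Induction over the Koszul complex. -/
theorem koszul_induction {P : Koszul R n → Prop} (halg : ∀ a, P (algebraMap R _ a))
    (hadd : ∀ y y', P y → P y' → P (y + y'))
    (hmul : ∀ m y, P y → P (ExteriorAlgebra.ι R m * y)) (y : Koszul R n) : P y :=
  CliffordAlgebra.left_induction (Q := (0 : QuadraticForm R (Fin n → R))) halg hadd
    (fun y m => hmul m y) y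

theorem signMap_koszulD (x : Fin n → R) (y : Koszul R n) :
    signMap R n (koszulD x y) = -koszulD x (signMap R n y) := by
  have hι : ∀ (m : Fin n → R) (y : Koszul R n), signMap R n (ExteriorAlgebra.ι R m * y) =
      -(ExteriorAlgebra.ι R m * signMap R n y) := by
    intro m y
    change CliffordAlgebra.involute (CliffordAlgebra.ι _ m * y) = _
    rw [map_mul, CliffordAlgebra.involute_ι, neg_mul]
    rfl
  induction y using koszul_induction with
  | halg a =>
    have : signMap R n (algebraMap R _ a) = algebraMap R _ a :=
      AlgHom.commutes (CliffordAlgebra.involute (Q := (0 : QuadraticForm R (Fin n → R)))) a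
    rw [this, koszulD_algebraMap, map_zero, neg_zero]
  | hadd y y' h1 h2 => simp only [map_add, h1, h2, neg_add]
  | hmul m y h =>
    rw [koszulD_ι_mul, map_sub, map_smul, hι, hι, map_neg, koszulD_ι_mul, h]
    simp only [mul_neg, neg_neg]

theorem signMap_mul (y y' : Koszul R n) :
    signMap R n (y * y') = signMap R n y * signMap R n y' :=
  map_mul (CliffordAlgebra.involute (Q := (0 : QuadraticForm R (Fin n → R)))) y y'

theorem signMap_one : signMap R n 1 = 1 :=
  map_one (CliffordAlgebra.involute (Q := (0 : QuadraticForm R (Fin n → R))))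

theorem signMap_prod_T {r : ℕ} (f : Fin r → Fin n) :
    signMap R n (List.ofFn fun s => T R (f s)).prod =
      (-1 : ℤ) ^ r • (List.ofFn fun s => T R (f s)).prod := by
  induction r with
  | zero => simp [signMap_one]
  | succ r ih =>
    rw [List.ofFn_succ, List.prod_cons, signMap_mul, ih]
    have : signMap R n (T R (f 0)) = -T R (f 0) := CliffordAlgebra.involute_ι _
    rw [this, mul_smul_comm, pow_succ, mul_neg_one, neg_smul, neg_mul, smul_neg]

omit [GradedAlgebra 𝒜] in
theorem signMap_of_mem {r j : ℕ} {y : Koszul R n} (hy : y ∈ koszulDeg 𝒜 n r j) :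
    signMap R n y = (-1 : ℤ) ^ r • y := by
  have hk : ∀ (c : k) (y : Koszul R n), c • y = algebraMap k R c • y := fun c y =>
    (algebraMap_smul R c y).symm
  induction hy using Submodule.span_induction with
  | mem y hy =>
    obtain ⟨p, a, f, -, -, rfl⟩ := hy
    rw [map_smul, signMap_prod_T, smul_comm]
  | zero => simp
  | add y y' _ _ h1 h2 => rw [map_add, h1, h2, smul_add]
  | smul c y _ h1 => rw [hk, map_smul, h1, smul_comm]

/-- The projection of the Koszul complex onto `K_0 = R`. -/
abbrev koszulAug (R : Type u) [CommRing R] (n : ℕ) : Koszul R n →ₐ[R] R :=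
  ExteriorAlgebra.algebraMapInv

theorem koszulAug_ι (m : Fin n → R) : koszulAug R n (ExteriorAlgebra.ι R m) = 0 := by
  simp [koszulAug, ExteriorAlgebra.algebraMapInv]

theorem koszulAug_algebraMap (a : R) : koszulAug R n (algebraMap R _ a) = a :=
  ExteriorAlgebra.algebraMap_leftInverse _ a

theorem koszulAug_basis (s : Finset (Fin n)) (hs : s.card ≠ 0) :
    koszulAug R n (koszulBasis R n s) = 0 := by
  obtain ⟨f, hf⟩ := koszulBasis_eq n s
  rw [hf R]
  obtain ⟨r, hr⟩ := Nat.exists_eq_succ_of_ne_zero hs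
  revert f
  rw [hr]
  intro f _
  rw [List.ofFn_succ, List.prod_cons, map_mul]
  simp only [T]
  rw [koszulAug_ι, zero_mul]

theorem koszulAug_koszulD_mem (x : Fin n → R) (y : Koszul R n) :
    koszulAug R n (koszulD x y) ∈ Ideal.span (Set.range x) := by
  induction y using koszul_induction with
  | halg a => simp [koszulD_algebraMap]
  | hadd y y' h1 h2 => rw [map_add, map_add]; exact add_mem h1 h2
  | hmul m y _ =>
    rw [koszulD_ι_mul, map_sub, map_smul, map_mul, koszulAug_ι, zero_mul, sub_zero,
      smul_eq_mul]
    refine Ideal.mul_mem_right _ _ ?_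
    rw [Fintype.linearCombination_apply]
    exact sum_mem fun i _ => Ideal.mul_mem_left _ _ (Ideal.subset_span ⟨i, rfl⟩)

theorem koszulD_mem_smul_top (x : Fin n → R) (y : Koszul R n) :
    koszulD x y ∈ Ideal.span (Set.range x) • (⊤ : Submodule R (Koszul R n)) := by
  induction y using koszul_induction with
  | halg a => simp [koszulD_algebraMap]
  | hadd y y' h1 h2 => rw [map_add]; exact add_mem h1 h2
  | hmul m y h =>
    rw [koszulD_ι_mul]
    refine sub_mem (Submodule.smul_mem_smul ?_ trivial)
      (Submodule.smul_top_le_comap_smul_top _ (LinearMap.mulLeft R (ExteriorAlgebra.ι R m)) h)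
    rw [Fintype.linearCombination_apply]
    exact sum_mem fun i _ => Ideal.mul_mem_left _ _ (Ideal.subset_span ⟨i, rfl⟩)

/-- `K` is the sum of `K_0` and `K_+`. -/
theorem sub_koszulAug_mem (y : Koszul R n) :
    y - algebraMap R _ (koszulAug R n y) ∈ ⨆ r : ℕ, ⋀[R]^(r + 1) (Fin n → R) := by
  induction (koszulBasis R n).mem_span y using Submodule.span_induction with
  | mem y hy =>
    obtain ⟨s, rfl⟩ := hy
    by_cases hs : s.card = 0
    · rw [Finset.card_eq_zero.1 hs, koszulBasis_empty, map_one, map_one, sub_self]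
      exact zero_mem _
    · rw [koszulAug_basis s hs, map_zero, sub_zero]
      obtain ⟨r, hr⟩ := Nat.exists_eq_succ_of_ne_zero hs
      refine Submodule.mem_iSup_of_mem r ?_
      have := koszulBasis_mem_exteriorPower (R := R) s
      rwa [hr] at this
  | zero => simp
  | add y y' _ _ h1 h2 =>
    have := add_mem h1 h2
    rw [map_add, map_add]
    convert this using 1
    abel
  | smul a y _ h =>
    have := Submodule.smul_mem _ a h
    rwa [smul_sub, Algebra.smul_def a (algebraMap R (Koszul R n) _), ← map_mul, ← smul_eq_mul,
      ← map_smul] at this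

theorem koszulAug_of_mem {y : Koszul R n} (hy : y ∈ ⨆ r : ℕ, ⋀[R]^(r + 1) (Fin n → R)) :
    koszulAug R n y = 0 := by
  have : ⨆ r : ℕ, ⋀[R]^(r + 1) (Fin n → R) ≤ LinearMap.ker (koszulAug R n).toLinearMap := by
    refine iSup_le fun r => ?_
    rw [exteriorPower_eq_homPiece, homPiece_le_iff]
    exact fun s hs => koszulAug_basis s (by omega)
  exact this hy

end Koszul

/-! ### The homology of the Koszul complex of a standard graded algebra -/

section StandardGraded

variable {k R : Type u} [Field k] [CommRing R] [Algebra k R]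
variable {𝒜 : ℕ → Submodule k R} [GradedAlgebra 𝒜] {n : ℕ} {x : Fin n → R}

/-- `R` is the sum of `k` and the ideal generated by `R_1`. -/
theorem IsStandardGraded.exists_sub_mem_span (hR : IsStandardGraded 𝒜)
    (hx1 : 𝒜 1 ≤ Submodule.span k (Set.range x)) (a : R) :
    ∃ c : k, a - algebraMap k R c ∈ Ideal.span (Set.range x) := by
  have ha : a ∈ Algebra.adjoin k (𝒜 1 : Set R) := by rw [hR.adjoin_one]; trivial
  induction ha using Algebra.adjoin_induction with
  | mem a ha =>
    refine ⟨0, ?_⟩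
    rw [map_zero, sub_zero]
    have h := hx1 ha
    clear ha
    induction h using Submodule.span_induction with
    | mem y hy => exact Ideal.subset_span hy
    | zero => exact zero_mem _
    | add y y' _ _ h1 h2 => exact add_mem h1 h2
    | smul c y _ h1 => rw [Algebra.smul_def]; exact Ideal.mul_mem_left _ _ h1
  | algebraMap c => exact ⟨c, by rw [sub_self]; exact zero_mem _⟩
  | add a a' _ _ h1 h2 =>
    obtain ⟨c, hc⟩ := h1
    obtain ⟨c', hc'⟩ := h2
    exact ⟨c + c', by rw [map_add, add_sub_add_comm]; exact add_mem hc hc'⟩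
  | mul a a' _ _ h1 h2 =>
    obtain ⟨c, hc⟩ := h1
    obtain ⟨c', hc'⟩ := h2
    refine ⟨c * c', ?_⟩
    have : a * a' - algebraMap k R (c * c') =
        a' * (a - algebraMap k R c) + algebraMap k R c * (a' - algebraMap k R c') := by
      rw [map_mul]; ring
    rw [this]
    exact add_mem (Ideal.mul_mem_left _ _ hc) (Ideal.mul_mem_left _ _ hc')

theorem span_range_le_plusIdeal (hx : ∀ i, x i ∈ 𝒜 1) :
    Ideal.span (Set.range x) ≤ plusIdeal 𝒜 := by
  refine Ideal.span_le.2 ?_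
  rintro _ ⟨i, rfl⟩
  exact mem_plusIdeal_of_mem (hx i) one_ne_zero

theorem IsStandardGraded.eq_zero_of_algebraMap_mem (hR : IsStandardGraded 𝒜) {c : k}
    (hc : algebraMap k R c ∈ plusIdeal 𝒜) : c = 0 := by
  apply hR.algebraMap_residue_bijective.1
  rw [map_zero]
  exact Ideal.Quotient.eq_zero_iff_mem.2 hc

theorem exists_eq_linearCombination {a : R} (ha : a ∈ Ideal.span (Set.range x)) :
    ∃ m : Fin n → R, a = Fintype.linearCombination R x m := by
  obtain ⟨m, hm⟩ := (Submodule.mem_span_range_iff_exists_fun R).1 ha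
  exact ⟨m, by rw [Fintype.linearCombination_apply, hm]⟩

/-- If `a` is in the ideal `(x)` and `y` is a cycle then `a y` is a boundary. -/
theorem smul_eq_koszulD {m : Fin n → R} {y : Koszul R n} (hy : koszulD x y = 0) :
    (Fintype.linearCombination R x m) • y = koszulD x (ExteriorAlgebra.ι R m * y) := by
  rw [koszulD_ι_mul, hy, mul_zero, sub_zero]

theorem ι_mul_mem_exteriorPower (m : Fin n → R) {r : ℕ} {y : Koszul R n}
    (hy : y ∈ ⋀[R]^r (Fin n → R)) :
    ExteriorAlgebra.ι R m * y ∈ ⋀[R]^(r + 1) (Fin n → R) := by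
  have h := Submodule.mul_mem_mul (M := LinearMap.range (ExteriorAlgebra.ι R)) ⟨m, rfl⟩ hy
  rwa [ExteriorAlgebra.exteriorPower, ← pow_succ'] at h

theorem koszulD_mem_exteriorPower (x : Fin n → R) (r : ℕ) :
    ∀ y ∈ ⋀[R]^(r + 1) (Fin n → R), koszulD x y ∈ ⋀[R]^r (Fin n → R) := by
  have hT : ∀ (i : Fin n) (r : ℕ) (y : Koszul R n), y ∈ ⋀[R]^r (Fin n → R) →
      T R i * y ∈ ⋀[R]^(r + 1) (Fin n → R) := by
    intro i r y hy
    exact ι_mul_mem_exteriorPower _ hy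
  have hprod : ∀ (r : ℕ) (f : Fin (r + 1) → Fin n),
      koszulD x (List.ofFn fun s => T R (f s)).prod ∈ ⋀[R]^r (Fin n → R) := by
    intro r
    induction r with
    | zero =>
      intro f
      rw [List.ofFn_succ, List.prod_cons, koszulD_T_mul, List.ofFn_zero, List.prod_nil,
        koszulD_one, mul_zero, sub_zero]
      exact Submodule.smul_mem _ _ (prod_T_mem_exteriorPower (R := R) (n := n) (r := 0) Fin.elim0)
    | succ r ih =>
      intro f
      rw [List.ofFn_succ, List.prod_cons, koszulD_T_mul]
      exact sub_mem (Submodule.smul_mem _ _ (prod_T_mem_exteriorPower _)) (hT _ _ _ (ih _))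
  intro y hy
  rw [exteriorPower_eq_homPiece] at hy
  refine (homPiece_le_iff _ (N := (⋀[R]^r (Fin n → R)).comap (koszulD x))).2 ?_ hy
  intro s hs
  obtain ⟨f, hf⟩ := koszulBasis_eq n s
  rw [Submodule.mem_comap, hf R]
  revert f
  rw [hs]
  exact fun f _ => hprod r f

/-- The homology of the Koszul complex is finite-dimensional, since it is finitely generated over
`R` and killed by the `x_i`. -/
theorem finite_koszulHomology (hR : IsStandardGraded 𝒜)
    (hx1 : 𝒜 1 ≤ Submodule.span k (Set.range x)) (r : ℕ) :
    Module.Finite k (KoszulHomology k x r) := by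
  have hfin := hR.finite_one
  have : Algebra.FiniteType k R := by
    obtain ⟨S, hS⟩ := Module.Finite.iff_fg.1 hfin
    refine ⟨S, ?_⟩
    rw [eq_top_iff, ← hR.adjoin_one]
    refine Algebra.adjoin_le ?_
    rw [← hS]
    exact Algebra.span_le_adjoin k _
  have : IsNoetherianRing R := Algebra.FiniteType.isNoetherianRing k R
  have : Module.Finite R (Koszul R n) := Module.Finite.of_basis (koszulBasis R n)
  obtain ⟨S, hS⟩ := IsNoetherian.noetherian (R := R)
    (⋀[R]^r (Fin n → R) ⊓ LinearMap.ker (koszulD x))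
  have hSZ : Submodule.span k (S : Set (Koszul R n)) ≤
      koszulHomDeg k n r ⊓ LinearMap.ker ((koszulD x).restrictScalars k) := by
    refine Submodule.span_le.2 fun y hy => ?_
    have : y ∈ Submodule.span R (S : Set (Koszul R n)) := Submodule.subset_span hy
    rw [hS] at this
    exact this
  have key : ∀ y ∈ Submodule.span R (S : Set (Koszul R n)),
      ∃ v ∈ Submodule.span k (S : Set (Koszul R n)), ∃ w ∈ ⋀[R]^(r + 1) (Fin n → R),
        y = v + koszulD x w := by
    intro y hy
    induction hy using Submodule.span_induction with
    | mem y hy => exact ⟨y, Submodule.subset_span hy, 0, zero_mem _, by simp⟩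
    | zero => exact ⟨0, zero_mem _, 0, zero_mem _, by simp⟩
    | add y y' _ _ h1 h2 =>
      obtain ⟨v, hv, w, hw, rfl⟩ := h1
      obtain ⟨v', hv', w', hw', rfl⟩ := h2
      exact ⟨v + v', add_mem hv hv', w + w', add_mem hw hw', by rw [map_add]; abel⟩
    | smul a y _ h1 =>
      obtain ⟨v, hv, w, hw, rfl⟩ := h1
      obtain ⟨c, hc⟩ := hR.exists_sub_mem_span hx1 a
      obtain ⟨m, hm⟩ := exists_eq_linearCombination hc
      have hvZ := hSZ hv
      refine ⟨c • v, Submodule.smul_mem _ _ hv, ExteriorAlgebra.ι R m * v + a • w,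
        add_mem (ι_mul_mem_exteriorPower m hvZ.1) (Submodule.smul_mem _ _ hw), ?_⟩
      rw [map_add, map_smul, ← smul_eq_koszulD hvZ.2, ← hm, sub_smul, algebraMap_smul, smul_add]
      abel
  have hfinS : Module.Finite k (Submodule.span k (S : Set (Koszul R n))) :=
    Module.Finite.span_finset k S
  let φ : Submodule.span k (S : Set (Koszul R n)) →ₗ[k] KoszulHomology k x r :=
    Submodule.mkQ _ ∘ₗ Submodule.inclusion hSZ
  refine Module.Finite.of_surjective φ fun y => ?_
  obtain ⟨⟨y, hy⟩, rfl⟩ := Submodule.mkQ_surjective _ y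
  have hy' : y ∈ Submodule.span R (S : Set (Koszul R n)) := by rw [hS]; exact hy
  obtain ⟨v, hv, w, hw, hvw⟩ := key y hy'
  refine ⟨⟨v, hv⟩, (Submodule.Quotient.eq _).2 ⟨-w, neg_mem hw, ?_⟩⟩
  change koszulD x (-w) = v - y
  rw [hvw, map_neg]
  abel

variable {ι : Type u} {z : ι → koszulZPlus x} {b : Module.Basis ι k (HPlus x)}

/-- The cycles `z i`, together with `1`: they represent a basis of `H(K)`. -/
def koszulCycles (z : ι → koszulZPlus x) : Option ι → Koszul R n
  | none => 1
  | some i => z i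

theorem koszulD_koszulCycles (i : Option ι) : koszulD x (koszulCycles z i) = 0 := by
  rcases i with _ | i
  · exact koszulD_one x
  · exact (z i).2.1

theorem linearCombination_koszulCycles (c : Option ι →₀ k) :
    Finsupp.linearCombination k (koszulCycles z) c =
      c none • 1 + (Finsupp.linearCombination k z c.some : koszulZPlus x) := by
  induction c using Finsupp.induction_linear with
  | zero => simp
  | add c c' h1 h2 =>
    rw [map_add, h1, h2, Finsupp.some_add, map_add, Submodule.coe_add, Finsupp.add_apply,
      add_smul]
    abel
  | single i a =>
    rcases i with _ | i
    · simp [koszulCycles]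
    · simp [koszulCycles]

theorem mk_linearCombination (hb : ∀ i, b i = cls x (z i)) (c : ι →₀ k) :
    cls x (Finsupp.linearCombination k z c) = b.repr.symm c := by
  have : (⇑b : ι → HPlus x) = fun i => cls x (z i) := funext hb
  rw [b.repr_symm_apply, this]
  exact Finsupp.apply_linearCombination k
    ((Submodule.mkQ ((LinearMap.range (koszulD x)).submoduleOf (koszulZPlus x))).restrictScalars k)
    z c

/-- Every cycle of `K` is a boundary plus a combination of `1` and the `z i`: up to a boundary its
component in `K_0 = R` is a scalar, since `(x)` and `k` span `R`. -/
theorem koszulCycles_span (hR : IsStandardGraded 𝒜)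
    (hx1 : 𝒜 1 ≤ Submodule.span k (Set.range x)) (hb : ∀ i, b i = cls x (z i))
    (y : Koszul R n) (hy : koszulD x y = 0) :
    ∃ c w, y = koszulD x w + Finsupp.linearCombination k (koszulCycles z) c := by
  classical
  obtain ⟨c, hc⟩ := hR.exists_sub_mem_span hx1 (koszulAug R n y)
  obtain ⟨m, hm⟩ := exists_eq_linearCombination hc
  let y' : koszulZPlus x := ⟨y - algebraMap R _ (koszulAug R n y), by
    change koszulD x _ = 0
    rw [map_sub, hy, koszulD_algebraMap, sub_zero], sub_koszulAug_mem y⟩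
  let c' := b.repr (cls x y')
  have h1 : cls x (Finsupp.linearCombination k z c') = cls x y' := by
    rw [mk_linearCombination hb, LinearEquiv.symm_apply_apply]
  obtain ⟨w, hw⟩ := (Submodule.Quotient.eq _).1 h1.symm
  let c'' : Option ι →₀ k := c'.embDomain Function.Embedding.some + Finsupp.single none c
  have hnone : c'' none = c := by
    rw [Finsupp.add_apply, Finsupp.single_eq_same, Finsupp.embDomain_of_notMem_range _ _ _ (by simp),
      zero_add]
  have hsome : c''.some = c' := by
    ext i
    rw [Finsupp.some_apply, Finsupp.add_apply, Finsupp.single_eq_of_ne (by simp), add_zero]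
    exact Finsupp.embDomain_apply_self Function.Embedding.some c' i
  refine ⟨c'', w + ExteriorAlgebra.ι R m * 1, ?_⟩
  have hw' : koszulD x w = (y - algebraMap R _ (koszulAug R n y)) -
    (Finsupp.linearCombination k z c' : koszulZPlus x) := hw
  rw [linearCombination_koszulCycles, hnone, hsome, map_add (koszulD x),
    ← smul_eq_koszulD (koszulD_one x), ← hm, hw', sub_smul, algebraMap_smul,
    ← Algebra.algebraMap_eq_smul_one]
  abel

/-- A combination of `1` and the `z i` that is a boundary is trivial: the coefficient of `1` lies in
`R_+`, and the `z i` represent a basis of `H_+(K)`. -/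
theorem koszulCycles_independent (hR : IsStandardGraded 𝒜) (hx : ∀ i, x i ∈ 𝒜 1)
    (hb : ∀ i, b i = cls x (z i)) (c : Option ι →₀ k) (w : Koszul R n)
    (hc : Finsupp.linearCombination k (koszulCycles z) c = koszulD x w) : c = 0 := by
  rw [linearCombination_koszulCycles] at hc
  have h0 : c none = 0 := by
    refine hR.eq_zero_of_algebraMap_mem (span_range_le_plusIdeal hx ?_)
    have := koszulAug_koszulD_mem x w
    rw [← hc, map_add, koszulAug_of_mem (Submodule.coe_mem
      (Finsupp.linearCombination k z c.some)).2, add_zero] at this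
    rwa [← algebraMap_smul R, map_smul, map_one, smul_eq_mul, mul_one] at this
  rw [h0, zero_smul, zero_add] at hc
  have h1 : cls x (Finsupp.linearCombination k z c.some) = 0 :=
    (Submodule.Quotient.mk_eq_zero _).2 ⟨w, hc.symm⟩
  rw [mk_linearCombination hb, LinearEquiv.map_eq_zero_iff] at h1
  ext i
  rcases i with _ | i
  · exact h0
  · exact DFunLike.congr_fun h1 i

end StandardGraded

/-! ### Cycles of the Koszul complex have coefficients in the irrelevant ideal -/

section KoszulMinimal

variable {k R : Type u} [Field k] [CommRing R] [Algebra k R] {n : ℕ}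

/-- The contraction of the exterior algebra over `k` with the `i`-th coordinate function. -/
def partialT (i : Fin n) : Koszul k n →ₗ[k] Koszul k n :=
  CliffordAlgebra.contractLeft (LinearMap.proj i)

theorem partialT_ι_mul (i : Fin n) (m : Fin n → k) (y : Koszul k n) :
    partialT i (ExteriorAlgebra.ι k m * y) = m i • y - ExteriorAlgebra.ι k m * partialT i y :=
  CliffordAlgebra.contractLeft_ι_mul (Q := (0 : QuadraticForm k (Fin n → k)))
    (LinearMap.proj i) m y

theorem partialT_algebraMap (i : Fin n) (a : k) :
    partialT i (algebraMap k (Koszul k n) a) = 0 :=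
  CliffordAlgebra.contractLeft_algebraMap (Q := (0 : QuadraticForm k (Fin n → k)))
    (LinearMap.proj i) a

/-- The projection `y ↦ ∂_i (T_i y)` that removes the basis elements containing `T_i`. -/
def removeT (i : Fin n) : Koszul k n →ₗ[k] Koszul k n :=
  partialT i ∘ₗ LinearMap.mulLeft k (T k i)

theorem removeT_apply (i : Fin n) (y : Koszul k n) :
    removeT i y = y - T k i * partialT i y := by
  rw [removeT, LinearMap.comp_apply, LinearMap.mulLeft_apply, T, partialT_ι_mul]
  simp

theorem removeT_T_mul_self (i : Fin n) (y : Koszul k n) : removeT i (T k i * y) = 0 := by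
  rw [removeT, LinearMap.comp_apply, LinearMap.mulLeft_apply, ← mul_assoc, T,
    ExteriorAlgebra.ι_sq_zero, zero_mul, map_zero]

theorem removeT_T_mul {i j : Fin n} (hij : i ≠ j) (y : Koszul k n) :
    removeT i (T k j * y) = T k j * removeT i y := by
  have hanti : T k i * T k j = -(T k j * T k i) :=
    eq_neg_of_add_eq_zero_left (ExteriorAlgebra.ι_add_mul_swap _ _)
  have hpart : partialT i (T k j * y) = -(T k j * partialT i y) := by
    rw [T, partialT_ι_mul, Pi.single_eq_of_ne hij, zero_smul, zero_sub]
  rw [removeT_apply, removeT_apply, hpart, mul_neg, ← mul_assoc, hanti, mul_sub, ← mul_assoc,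
    neg_mul, neg_neg]

/-- An element of the exterior algebra that is killed by all the partial derivatives is a
scalar. -/
theorem eq_algebraMap_of_partialT_eq_zero (y : Koszul k n) (hy : ∀ i, partialT i y = 0) :
    y = algebraMap k _ (koszulAug k n y) := by
  let Q : List (Fin n) → Koszul k n →ₗ[k] Koszul k n := fun L =>
    L.foldr (fun i f => f ∘ₗ removeT i) LinearMap.id
  have hQfix : ∀ L v, (∀ i, partialT i v = 0) → Q L v = v := by
    intro L v hv
    induction L with
    | nil => rfl
    | cons i L ih =>
      change Q L (removeT i v) = v
      rw [removeT_apply, hv, mul_zero, sub_zero, ih]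
  have hQT : ∀ L j v, j ∈ L → Q L (T k j * v) = 0 := by
    intro L j
    induction L with
    | nil => simp
    | cons i L ih =>
      intro v hj
      change Q L (removeT i (T k j * v)) = 0
      by_cases hij : i = j
      · subst hij
        rw [removeT_T_mul_self, map_zero]
      · rw [removeT_T_mul hij]
        exact ih _ (List.mem_of_ne_of_mem (fun h => hij h.symm) hj)
  -- removing all the `T_i` leaves only the scalar part
  have hQ : ∀ v, Q (List.finRange n) v = algebraMap k _ (koszulAug k n v) := by
    intro v
    induction v using koszul_induction with
    | halg a =>
      rw [hQfix _ _ fun i => partialT_algebraMap i a, koszulAug_algebraMap]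
    | hadd v v' h1 h2 => rw [map_add, h1, h2, map_add, map_add]
    | hmul m v _ =>
      rw [map_mul (koszulAug k n), koszulAug_ι, zero_mul, map_zero]
      have hm : ExteriorAlgebra.ι k m = ∑ i, m i • T k i := by
        conv_lhs => rw [pi_eq_sum_univ' m]
        rw [map_sum]
        refine Finset.sum_congr rfl fun i _ => ?_
        rw [map_smul, T]
      rw [hm, Finset.sum_mul, map_sum]
      refine Finset.sum_eq_zero fun i _ => ?_
      rw [smul_mul_assoc, map_smul, hQT _ _ _ (List.mem_finRange i), smul_zero]
  rw [← hQ, hQfix _ _ hy]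

/-- On elements with scalar coefficients the Koszul differential is `∑ x_i ∂_i`. -/
theorem koszulD_koszulIncl (x : Fin n → R) (y : Koszul k n) :
    koszulD x (koszulIncl k R n y) = ∑ i, x i • koszulIncl k R n (partialT i y) := by
  induction y using koszul_induction with
  | halg a =>
    have : koszulIncl k R n (algebraMap k _ a) = algebraMap R _ (algebraMap k R a) := by
      rw [AlgHom.commutes, ← IsScalarTower.algebraMap_apply]
    rw [this, koszulD_algebraMap]
    simp [partialT_algebraMap]
  | hadd y y' h1 h2 => simp only [map_add, h1, h2, smul_add, Finset.sum_add_distrib]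
  | hmul m y h =>
    rw [map_mul, koszulIncl_ι, koszulD_ι_mul, h, Finset.mul_sum,
      Fintype.linearCombination_apply, Finset.sum_smul, ← Finset.sum_sub_distrib]
    refine Finset.sum_congr rfl fun i _ => ?_
    rw [partialT_ι_mul, map_sub, map_smul, map_mul, koszulIncl_ι, smul_sub, mul_smul_comm,
      smul_eq_mul, mul_comm, mul_smul, algebraMap_smul]

variable {𝒜 : ℕ → Submodule k R} [GradedAlgebra 𝒜] {x : Fin n → R}

/-- A bihomogeneous cycle of positive degree has its coefficients in `R_+`: if they were scalars,
all its partial derivatives would vanish because the `x_i` are linearly independent over `k`. -/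
theorem mem_plusIdeal_smul_of_koszulD_eq_zero (hR : IsStandardGraded 𝒜)
    (hx : LinearIndependent k x) {r j : ℕ} (hr : r ≠ 0) {y : Koszul R n}
    (hy : y ∈ koszulDeg 𝒜 n r j) (hdy : koszulD x y = 0) :
    y ∈ plusIdeal 𝒜 • (⊤ : Submodule R (Koszul R n)) := by
  have hsmul : ∀ (c : k) (v : Koszul R n), v ∈ plusIdeal 𝒜 • (⊤ : Submodule R (Koszul R n)) →
      c • v ∈ plusIdeal 𝒜 • (⊤ : Submodule R (Koszul R n)) := fun c v hv => by
    rw [← algebraMap_smul R c v]; exact Submodule.smul_mem _ _ hv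
  rcases ne_or_eq j r with hjr | rfl
  · clear hdy
    induction hy using Submodule.span_induction with
    | mem y hy =>
      obtain ⟨p, a, f, hp, ha, rfl⟩ := hy
      exact Submodule.smul_mem_smul (mem_plusIdeal_of_mem ha (by omega)) trivial
    | zero => exact zero_mem _
    | add y y' _ _ h1 h2 => exact add_mem h1 h2
    | smul c y _ h1 => exact hsmul c y h1
  · have hincl : ∃ v ∈ ⋀[k]^j (Fin n → k), y = koszulIncl k R n v := by
      have : koszulDeg 𝒜 n j j ≤ (⋀[k]^j (Fin n → k)).map (koszulIncl k R n).toLinearMap := by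
        refine Submodule.span_le.2 ?_
        rintro _ ⟨p, a, f, hp, ha, rfl⟩
        obtain rfl : p = 0 := by omega
        rw [hR.zero_eq] at ha
        obtain ⟨c, rfl⟩ := Submodule.mem_one.1 ha
        rw [algebraMap_smul]
        exact Submodule.smul_mem _ _ ⟨_, prod_T_mem_exteriorPower f, koszulIncl_prod f⟩
      obtain ⟨v, hv, rfl⟩ := this hy
      exact ⟨v, hv, rfl⟩
    obtain ⟨v, hv, rfl⟩ := hincl
    suffices hv0 : v = 0 by rw [hv0, map_zero]; exact zero_mem _
    have hpart : ∀ i, partialT i v = 0 := by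
      have hexp : ∀ i, koszulIncl k R n (partialT i v) =
          ∑ s, (koszulBasis k n).repr (partialT i v) s • koszulBasis R n s := by
        intro i
        conv_lhs => rw [← (koszulBasis k n).sum_repr (partialT i v)]
        rw [map_sum]
        exact Finset.sum_congr rfl fun s _ => by rw [map_smul, koszulIncl_basis]
      rw [koszulD_koszulIncl] at hdy
      simp only [hexp, Finset.smul_sum] at hdy
      rw [Finset.sum_comm] at hdy
      have hcoef : ∀ s, ∑ i, (koszulBasis k n).repr (partialT i v) s • x i = 0 := by
        refine fun s => Fintype.linearIndependent_iff.1 (koszulBasis R n).linearIndependent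
          (fun s => ∑ i, (koszulBasis k n).repr (partialT i v) s • x i) ?_ s
        rw [← hdy]
        refine Finset.sum_congr rfl fun s _ => ?_
        rw [Finset.sum_smul]
        refine Finset.sum_congr rfl fun i _ => ?_
        rw [smul_assoc, smul_comm]
      intro i
      refine (koszulBasis k n).ext_elem fun s => ?_
      rw [Fintype.linearIndependent_iff.1 hx _ (hcoef s) i, map_zero, Finsupp.zero_apply]
    have haug : koszulAug k n v = 0 := by
      obtain ⟨r, rfl⟩ := Nat.exists_eq_succ_of_ne_zero hr
      exact koszulAug_of_mem (Submodule.mem_iSup_of_mem r hv)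
    rw [eq_algebraMap_of_partialT_eq_zero v hpart, haug, map_zero]

end KoszulMinimal

/-! ### Bases of the homology of the Koszul complex -/

section KoszulHomologyBasis

variable {k R : Type u} [Field k] [CommRing R] [Algebra k R] {n : ℕ}
variable {𝒜 : ℕ → Submodule k R} [GradedAlgebra 𝒜] {x : Fin n → R}
variable {ι : Type u} {z : ι → koszulZPlus x} {b : Module.Basis ι k (HPlus x)} {h g : ι → ℕ}

omit [GradedAlgebra 𝒜] in
theorem eq_zero_of_mem_koszulDeg_zero {z : koszulZPlus x} {j : ℕ}
    (hz : (z : Koszul R n) ∈ koszulDeg 𝒜 n 0 j) : z = 0 := by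
  have hz' : (z : Koszul R n) ∈ Submodule.span R {1} := by
    rw [koszulDeg_eq] at hz
    have := gradedPiece_le_homPiece _ 𝒜 _ _ _ hz
    refine (homPiece_le_iff _).2 (fun s hs => ?_) this
    rw [Finset.card_eq_zero.1 hs, koszulBasis_empty]
    exact Submodule.mem_span_singleton_self 1
  obtain ⟨a, ha⟩ := Submodule.mem_span_singleton.1 hz'
  have h0 := koszulAug_of_mem z.2.2
  rw [← ha, map_smul, map_one, smul_eq_mul, mul_one] at h0
  refine Subtype.ext ?_
  rw [← ha, h0, zero_smul]
  rfl

omit [GradedAlgebra 𝒜] in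
/-- The homological degrees of the cycles representing a basis of `H_+(K)` are positive. -/
theorem degree_ne_zero (hb : ∀ i, b i = cls x (z i))
    (hz : ∀ i, (z i : Koszul R n) ∈ koszulDeg 𝒜 n (h i) (g i)) (i : ι) : h i ≠ 0 := by
  intro h0
  have := hz i
  rw [h0] at this
  refine b.ne_zero i ?_
  rw [hb, eq_zero_of_mem_koszulDeg_zero this]
  rfl

theorem koszulCycles_mem (hz : ∀ i, (z i : Koszul R n) ∈ koszulDeg 𝒜 n (h i) (g i))
    (i : Option ι) : koszulCycles z i ∈ koszulDeg 𝒜 n (i.elim 0 h) (i.elim 0 g) := by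
  rcases i with _ | i
  · exact prod_T_mem_koszulDeg 𝒜 (n := n) (r := 0) Fin.elim0
  · exact hz i

/-- The cycles `1` and `z i` of bidegree `(r, j)` represent a basis of `H_{r,j}(K)`. -/
theorem nonempty_koszulBiHomology_basis (hR : IsStandardGraded 𝒜) (hx : ∀ i, x i ∈ 𝒜 1)
    (hx1 : 𝒜 1 ≤ Submodule.span k (Set.range x)) (hb : ∀ i, b i = cls x (z i))
    (hz : ∀ i, (z i : Koszul R n) ∈ koszulDeg 𝒜 n (h i) (g i)) (r j : ℕ) :
    Nonempty (Module.Basis {i : Option ι | i.elim 0 h = r ∧ i.elim 0 g = j} k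
      (KoszulBiHomology 𝒜 x r j)) := by
  let e := koszulBasis R n
  change Nonempty (Module.Basis _ k (Homology (fun s => koszulDeg 𝒜 n s j)
    ((koszulD x).restrictScalars k) r))
  let P : ℕ → Koszul R n →ₗ[k] Koszul R n := fun s => gradedProj 𝒜 e Finset.card Finset.card s j
  have hPd : ∀ y, P r (koszulD x y) = koszulD x (P (r + 1) y) :=
    gradedProj_comm 𝒜 e (by simpa only [koszulDeg_eq] using koszulD_mem_koszulDeg hx)
      (fun j => by
        have := koszulD_of_mem_zero (𝒜 := 𝒜) (x := x) (j := j)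
        rwa [koszulDeg_eq] at this) r j
  refine nonempty_homology_basis (N := fun s => koszulDeg 𝒜 n s j)
    (d := (koszulD x).restrictScalars k) r (P r) (P (r + 1)) ?_ ?_
    hPd (koszulCycles z) koszulD_koszulCycles (koszulCycles_span hR hx1 hb)
    (koszulCycles_independent hR hx hb) _ ?_ ?_
  · intro y hy
    rw [koszulDeg_eq] at hy
    exact gradedProj_of_mem 𝒜 e hy
  · intro y
    rw [koszulDeg_eq]
    exact gradedProj_mem 𝒜 e _ _ y
  · rintro i ⟨rfl, rfl⟩
    exact koszulCycles_mem hz i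
  · intro i hi
    have := koszulCycles_mem hz i
    rw [koszulDeg_eq] at this
    exact gradedProj_of_mem_ne 𝒜 e this hi

/-- The cycles `1` and `z i` of homological degree `r` represent a basis of `H_r(K)`. -/
theorem nonempty_koszulHomology_basis (hR : IsStandardGraded 𝒜) (hx : ∀ i, x i ∈ 𝒜 1)
    (hx1 : 𝒜 1 ≤ Submodule.span k (Set.range x)) (hb : ∀ i, b i = cls x (z i))
    (hz : ∀ i, (z i : Koszul R n) ∈ koszulDeg 𝒜 n (h i) (g i)) (r : ℕ) :
    Nonempty (Module.Basis {i : Option ι | i.elim 0 h = r} k (KoszulHomology k x r)) := by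
  let e := koszulBasis R n
  let P : ℕ → Koszul R n →ₗ[k] Koszul R n := fun s =>
    (homProj e Finset.card s).restrictScalars k
  have hN : ∀ s, koszulHomDeg k n s = (homPiece e Finset.card s).restrictScalars k := fun s => by
    rw [koszulHomDeg, exteriorPower_eq_homPiece]
  have hmem : ∀ i, koszulCycles z i ∈ homPiece e Finset.card (i.elim 0 h) := fun i => by
    have := koszulCycles_mem hz i
    rw [koszulDeg_eq] at this
    exact gradedPiece_le_homPiece e 𝒜 _ _ _ this
  have hPd : ∀ y, P r (koszulD x y) = koszulD x (P (r + 1) y) :=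
    homProj_comm e (by simpa only [exteriorPower_eq_homPiece] using koszulD_mem_exteriorPower x)
      ((homPiece_le_iff e (N := LinearMap.ker (koszulD x))).2 fun s hs => by
        rw [Finset.card_eq_zero.1 hs, koszulBasis_empty]
        exact koszulD_one x) r
  refine nonempty_homology_basis (N := koszulHomDeg k n)
    (d := (koszulD x).restrictScalars k) r (P r) (P (r + 1)) ?_ ?_
    hPd (koszulCycles z) koszulD_koszulCycles (koszulCycles_span hR hx1 hb)
    (koszulCycles_independent hR hx hb) _ ?_ ?_
  · intro y hy
    rw [hN] at hy
    exact homProj_of_mem e y hy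
  · intro y
    rw [hN]
    exact homProj_mem e _ y
  · rintro i rfl
    rw [hN]
    exact hmem i
  · intro i hi
    exact homProj_of_mem_ne e hi _ (hmem i)

end KoszulHomologyBasis

/-! ### Words in a basis of `C` -/

section Words

variable {k : Type u} [Field k] {C : Type u} [AddCommGroup C] [Module k C] {ι : Type u}
variable (b : Module.Basis ι k C)

/-- The basis of `T(C)` consisting of the words in a basis of `C`. -/
def wordBasis : Module.Basis (List ι) k (TensorAlgebra k C) :=
  b.tensorAlgebra.reindex FreeMonoid.toList

theorem wordBasis_apply (l : List ι) :
    wordBasis b l = (l.map fun i => TensorAlgebra.ι k (b i)).prod := by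
  rw [wordBasis, Module.Basis.reindex_apply]
  have h1 : FreeAlgebra.basisFreeMonoid k ι (FreeMonoid.toList.symm l) =
      (l.map (FreeAlgebra.ι k)).prod := by
    change FreeAlgebra.equivMonoidAlgebraFreeMonoid.symm
      (MonoidAlgebra.of k (FreeMonoid ι) (FreeMonoid.ofList l)) = _
    rw [AlgEquiv.symm_apply_eq, map_list_prod]
    induction l with
    | nil => simp [FreeAlgebra.equivMonoidAlgebraFreeMonoid]; rfl
    | cons i l ih =>
      rw [FreeMonoid.ofList_cons, map_mul, ih]
      simp [FreeAlgebra.equivMonoidAlgebraFreeMonoid]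
  change (TensorAlgebra.equivFreeAlgebra b).symm
    (FreeAlgebra.basisFreeMonoid k ι (FreeMonoid.toList.symm l)) = _
  rw [h1, map_list_prod, List.map_map]
  congr 2
  funext i
  exact TensorAlgebra.equivFreeAlgebra_symm_ι b i

theorem wordBasis_nil : wordBasis b [] = 1 := by
  rw [wordBasis_apply]; rfl

theorem wordBasis_cons (i : ι) (l : List ι) :
    wordBasis b (i :: l) = TensorAlgebra.ι k (b i) * wordBasis b l := by
  rw [wordBasis_apply, wordBasis_apply, List.map_cons, List.prod_cons]

theorem wordBasis_concat (l : List ι) (i : ι) :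
    wordBasis b (l ++ [i]) = wordBasis b l * TensorAlgebra.ι k (b i) := by
  rw [wordBasis_apply, wordBasis_apply, List.map_append, List.prod_append]
  simp

theorem algebraMapInv_wordBasis_cons (i : ι) (l : List ι) :
    TensorAlgebra.algebraMapInv (wordBasis b (i :: l)) = (0 : k) := by
  rw [wordBasis_cons, map_mul]
  simp [TensorAlgebra.algebraMapInv]

open Classical in
/-- The map `T(C) → T(C)` that removes the last letter of a word if it is `i`, and sends all the
other words to zero. -/
def stripLast (i : ι) : TensorAlgebra k C →ₗ[k] TensorAlgebra k C :=
  (wordBasis b).constr k fun l => if l.getLast? = some i then wordBasis b l.dropLast else 0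

theorem stripLast_nil (i : ι) : stripLast b i (wordBasis b []) = 0 := by
  rw [stripLast, Module.Basis.constr_basis]; simp

open Classical in
theorem stripLast_concat (i j : ι) (l : List ι) :
    stripLast b i (wordBasis b (l ++ [j])) = if j = i then wordBasis b l else 0 := by
  rw [stripLast, Module.Basis.constr_basis]
  simp

/-- The homological degree of a word, in which the letter `i` has bidegree `(h i + 1, g i)`. -/
def wordHom (h : ι → ℕ) (l : List ι) : ℕ := (l.map fun i => h i + 1).sum

/-- The internal degree of a word, in which the letter `i` has bidegree `(h i + 1, g i)`. -/
def wordInt (g : ι → ℕ) (l : List ι) : ℕ := (l.map g).sum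

/-- If the pieces of `C` are spanned by basis elements, those of `T(C)` are spanned by words. -/
theorem tensorDeg_eq_span {𝒞 : ℕ → ℕ → Submodule k C} {h g : ι → ℕ}
    (h𝒞 : ∀ p q, 𝒞 p q = Submodule.span k (b '' {i | h i + 1 = p ∧ g i = q})) (r j : ℕ) :
    tensorDeg 𝒞 r j =
      Submodule.span k (wordBasis b '' {l | wordHom h l = r ∧ wordInt g l = j}) := by
  refine le_antisymm (Submodule.span_le.2 ?_) (Submodule.span_le.2 ?_)
  · rintro _ ⟨m, c, p, q, hc, rfl, rfl, rfl⟩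
    rw [TensorAlgebra.tprod_apply]
    induction m with
    | zero =>
      refine Submodule.subset_span ⟨[], ⟨rfl, rfl⟩, ?_⟩
      rw [wordBasis_nil, List.ofFn_zero, List.prod_nil]
    | succ m ih =>
      rw [List.ofFn_succ, List.prod_cons, Fin.sum_univ_succ, Fin.sum_univ_succ]
      have h0 := hc 0
      rw [h𝒞] at h0
      have h1 := ih (fun i => c i.succ) (fun i => p i.succ) (fun i => q i.succ)
        (fun i => hc i.succ)
      generalize (List.ofFn fun i : Fin m => TensorAlgebra.ι k (c i.succ)).prod = t at h1
      generalize c 0 = c₀ at h0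
      have h2 := Submodule.mul_mem_mul
        (Submodule.mem_map_of_mem (f := TensorAlgebra.ι k) h0) h1
      rw [Submodule.map_span, Submodule.span_mul_span] at h2
      refine Submodule.span_mono ?_ h2
      rintro _ ⟨_, ⟨_, ⟨i, ⟨hi, hi'⟩, rfl⟩, rfl⟩, _, ⟨l, ⟨hl, hl'⟩, rfl⟩, rfl⟩
      exact ⟨i :: l, ⟨by simp [wordHom, ← hi, ← hl], by simp [wordInt, ← hi', ← hl']⟩,
        wordBasis_cons b i l⟩
  · rintro _ ⟨l, ⟨rfl, rfl⟩, rfl⟩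
    refine Submodule.subset_span ⟨l.length, fun i => b (l.get i), fun i => h (l.get i) + 1,
      fun i => g (l.get i), fun i => ?_, ?_, ?_, ?_⟩
    · rw [h𝒞]; exact Submodule.subset_span ⟨_, ⟨rfl, rfl⟩, rfl⟩
    · rw [wordHom, ← List.sum_ofFn]
      conv_rhs => rw [← List.ofFn_get l, List.map_ofFn]
      rfl
    · rw [wordInt, ← List.sum_ofFn]
      conv_rhs => rw [← List.ofFn_get l, List.map_ofFn]
      rfl
    · rw [TensorAlgebra.tprod_apply, wordBasis_apply]
      congr 1
      conv_lhs => rw [← List.ofFn_get l, List.map_ofFn]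
      rfl

end Words

section YComplex

variable {k R : Type u} [Field k] [CommRing R] [Algebra k R] {n : ℕ} {x : Fin n → R}
variable {ι : Type u} (b : Module.Basis ι k (HPlus x))

/-- The basis of `Y` over `R` consisting of the `e_s | c_1 | ⋯ | c_m`, where `e_s` is a product of
distinct `T_i`. -/
def yBasis : Module.Basis (ULift.{u} (Finset (Fin n)) × List ι) R (Y k x) :=
  ((koszulBasis R n).reindex Equiv.ulift.symm).tensorProduct (wordBasis b)

theorem yBasis_apply (s : ULift.{u} (Finset (Fin n))) (l : List ι) :
    yBasis b (s, l) = koszulBasis R n s.down ⊗ₜ[k] wordBasis b l := by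
  rw [yBasis, Module.Basis.tensorProduct_apply, Module.Basis.reindex_apply]
  rfl

/-- The homological degree of an element of the basis of `Y`. -/
def yHom (h : ι → ℕ) (p : ULift.{u} (Finset (Fin n)) × List ι) : ℕ :=
  p.1.down.card + wordHom h p.2

/-- The internal degree of an element of the basis of `Y`. -/
def yInt (g : ι → ℕ) (p : ULift.{u} (Finset (Fin n)) × List ι) : ℕ :=
  p.1.down.card + wordInt g p.2

/-- A linear property of elements of `Y` may be checked on the `v ⊗ l`, where `l` is a word. -/
theorem y_ext {V : Type*} [AddCommGroup V] [Module R V] {φ ψ : Y k x →ₗ[R] V}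
    (hφ : ∀ v l, φ (v ⊗ₜ wordBasis b l) = ψ (v ⊗ₜ wordBasis b l)) : φ = ψ :=
  (yBasis b).ext fun ⟨s, l⟩ => by rw [yBasis_apply]; exact hφ _ l

end YComplex

/-! ### Complexes of words -/

section Words

variable {k R V M ι : Type*} [Field k] [CommRing R] [Algebra k R]
variable [AddCommGroup V] [Module k V] [Module R V] [IsScalarTower k R V]
variable [AddCommGroup M] [Module k M] [Module R M] [IsScalarTower k R M]

/-- The elements `v | c_1 | ⋯ | c_m = W (c_1, …, c_m) v` span `M`, and the differential `d` of `M`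
acts on them by `d (v | c_1 | ⋯ | c_m) = δ v | c_1 | ⋯ | c_m + φ_{c_1} v | c_2 | ⋯ | c_m`. The maps
`strip i`, `append i` and `zero` remove a last letter `i` (and kill the other words), append the
letter `i`, and project to the words of length zero. -/
structure IsWordComplex (W : List ι → V →ₗ[R] M) (δ : V →ₗ[R] V) (φ : ι → V →ₗ[R] V)
    (d : M →ₗ[R] M) (strip append : ι → M →ₗ[R] M) (zero : M →ₗ[R] V) : Prop where
  span : ∀ y, y ∈ Submodule.span R {y | ∃ l v, y = W l v}
  d_nil : ∀ v, d (W [] v) = W [] (δ v)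
  d_cons : ∀ i l v, d (W (i :: l) v) = W (i :: l) (δ v) + W l (φ i v)
  strip_nil : ∀ i v, strip i (W [] v) = 0
  strip_self : ∀ i l v, strip i (W (l ++ [i]) v) = W l v
  strip_ne : ∀ i j l v, j ≠ i → strip i (W (l ++ [j]) v) = 0
  append_apply : ∀ i l v, append i (W l v) = W (l ++ [i]) v
  zero_nil : ∀ v, zero (W [] v) = v
  zero_cons : ∀ i l v, zero (W (i :: l) v) = 0

namespace IsWordComplex

variable {W : List ι → V →ₗ[R] M} {δ : V →ₗ[R] V} {φ : ι → V →ₗ[R] V} {d : M →ₗ[R] M}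
  {strip append : ι → M →ₗ[R] M} {zero : M →ₗ[R] V}

section

variable (hW : IsWordComplex W δ φ d strip append zero)
include hW

/-- Removing the last letter commutes with the differential, which acts on the first letter. -/
theorem strip_d (i : ι) (y : M) : strip i (d y) = d (strip i y) := by
  induction hW.span y using Submodule.span_induction with
  | mem y hy =>
    obtain ⟨l, v, rfl⟩ := hy
    rcases List.eq_nil_or_concat' l with rfl | ⟨l, j, rfl⟩
    · rw [hW.d_nil, hW.strip_nil, hW.strip_nil, map_zero]
    · by_cases hj : j = i
      · subst hj
        rw [hW.strip_self]
        rcases l with _ | ⟨i', l⟩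
        · have h1 := hW.strip_self j [] (δ v)
          rw [List.nil_append] at h1 ⊢
          rw [hW.d_cons, map_add, hW.strip_nil, h1, add_zero, hW.d_nil]
        · rw [List.cons_append, hW.d_cons, map_add, ← List.cons_append, hW.strip_self,
            hW.strip_self, hW.d_cons]
      · rw [hW.strip_ne i j l v hj, map_zero]
        rcases l with _ | ⟨i', l⟩
        · have h1 := hW.strip_ne i j [] (δ v) hj
          rw [List.nil_append] at h1 ⊢
          rw [hW.d_cons, map_add, hW.strip_nil, h1, add_zero]
        · rw [List.cons_append, hW.d_cons, map_add, ← List.cons_append, hW.strip_ne _ _ _ _ hj,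
            hW.strip_ne _ _ _ _ hj, add_zero]
  | zero => simp only [map_zero]
  | add y y' _ _ h1 h2 => simp only [map_add, h1, h2]
  | smul a y _ h1 => simp only [map_smul, h1]

/-- Appending a letter commutes with the differential up to terms of word length zero. -/
theorem exists_d_append (i : ι) (y : M) :
    ∃ v : V, d (append i y) = append i (d y) + W [] v := by
  induction hW.span y using Submodule.span_induction with
  | mem y hy =>
    obtain ⟨l, v, rfl⟩ := hy
    rw [hW.append_apply]
    rcases l with _ | ⟨j, l⟩
    · refine ⟨φ i v, ?_⟩
      rw [List.nil_append, hW.d_cons, hW.d_nil, hW.append_apply, List.nil_append]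
    · refine ⟨0, ?_⟩
      rw [List.cons_append, hW.d_cons, hW.d_cons, map_add, hW.append_apply, hW.append_apply,
        List.cons_append, map_zero, add_zero]
  | zero => exact ⟨0, by simp only [map_zero, add_zero]⟩
  | add y y' _ _ h1 h2 =>
    obtain ⟨v, hv⟩ := h1
    obtain ⟨v', hv'⟩ := h2
    exact ⟨v + v', by simp only [map_add, hv, hv']; abel⟩
  | smul a y _ h1 =>
    obtain ⟨v, hv⟩ := h1
    exact ⟨a • v, by simp only [map_smul, hv, smul_add]⟩

/-- Every element is the sum of its part of word length zero and of the parts ending in the letters of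
a finite set, which may be enlarged. -/
theorem exists_finset_eq_sum_append (y : M) : ∃ (v : V) (I : Finset ι),
    ∀ J, I ⊆ J → y = W [] v + ∑ i ∈ J, append i (strip i y) := by
  classical
  induction hW.span y using Submodule.span_induction with
  | mem y hy =>
    obtain ⟨l, v, rfl⟩ := hy
    rcases List.eq_nil_or_concat' l with rfl | ⟨l, j, rfl⟩
    · refine ⟨v, ∅, fun J _ => ?_⟩
      rw [Finset.sum_eq_zero fun i _ => by rw [hW.strip_nil, map_zero], add_zero]
    · refine ⟨0, {j}, fun J hJ => ?_⟩
      rw [Finset.sum_eq_single_of_mem j (hJ (Finset.mem_singleton_self j))]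
      · rw [hW.strip_self, hW.append_apply, map_zero, zero_add]
      · intro i _ hi
        rw [hW.strip_ne i j l v hi.symm, map_zero]
  | zero => exact ⟨0, ∅, by simp⟩
  | add y y' _ _ h1 h2 =>
    obtain ⟨v, I, hI⟩ := h1
    obtain ⟨v', I', hI'⟩ := h2
    refine ⟨v + v', I ∪ I', fun J hJ => ?_⟩
    have e1 := hI J (Finset.union_subset_left hJ)
    have e2 := hI' J (Finset.union_subset_right hJ)
    simp only [map_add, Finset.sum_add_distrib]
    nth_rewrite 1 [e1]
    nth_rewrite 1 [e2]
    abel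
  | smul a y _ h1 =>
    obtain ⟨v, I, hI⟩ := h1
    refine ⟨a • v, I, fun J hJ => ?_⟩
    simp only [map_smul, ← Finset.smul_sum]
    nth_rewrite 1 [hI J hJ]
    rw [smul_add]

end

/-- The span of the words of length less than `m`. -/
def length (W : List ι → V →ₗ[R] M) (m : ℕ) : Submodule R M :=
  Submodule.span R {y | ∃ l v, l.length < m ∧ y = W l v}

section

variable (hW : IsWordComplex W δ φ d strip append zero)
include hW

theorem strip_mem_length {m : ℕ} (i : ι) {y : M} (hy : y ∈ length W (m + 1)) :
    strip i y ∈ length W m := by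
  have : length W (m + 1) ≤ (length W m).comap (strip i) := Submodule.span_le.2 ?_
  · exact this hy
  rintro _ ⟨l, v, hl, rfl⟩
  rw [SetLike.mem_coe, Submodule.mem_comap]
  rcases List.eq_nil_or_concat' l with rfl | ⟨l, j, rfl⟩
  · rw [hW.strip_nil]; exact zero_mem _
  · by_cases hj : j = i
    · subst hj
      rw [hW.strip_self]
      exact Submodule.subset_span ⟨l, v, by simpa using hl, rfl⟩
    · rw [hW.strip_ne _ _ _ _ hj]
      exact zero_mem _

theorem exists_mem_length (y : M) : ∃ m, y ∈ length W m := by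
  have hmono : Monotone (length W) := fun m m' hm => Submodule.span_mono (by
    rintro _ ⟨l, v, hl, rfl⟩
    exact ⟨l, v, hl.trans_le hm, rfl⟩)
  induction hW.span y using Submodule.span_induction with
  | mem y hy =>
    obtain ⟨l, v, rfl⟩ := hy
    exact ⟨l.length + 1, Submodule.subset_span ⟨l, v, Nat.lt_succ_self _, rfl⟩⟩
  | zero => exact ⟨0, zero_mem _⟩
  | add y y' _ _ h1 h2 =>
    obtain ⟨m, hm⟩ := h1
    obtain ⟨m', hm'⟩ := h2
    exact ⟨max m m', add_mem (hmono (le_max_left _ _) hm) (hmono (le_max_right _ _) hm')⟩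
  | smul a y _ h1 =>
    obtain ⟨m, hm⟩ := h1
    exact ⟨m, Submodule.smul_mem _ a hm⟩

theorem range_d_le {I : Ideal R} (hδ : ∀ v, δ v ∈ I • (⊤ : Submodule R V))
    (hφ : ∀ i v, φ i v ∈ I • (⊤ : Submodule R V)) :
    LinearMap.range d ≤ I • (⊤ : Submodule R M) := by
  have hmap : ∀ l, ∀ v ∈ I • (⊤ : Submodule R V), W l v ∈ I • (⊤ : Submodule R M) :=
    fun l v hv => Submodule.smul_top_le_comap_smul_top I (W l) hv
  rintro _ ⟨y, rfl⟩
  induction hW.span y using Submodule.span_induction with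
  | mem y hy =>
    obtain ⟨l, v, rfl⟩ := hy
    rcases l with _ | ⟨i, l⟩
    · rw [hW.d_nil]; exact hmap _ _ (hδ v)
    · rw [hW.d_cons]; exact add_mem (hmap _ _ (hδ v)) (hmap _ _ (hφ i v))
  | zero => rw [map_zero]; exact zero_mem _
  | add y y' _ _ h1 h2 => rw [map_add]; exact add_mem h1 h2
  | smul a y _ h1 => rw [map_smul]; exact Submodule.smul_mem _ a h1

theorem apply_zero_d {N : Type*} [AddCommGroup N] [Module R N] (η : V →ₗ[R] N)
    (hδ : ∀ v, η (δ v) = 0) (hφ : ∀ i v, η (φ i v) = 0) (y : M) : η (zero (d y)) = 0 := by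
  induction hW.span y using Submodule.span_induction with
  | mem y hy =>
    obtain ⟨l, v, rfl⟩ := hy
    rcases l with _ | ⟨i, l⟩
    · rw [hW.d_nil, hW.zero_nil, hδ]
    · rw [hW.d_cons, map_add, hW.zero_cons, zero_add]
      rcases l with _ | ⟨j, l⟩
      · rw [hW.zero_nil, hφ]
      · rw [hW.zero_cons, map_zero]
  | zero => simp only [map_zero]
  | add y y' _ _ h1 h2 => simp only [map_add, h1, h2, add_zero]
  | smul a y _ h1 => simp only [map_smul, h1, smul_zero]

/-- Suppose that the cycles `u` and `φ_i u` of `V` represent a basis of its homology over `k`.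
Then a cycle of `M` is a boundary plus a multiple of `u`. Removing the last letter of a cycle
gives cycles of smaller word length, so by induction a cycle is, up to a boundary, of the form
`v + ∑ a_i u | c_i` with `v ∈ V` and `a_i ∈ k`. Its differential is `δ v + ∑ a_i φ_i u`, so the `a_i`
are zero and `v` is a cycle, hence a sum of a boundary, a multiple of `u` and a combination of the
`φ_i u = d (u | c_i)`. -/
theorem exists_eq_d_add {u : V} (hu : δ u = 0)
    (hspan : ∀ v, δ v = 0 → ∃ c w, v = δ w +
      Finsupp.linearCombination k (fun i : Option ι => i.elim u fun i => φ i u) c)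
    (hind : ∀ c w, Finsupp.linearCombination k (fun i : Option ι => i.elim u fun i => φ i u) c =
      δ w → c = 0)
    (hdd : ∀ y, d (d y) = 0) (y : M) (hy : d y = 0) : ∃ (w : M) (a : k), y = d w + a • W [] u := by
  classical
  obtain ⟨m, hm⟩ := hW.exists_mem_length y
  induction m generalizing y with
  | zero =>
    have : length W 0 = ⊥ := by
      rw [length, Submodule.span_eq_bot]
      rintro _ ⟨l, v, hl, rfl⟩
      exact absurd hl (Nat.not_lt_zero _)
    rw [this] at hm
    exact ⟨0, 0, by rw [(Submodule.mem_bot R).1 hm]; simp⟩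
  | succ m ih =>
    have hstrip : ∀ i, d (strip i y) = 0 := fun i => by
      rw [← hW.strip_d, hy, map_zero]
    choose w a hw using fun i => ih (strip i y) (hstrip i) (hW.strip_mem_length i hm)
    obtain ⟨v, I, hI⟩ := hW.exists_finset_eq_sum_append y
    choose v' hv' using fun i => hW.exists_d_append i (w i)
    have hk : ∀ (ψ : M →ₗ[R] M) (c : k) (y : M), ψ (c • y) = c • ψ y :=
      fun ψ c y => (ψ.restrictScalars k).map_smul c y
    have hk' : ∀ (ψ : V →ₗ[R] M) (c : k) (y : V), ψ (c • y) = c • ψ y :=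
      fun ψ c y => (ψ.restrictScalars k).map_smul c y
    have hk'' : ∀ (ψ : M →ₗ[R] V) (c : k) (y : M), ψ (c • y) = c • ψ y :=
      fun ψ c y => (ψ.restrictScalars k).map_smul c y
    -- up to a boundary, `y` has words of length at most one with scalar coefficients
    obtain ⟨v₀, hv₀⟩ : ∃ v₀ : V, y = d (∑ i ∈ I, append i (w i)) +
        (W [] v₀ + ∑ i ∈ I, a i • W [i] u) := by
      refine ⟨v - ∑ i ∈ I, v' i, ?_⟩
      nth_rewrite 1 [hI I subset_rfl]
      rw [map_sum, Finset.sum_congr rfl fun i _ => hv' i, Finset.sum_congr rfl fun i _ =>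
        congrArg (append i) (hw i), map_sub, map_sum]
      simp only [map_add, hk, hW.append_apply, List.nil_append, Finset.sum_add_distrib]
      abel
    have hd1 : ∀ i, d (W [i] u) = W [] (φ i u) := fun i => by
      rw [hW.d_cons, hu, map_zero, zero_add]
    have h0 : δ v₀ + ∑ i ∈ I, a i • φ i u = 0 := by
      have := congrArg (fun y => zero (d y)) hv₀
      simp only [hy, map_add, hdd, map_sum, hW.d_nil, hk, hk'', hd1, hW.zero_nil, map_zero,
        zero_add, Finset.sum_const_zero] at this
      exact this.symm
    have ha : ∀ i ∈ I, a i = 0 := by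
      have hc := hind (∑ i ∈ I, Finsupp.single (some i) (a i)) (-v₀) (by
        rw [map_sum, map_neg, eq_neg_iff_add_eq_zero, add_comm, ← h0]
        congr 1
        exact Finset.sum_congr rfl fun i _ => Finsupp.linearCombination_single k _ _)
      intro i hi
      have := DFunLike.congr_fun hc (some i)
      rw [Finsupp.finsetSum_apply, Finset.sum_eq_single_of_mem i hi] at this
      · simpa using this
      · intro j _ hj
        exact Finsupp.single_eq_of_ne (by simpa using hj.symm)
    have ha' : ∀ i ∈ I, a i • W [i] u = 0 := fun i hi => by rw [ha i hi, zero_smul]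
    have ha'' : ∀ i ∈ I, a i • φ i u = 0 := fun i hi => by rw [ha i hi, zero_smul]
    rw [Finset.sum_eq_zero ha', add_zero] at hv₀
    rw [Finset.sum_eq_zero ha'', add_zero] at h0
    obtain ⟨c, w₁, hcw⟩ := hspan v₀ h0
    have hcyc : ∀ c : Option ι →₀ k, ∃ (w : M) (a : k),
        W [] (Finsupp.linearCombination k (fun i : Option ι => i.elim u fun i => φ i u) c) =
          d w + a • W [] u := by
      intro c
      induction c using Finsupp.induction_linear with
      | zero => exact ⟨0, 0, by simp⟩
      | add c c' h1 h2 =>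
        obtain ⟨w, a, h1⟩ := h1
        obtain ⟨w', a', h2⟩ := h2
        exact ⟨w + w', a + a', by rw [map_add, map_add, h1, h2, map_add, add_smul]; abel⟩
      | single i a =>
        rw [Finsupp.linearCombination_single, hk']
        rcases i with _ | i
        · exact ⟨0, a, by rw [map_zero, zero_add]; rfl⟩
        · refine ⟨a • W [i] u, 0, ?_⟩
          rw [zero_smul, add_zero, hk, hd1]
          rfl
    obtain ⟨w₂, a', hw₂⟩ := hcyc c
    refine ⟨∑ i ∈ I, append i (w i) + (W [] w₁ + w₂), a', ?_⟩
    rw [hcw, map_add, hw₂] at hv₀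
    rw [map_add, map_add, hW.d_nil, add_assoc, add_assoc]
    exact hv₀

end

end IsWordComplex

end Words

/-! ### The complex `Y` -/

section YDifferential

variable {k R : Type u} [Field k] [CommRing R] [Algebra k R] {n : ℕ} {x : Fin n → R}
variable {ι : Type u} {z : ι → koszulZPlus x} (b : Module.Basis ι k (HPlus x))

/-- The map `α : C → K` that sends a basis element to its representing cycle. -/
abbrev alpha (z : ι → koszulZPlus x) : HPlus x →ₗ[k] Koszul R n :=
  b.constr k fun i => (z i : Koszul R n)

theorem alpha_basis (i : ι) : alpha b z (b i) = z i := b.constr_basis k _ i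

theorem dY_nil (v : Koszul R n) :
    dY x (alpha b z) (v ⊗ₜ wordBasis b []) = koszulD x v ⊗ₜ wordBasis b [] := by
  rw [wordBasis_nil, dY_tmul_one]

theorem dY_cons (v : Koszul R n) (i : ι) (l : List ι) :
    dY x (alpha b z) (v ⊗ₜ wordBasis b (i :: l)) =
      koszulD x v ⊗ₜ wordBasis b (i :: l) + (signMap R n v * z i) ⊗ₜ wordBasis b l := by
  rw [wordBasis_cons, dY_tmul_ι_mul, alpha_basis]

/-- The Leibniz rule. -/
theorem koszulD_mul (x : Fin n → R) (y y' : Koszul R n) :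
    koszulD x (y * y') = koszulD x y * y' + signMap R n y * koszulD x y' := by
  induction y using koszul_induction with
  | halg a =>
    have : signMap R n (algebraMap R _ a) = algebraMap R _ a :=
      AlgHom.commutes (CliffordAlgebra.involute (Q := (0 : QuadraticForm R (Fin n → R)))) a
    rw [this, koszulD_algebraMap, zero_mul, zero_add, ← Algebra.smul_def, ← Algebra.smul_def,
      map_smul]
  | hadd y v h1 h2 => simp only [add_mul, map_add, h1, h2]; abel
  | hmul m y h =>
    have : signMap R n (ExteriorAlgebra.ι R m) = -ExteriorAlgebra.ι R m :=
      CliffordAlgebra.involute_ι _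
    rw [mul_assoc, koszulD_ι_mul, koszulD_ι_mul, h, signMap_mul, this, sub_mul, smul_mul_assoc,
      mul_add, neg_mul, neg_mul, ← mul_assoc, ← mul_assoc]
    abel

variable {𝒜 : ℕ → Submodule k R} {h g : ι → ℕ}

theorem signMap_mul_eq_zero (hz : ∀ i, (z i : Koszul R n) ∈ koszulDeg 𝒜 n (h i) (g i))
    (hmul : ∀ i i', (z i : Koszul R n) * (z i' : Koszul R n) = 0) (v : Koszul R n) (i j : ι) :
    signMap R n (signMap R n v * z i) * z j = 0 := by
  rw [signMap_mul, signMap_of_mem (hz i), mul_assoc, smul_mul_assoc, hmul, smul_zero, mul_zero]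

/-- `d² = 0`: the only term that does not cancel by the Leibniz rule is
`± x α(c_1) α(c_2) | c_3 | ⋯`, which vanishes because products of the cycles do. -/
theorem dY_dY (hz : ∀ i, (z i : Koszul R n) ∈ koszulDeg 𝒜 n (h i) (g i))
    (hmul : ∀ i i', (z i : Koszul R n) * (z i' : Koszul R n) = 0) :
    dY x (alpha b z) ∘ₗ dY x (alpha b z) = 0 := by
  have hd : ∀ v i, koszulD x (signMap R n v * z i) = -(signMap R n (koszulD x v) * z i) := by
    intro v i
    rw [koszulD_mul, show koszulD x (z i : Koszul R n) = 0 from (z i).2.1, mul_zero, add_zero,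
      signMap_koszulD, neg_mul, neg_neg]
  refine y_ext b fun v l => ?_
  rw [LinearMap.comp_apply, LinearMap.zero_apply]
  rcases l with _ | ⟨i, l⟩
  · rw [dY_nil, dY_nil, koszulD_koszulD, TensorProduct.zero_tmul]
  · rw [dY_cons, map_add, dY_cons, koszulD_koszulD, TensorProduct.zero_tmul, zero_add]
    rcases l with _ | ⟨j, l⟩
    · rw [dY_nil, hd, TensorProduct.neg_tmul, add_neg_cancel]
    · rw [dY_cons, hd, TensorProduct.neg_tmul, signMap_mul_eq_zero hz hmul,
        TensorProduct.zero_tmul, add_zero, add_neg_cancel]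

/-! ### Exactness of `Y` -/

/-- The map `Y → Y` that removes the last letter if it is `i`. -/
def yStrip (i : ι) : Y k x →ₗ[R] Y k x :=
  TensorProduct.AlgebraTensorModule.map LinearMap.id (stripLast b i)

/-- The map `Y → Y` that appends the letter `i`. -/
def yAppend (i : ι) : Y k x →ₗ[R] Y k x :=
  TensorProduct.AlgebraTensorModule.map LinearMap.id
    (LinearMap.mulRight k (TensorAlgebra.ι k (b i)))

theorem yStrip_nil (i : ι) (v : Koszul R n) : yStrip b i (v ⊗ₜ wordBasis b []) = 0 := by
  rw [yStrip, TensorProduct.AlgebraTensorModule.map_tmul, stripLast_nil, TensorProduct.tmul_zero]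

open Classical in
theorem yStrip_concat (i j : ι) (v : Koszul R n) (l : List ι) :
    yStrip b i (v ⊗ₜ wordBasis b (l ++ [j])) = if j = i then v ⊗ₜ wordBasis b l else 0 := by
  rw [yStrip, TensorProduct.AlgebraTensorModule.map_tmul, stripLast_concat]
  split_ifs
  · rfl
  · rw [TensorProduct.tmul_zero]

theorem yAppend_tmul (i : ι) (v : Koszul R n) (l : List ι) :
    yAppend b i (v ⊗ₜ wordBasis b l) = v ⊗ₜ wordBasis b (l ++ [i]) := by
  rw [yAppend, TensorProduct.AlgebraTensorModule.map_tmul, wordBasis_concat]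
  rfl

/-- The projection of `Y` onto the part of word length zero. -/
def yZero : Y k x →ₗ[R] Koszul R n :=
  TensorProduct.AlgebraTensorModule.rid k R (Koszul R n) ∘ₗ
    TensorProduct.AlgebraTensorModule.map LinearMap.id TensorAlgebra.algebraMapInv.toLinearMap

theorem yZero_nil (v : Koszul R n) : yZero (v ⊗ₜ wordBasis b []) = v := by
  rw [wordBasis_nil]; simp [yZero]

theorem yZero_cons (v : Koszul R n) (i : ι) (l : List ι) :
    yZero (v ⊗ₜ[k] wordBasis b (i :: l)) = 0 := by
  simp [yZero, algebraMapInv_wordBasis_cons]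

/-- The map `v ↦ v | c_1 | ⋯ | c_m`. -/
def yWord (l : List ι) : Koszul R n →ₗ[R] Y k x :=
  (TensorProduct.AlgebraTensorModule.mk k R (Koszul R n)
    (TensorAlgebra k (HPlus x))).flip (wordBasis b l)

theorem yWord_apply (l : List ι) (v : Koszul R n) : yWord b l v = v ⊗ₜ wordBasis b l := rfl

/-- Here `φ_i v = (-1)^{|v|} v z_i`. -/
theorem isWordComplex_Y (z : ι → koszulZPlus x) :
    IsWordComplex (yWord b) (koszulD x)
      (fun i => LinearMap.mulRight R (z i : Koszul R n) ∘ₗ signMap R n) (dY x (alpha b z))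
      (yStrip b) (yAppend b) yZero where
  span y := by
    refine Submodule.span_mono ?_ ((yBasis b).mem_span y)
    rintro _ ⟨⟨s, l⟩, rfl⟩
    exact ⟨l, _, yBasis_apply b s l⟩
  d_nil v := dY_nil b v
  d_cons i l v := dY_cons b v i l
  strip_nil i v := yStrip_nil b i v
  strip_self i l v := (yStrip_concat b i i v l).trans (if_pos rfl)
  strip_ne i j l v hj := (yStrip_concat b i j v l).trans (if_neg hj)
  append_apply i l v := yAppend_tmul b i v l
  zero_nil v := yZero_nil b v
  zero_cons i l v := yZero_cons b v i l

/-- The cycles of `Y` are the boundaries plus the scalars. -/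
theorem exists_eq_dY_add
    (hspan : ∀ y : Koszul R n, koszulD x y = 0 →
      ∃ c w, y = koszulD x w + Finsupp.linearCombination k (koszulCycles z) c)
    (hind : ∀ c w, Finsupp.linearCombination k (koszulCycles z) c = koszulD x w → c = 0)
    (hdd : ∀ y, dY x (alpha b z) (dY x (alpha b z) y) = 0) (y : Y k x)
    (hy : dY x (alpha b z) y = 0) :
    ∃ (w : Y k x) (a : k), y = dY x (alpha b z) w + a • yWord b [] 1 := by
  have hcyc : koszulCycles z = fun i : Option ι => i.elim 1 fun i =>
      (LinearMap.mulRight R (z i : Koszul R n) ∘ₗ signMap R n) 1 := by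
    funext i
    rcases i with _ | i
    · rfl
    · change (z i : Koszul R n) = signMap R n 1 * z i
      rw [signMap_one, one_mul]
  rw [hcyc] at hspan hind
  exact (isWordComplex_Y b z).exists_eq_d_add (koszulD_one x) hspan hind hdd y hy

end YDifferential

/-! ### The bigrading of `Y` -/

section YGrading

variable {k R : Type u} [Field k] [CommRing R] [Algebra k R] {n : ℕ}
variable {𝒜 : ℕ → Submodule k R} [GradedAlgebra 𝒜] {x : Fin n → R}
variable {ι : Type u} {z : ι → koszulZPlus x} {b : Module.Basis ι k (HPlus x)} {h g : ι → ℕ}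

theorem mul_mem_koszulDeg {r j r' j' : ℕ} {v v' : Koszul R n} (hv : v ∈ koszulDeg 𝒜 n r j)
    (hv' : v' ∈ koszulDeg 𝒜 n r' j') : v * v' ∈ koszulDeg 𝒜 n (r + r') (j + j') := by
  have h := Submodule.mul_mem_mul hv hv'
  rw [koszulDeg, koszulDeg, Submodule.span_mul_span] at h
  refine Submodule.span_mono ?_ h
  rintro _ ⟨_, ⟨p, a, f, rfl, ha, rfl⟩, _, ⟨p', a', f', rfl, ha', rfl⟩, rfl⟩
  refine ⟨p + p', a * a', Fin.append f f', by omega, SetLike.GradedMul.mul_mem ha ha', ?_⟩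
  have : (fun s => T R (Fin.append f f' s)) =
      Fin.append (fun s => T R (f s)) (fun s => T R (f' s)) := by
    funext s
    refine Fin.addCases (fun s => ?_) (fun s => ?_) s <;> simp
  rw [this, List.ofFn_fin_append, List.prod_append]
  exact smul_mul_smul_comm a _ a' _

/-- The pieces of `C` are spanned by elements of the given basis: the component of a bihomogeneous cycle
in its own bidegree involves only the `z i` of that bidegree, up to the boundary of a component. -/
theorem suspDeg_eq_span (hx : ∀ i, x i ∈ 𝒜 1) (hb : ∀ i, b i = cls x (z i))
    (hz : ∀ i, (z i : Koszul R n) ∈ koszulDeg 𝒜 n (h i) (g i)) (p q : ℕ) :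
    suspDeg 𝒜 x p q = Submodule.span k (b '' {i | h i + 1 = p ∧ g i = q}) := by
  classical
  rcases p with _ | r
  · rw [show {i | h i + 1 = 0 ∧ g i = q} = (∅ : Set ι) from
      Set.eq_empty_of_forall_notMem fun i hi => Nat.succ_ne_zero _ hi.1, Set.image_empty,
      Submodule.span_empty]
    rfl
  refine le_antisymm (Submodule.span_le.2 ?_) (Submodule.span_le.2 ?_)
  · rintro _ ⟨y, hy, rfl⟩
    let e := koszulBasis R n
    let P : ℕ → Koszul R n →ₗ[k] Koszul R n := fun s =>
      gradedProj 𝒜 e Finset.card Finset.card s q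
    have hPd : ∀ y, P r (koszulD x y) = koszulD x (P (r + 1) y) :=
      gradedProj_comm 𝒜 e (by simpa only [koszulDeg_eq] using koszulD_mem_koszulDeg hx)
        (fun j => by
          have := koszulD_of_mem_zero (𝒜 := 𝒜) (x := x) (j := j)
          rwa [koszulDeg_eq] at this) r q
    have hP : ∀ r' j', ∀ v ∈ koszulDeg 𝒜 n r' j', P r v = if r' = r ∧ j' = q then v else 0 := by
      intro r' j' v hv
      rw [koszulDeg_eq] at hv
      split_ifs with hrj
      · rw [hrj.1, hrj.2] at hv
        exact gradedProj_of_mem 𝒜 e hv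
      · exact gradedProj_of_mem_ne 𝒜 e hv hrj
    let S : Set ι := {i | h i + 1 = r + 1 ∧ g i = q}
    have hPc : ∀ c : ι →₀ k, P r (Finsupp.linearCombination k z c : koszulZPlus x) =
        (Finsupp.linearCombination k z (c.filter (· ∈ S)) : koszulZPlus x) := by
      intro c
      induction c using Finsupp.induction_linear with
      | zero => rw [Finsupp.filter_zero, map_zero, ZeroMemClass.coe_zero, map_zero]
      | add c c' h1 h2 =>
        rw [map_add, Submodule.coe_add, map_add, h1, h2, Finsupp.filter_add, map_add,
          Submodule.coe_add]
      | single i a =>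
        rw [Finsupp.linearCombination_single]
        change P r (a • (z i : Koszul R n)) = _
        rw [map_smul, hP _ _ _ (hz i)]
        by_cases hi : i ∈ S
        · rw [if_pos ⟨Nat.succ_injective hi.1, hi.2⟩, Finsupp.filter_single_of_pos _ hi,
            Finsupp.linearCombination_single]
          rfl
        · rw [if_neg fun h' => hi ⟨congrArg _ h'.1, h'.2⟩, Finsupp.filter_single_of_neg _ hi,
            map_zero, smul_zero]
          rfl
    let c := b.repr (cls x y)
    have h1 : cls x (Finsupp.linearCombination k z c) = cls x y := by
      rw [mk_linearCombination hb, LinearEquiv.symm_apply_apply]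
    obtain ⟨w, hw⟩ := (Submodule.Quotient.eq _).1 h1
    have hw' : koszulD x w = (Finsupp.linearCombination k z c : koszulZPlus x) - (y : Koszul R n) :=
      hw
    have h2 : cls x (Finsupp.linearCombination k z (c.filter (· ∈ S))) = cls x y := by
      refine (Submodule.Quotient.eq _).2 ⟨P (r + 1) w, ?_⟩
      rw [← hPd, hw', map_sub, hPc, hP _ _ _ hy, if_pos ⟨rfl, rfl⟩]
      rfl
    rw [← h2, mk_linearCombination hb, b.repr_symm_apply]
    refine (Finsupp.mem_span_image_iff_linearCombination k).2 ⟨_, ?_, rfl⟩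
    intro i hi
    by_contra hi'
    exact Finsupp.mem_support_iff.1 hi (Finsupp.filter_apply_neg (· ∈ S) c hi')
  · rintro _ ⟨i, ⟨hi, rfl⟩, rfl⟩
    obtain rfl := Nat.succ_injective hi
    exact Submodule.subset_span ⟨z i, hz i, hb i⟩

omit [GradedAlgebra 𝒜] in
theorem yWord_mem {l : List ι} {r j : ℕ} {v : Koszul R n} (hv : v ∈ koszulDeg 𝒜 n r j) :
    yWord b l v ∈
      gradedPiece 𝒜 (yBasis b) (yHom h) (yInt g) (r + wordHom h l) (j + wordInt g l) := by
  rw [koszulDeg_eq] at hv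
  have : gradedPiece 𝒜 (koszulBasis R n) Finset.card Finset.card r j ≤
      (gradedPiece 𝒜 (yBasis b) (yHom h) (yInt g) (r + wordHom h l) (j + wordInt g l)).comap
        ((yWord b l).restrictScalars k) := Submodule.span_le.2 ?_
  · exact this hv
  rintro _ ⟨s, p, a, rfl, rfl, ha, rfl⟩
  refine Submodule.subset_span ⟨(ULift.up s, l), p, a, rfl, ?_, ha, ?_⟩
  · exact (add_assoc _ _ _).symm
  · rw [yBasis_apply]
    exact (yWord b l).map_smul a (koszulBasis R n s)

/-- The bigrading of `Y` is the one for which the elements of `yBasis` are bihomogeneous. -/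
theorem yDeg_eq (hx : ∀ i, x i ∈ 𝒜 1) (hb : ∀ i, b i = cls x (z i))
    (hz : ∀ i, (z i : Koszul R n) ∈ koszulDeg 𝒜 n (h i) (g i)) (r j : ℕ) :
    yDeg 𝒜 x r j = gradedPiece 𝒜 (yBasis b) (yHom h) (yInt g) r j := by
  refine le_antisymm (Submodule.span_le.2 ?_) (Submodule.span_le.2 ?_)
  · rintro _ ⟨p, q, p', q', v, t, rfl, rfl, hv, ht, rfl⟩
    rw [tensorDeg_eq_span b (suspDeg_eq_span hx hb hz)] at ht
    have : Submodule.span k (wordBasis b '' {l | wordHom h l = p' ∧ wordInt g l = q'}) ≤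
        (gradedPiece 𝒜 (yBasis b) (yHom h) (yInt g) (p + p') (q + q')).comap
          (TensorProduct.mk k (Koszul R n) (TensorAlgebra k (HPlus x)) v) := Submodule.span_le.2 ?_
    · exact this ht
    rintro _ ⟨l, ⟨rfl, rfl⟩, rfl⟩
    exact yWord_mem hv
  · rintro _ ⟨⟨s, l⟩, p, a, rfl, rfl, ha, rfl⟩
    rw [yBasis_apply]
    refine Submodule.subset_span ⟨s.down.card, p + s.down.card, wordHom h l, wordInt g l,
      a • koszulBasis R n s.down, wordBasis b l, rfl, ?_, ?_, ?_, rfl⟩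
    · exact add_assoc _ _ _
    · rw [koszulDeg_eq]
      exact smul_mem_gradedPiece 𝒜 _ ha rfl rfl
    · rw [tensorDeg_eq_span b (suspDeg_eq_span hx hb hz)]
      exact Submodule.subset_span ⟨l, ⟨rfl, rfl⟩, rfl⟩

omit [GradedAlgebra 𝒜] in
theorem signMap_mem_koszulDeg {r j : ℕ} {v : Koszul R n} (hv : v ∈ koszulDeg 𝒜 n r j) :
    signMap R n v ∈ koszulDeg 𝒜 n r j := by
  rw [signMap_of_mem hv]
  exact zsmul_mem hv _

theorem dY_mem (hx : ∀ i, x i ∈ 𝒜 1)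
    (hz : ∀ i, (z i : Koszul R n) ∈ koszulDeg 𝒜 n (h i) (g i)) (r j : ℕ) :
    ∀ y ∈ gradedPiece 𝒜 (yBasis b) (yHom h) (yInt g) (r + 1) j,
      dY x (alpha b z) y ∈ gradedPiece 𝒜 (yBasis b) (yHom h) (yInt g) r j := by
  intro y hy
  refine map_mem_gradedPiece 𝒜 (yBasis b) (yBasis b) (dY x (alpha b z)) ?_ hy
  rintro ⟨s, l⟩ hs
  rw [yBasis_apply]
  have hv : koszulBasis R n s.down ∈ koszulDeg 𝒜 n s.down.card s.down.card := by
    rw [koszulDeg_eq]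
    exact basis_mem_gradedPiece 𝒜 (koszulBasis R n) s.down
  have hdv : koszulD x (koszulBasis R n s.down) ⊗ₜ wordBasis b l ∈
      gradedPiece 𝒜 (yBasis b) (yHom h) (yInt g) r (yInt g (s, l)) := by
    rcases hc : s.down.card with _ | m
    · rw [koszulD_of_mem_zero (𝒜 := 𝒜) (j := 0) _ (by rwa [hc] at hv), TensorProduct.zero_tmul]
      exact zero_mem _
    · rw [hc] at hv
      have := yWord_mem (b := b) (h := h) (g := g) (l := l) (koszulD_mem_koszulDeg hx _ _ _ hv)
      rw [yInt, hc]
      rw [yHom, hc] at hs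
      rwa [show r = m + wordHom h l by change m + 1 + wordHom h l = r + 1 at hs; omega]
  rcases l with _ | ⟨i, l⟩
  · rw [dY_nil]; exact hdv
  · rw [dY_cons]
    refine add_mem hdv ?_
    have := yWord_mem (b := b) (h := h) (g := g) (l := l)
      (mul_mem_koszulDeg (signMap_mem_koszulDeg hv) (hz i))
    have hr : s.down.card + h i + wordHom h l = r := by
      change s.down.card + (h i + 1 + wordHom h l) = r + 1 at hs
      omega
    have hj : s.down.card + g i + wordInt g l = yInt g (s, i :: l) := by
      change _ = s.down.card + (g i + wordInt g l)
      omega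
    rwa [hr, hj] at this

omit [GradedAlgebra 𝒜] in
theorem dY_of_mem_zero (j : ℕ) :
    ∀ y ∈ gradedPiece 𝒜 (yBasis b) (yHom h) (yInt g) 0 j, dY x (alpha b z) y = 0 := by
  intro y hy
  refine (eq_of_mem_gradedPiece (φ := dY x (alpha b z)) (ψ := 0) ?_ hy).trans rfl
  rintro ⟨s, l⟩ hs
  rw [yBasis_apply, LinearMap.zero_apply]
  rcases l with _ | ⟨i, l⟩
  · have hc : s.down.card = 0 := hs
    rw [dY_nil, Finset.card_eq_zero.1 hc, koszulBasis_empty, koszulD_one, TensorProduct.zero_tmul]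
  · change s.down.card + (h i + 1 + wordHom h l) = 0 at hs
    omega

/-! ### `Y` is a minimal graded free resolution -/

/-- The augmentation of `Y`: the projections `Y → K → R → k`. -/
def yAug (𝒜 : ℕ → Submodule k R) [GradedAlgebra 𝒜] (x : Fin n → R) : Y k x →ₗ[R] Residue 𝒜 :=
  (Submodule.mkQ (plusIdeal 𝒜) ∘ₗ (koszulAug R n).toLinearMap) ∘ₗ yZero

theorem yAug_nil (v : Koszul R n) :
    yAug 𝒜 x (v ⊗ₜ wordBasis b []) = Submodule.Quotient.mk (koszulAug R n v) :=
  congrArg (fun v => Submodule.Quotient.mk (koszulAug R n v)) (yZero_nil b v)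

theorem yAug_cons (v : Koszul R n) (i : ι) (l : List ι) :
    yAug 𝒜 x (v ⊗ₜ wordBasis b (i :: l)) = 0 := by
  rw [yAug, LinearMap.comp_apply, yZero_cons, map_zero]

theorem yAug_surjective (b : Module.Basis ι k (HPlus x)) : Function.Surjective (yAug 𝒜 x) := by
  intro y
  obtain ⟨a, rfl⟩ := Submodule.Quotient.mk_surjective _ y
  exact ⟨algebraMap R (Koszul R n) a ⊗ₜ wordBasis b [], by
    rw [yAug_nil, koszulAug_algebraMap]⟩

theorem yAug_dY (hx : ∀ i, x i ∈ 𝒜 1) (y : Y k x) : yAug 𝒜 x (dY x (alpha b z) y) = 0 := by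
  refine (isWordComplex_Y b z).apply_zero_d
    (Submodule.mkQ (plusIdeal 𝒜) ∘ₗ (koszulAug R n).toLinearMap) (fun v => ?_) (fun i v => ?_) y
  · exact (Submodule.Quotient.mk_eq_zero _).2
      (span_range_le_plusIdeal hx (koszulAug_koszulD_mem x v))
  · change Submodule.Quotient.mk (koszulAug R n (signMap R n v * z i)) = _
    rw [map_mul, koszulAug_of_mem (z i).2.2, mul_zero, Submodule.Quotient.mk_zero]

theorem yAug_of_mem_ne {r j : ℕ} (hrj : (r, j) ≠ (0, 0)) :
    ∀ y ∈ gradedPiece 𝒜 (yBasis b) (yHom h) (yInt g) r j, yAug 𝒜 x y = 0 := by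
  intro y hy
  induction hy using Submodule.span_induction with
  | mem y hy =>
    obtain ⟨⟨s, l⟩, p, a, rfl, rfl, ha, rfl⟩ := hy
    rw [map_smul, yBasis_apply]
    rcases l with _ | ⟨i, l⟩
    · rw [yAug_nil]
      by_cases hs : s.down.card = 0
      · have hp : p ≠ 0 := by
          rintro rfl
          refine hrj (Prod.ext hs ?_)
          change 0 + (s.down.card + 0) = 0
          omega
        rw [Finset.card_eq_zero.1 hs, koszulBasis_empty, map_one]
        refine (Submodule.Quotient.mk_eq_zero _).2 ?_
        exact Ideal.mul_mem_right _ _ (mem_plusIdeal_of_mem ha hp)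
      · rw [koszulAug_basis _ hs, Submodule.Quotient.mk_zero, smul_zero]
    · rw [yAug_cons, smul_zero]
  | zero => exact map_zero _
  | add y y' _ _ h1 h2 => rw [map_add, h1, h2, add_zero]
  | smul c y _ h1 =>
    rw [show yAug 𝒜 x (c • y) = c • yAug 𝒜 x y from
      ((yAug 𝒜 x).restrictScalars k).map_smul c y, h1, smul_zero]

/-- The cycles in the kernel of the augmentation are boundaries. -/
theorem exists_dY_eq (hR : IsStandardGraded 𝒜) (hx : ∀ i, x i ∈ 𝒜 1)
    (hx1 : 𝒜 1 ≤ Submodule.span k (Set.range x)) (hb : ∀ i, b i = cls x (z i))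
    (hz : ∀ i, (z i : Koszul R n) ∈ koszulDeg 𝒜 n (h i) (g i))
    (hmul : ∀ i i', (z i : Koszul R n) * (z i' : Koszul R n) = 0) (y : Y k x)
    (hy : dY x (alpha b z) y = 0) (hεy : yAug 𝒜 x y = 0) : ∃ w, dY x (alpha b z) w = y := by
  obtain ⟨w, a, hwa⟩ := exists_eq_dY_add b (koszulCycles_span hR hx1 hb)
    (koszulCycles_independent hR hx hb) (LinearMap.congr_fun (dY_dY b hz hmul)) y hy
  have ha : algebraMap k (Residue 𝒜) a = 0 := by
    rw [hwa, map_add, yAug_dY hx, zero_add] at hεy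
    have : yAug 𝒜 x (a • yWord b [] 1) = a • yAug 𝒜 x (yWord b [] 1) :=
      ((yAug 𝒜 x).restrictScalars k).map_smul a _
    rw [this, yWord_apply, yAug_nil, map_one] at hεy
    rw [Algebra.algebraMap_eq_smul_one]
    exact hεy
  rw [(map_eq_zero_iff _ hR.algebraMap_residue_bijective.1).1 ha, zero_smul, add_zero] at hwa
  exact ⟨w, hwa.symm⟩

/-- `d(Y) ⊆ R_+ Y`, since both the `x_i` and the coefficients of the `z i` lie in `R_+`. -/
theorem range_dY_le (hR : IsStandardGraded 𝒜) (hx : ∀ i, x i ∈ 𝒜 1)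
    (hxk : LinearIndependent k x) (hb : ∀ i, b i = cls x (z i))
    (hz : ∀ i, (z i : Koszul R n) ∈ koszulDeg 𝒜 n (h i) (g i)) :
    LinearMap.range (dY x (alpha b z)) ≤ plusIdeal 𝒜 • (⊤ : Submodule R (Y k x)) := by
  refine (isWordComplex_Y b z).range_d_le (fun v => ?_) (fun i v => ?_)
  · exact Submodule.smul_mono_left (span_range_le_plusIdeal hx) (koszulD_mem_smul_top x v)
  · exact Submodule.smul_top_le_comap_smul_top _ (LinearMap.mulLeft R (signMap R n v))
      (mem_plusIdeal_smul_of_koszulD_eq_zero hR hxk (degree_ne_zero hb hz i) (hz i) (z i).2.1)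

theorem isMinimalGradedFreeResolution_dY (hR : IsStandardGraded 𝒜) (hx : ∀ i, x i ∈ 𝒜 1)
    (hx1 : 𝒜 1 ≤ Submodule.span k (Set.range x)) (hxk : LinearIndependent k x)
    (hb : ∀ i, b i = cls x (z i))
    (hz : ∀ i, (z i : Koszul R n) ∈ koszulDeg 𝒜 n (h i) (g i))
    (hmul : ∀ i i', (z i : Koszul R n) * (z i' : Koszul R n) = 0) :
    IsMinimalGradedFreeResolution 𝒜 (yDeg 𝒜 x) (dY x (alpha b z)) := by
  have hdeg : yDeg 𝒜 x = gradedPiece 𝒜 (yBasis b) (yHom h) (yInt g) :=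
    funext fun r => funext fun j => yDeg_eq hx hb hz r j
  have hex := exists_dY_eq hR hx hx1 hb hz hmul
  rw [hdeg]
  have hcomm := gradedProj_comm 𝒜 (yBasis b) (dY_mem (b := b) hx hz) dY_of_mem_zero
  have hlift : ∀ r j, ∀ y ∈ gradedPiece 𝒜 (yBasis b) (yHom h) (yInt g) r j,
      dY x (alpha b z) y = 0 → yAug 𝒜 x y = 0 →
      ∃ w ∈ gradedPiece 𝒜 (yBasis b) (yHom h) (yInt g) (r + 1) j, dY x (alpha b z) w = y := by
    intro r j y hy hdy hεy
    obtain ⟨w, hw⟩ := hex y hdy hεy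
    refine ⟨_, gradedProj_mem 𝒜 (yBasis b) _ _ w, ?_⟩
    rw [← hcomm, hw, gradedProj_of_mem 𝒜 (yBasis b) hy]
  exact {
    free := ⟨_, yBasis b, yHom h, yInt g, fun r j => rfl⟩
    map_succ := dY_mem hx hz
    map_zero := dY_of_mem_zero
    d_comp_d := dY_dY b hz hmul
    exact_succ := fun r j y hy hdy => hlift _ _ y hy hdy (yAug_of_mem_ne (by simp) y hy)
    augmentation := ⟨yAug 𝒜 x, yAug_surjective b, LinearMap.ext (yAug_dY hx),
      fun r j hrj => yAug_of_mem_ne hrj,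
      fun j y hy => hlift 0 j y hy (dY_of_mem_zero j y hy)⟩
    minimal := range_dY_le hR hx hxk hb hz }

/-- The basis elements of `Y` of homological degree `r` give a basis of `Tor_r(k, k)`. -/
theorem nonempty_tor_basis_yBasis (hR : IsStandardGraded 𝒜) (hx : ∀ i, x i ∈ 𝒜 1)
    (hx1 : 𝒜 1 ≤ Submodule.span k (Set.range x)) (hxk : LinearIndependent k x)
    (hb : ∀ i, b i = cls x (z i))
    (hz : ∀ i, (z i : Koszul R n) ∈ koszulDeg 𝒜 n (h i) (g i))
    (hmul : ∀ i i', (z i : Koszul R n) * (z i' : Koszul R n) = 0) (r : ℕ) :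
    Nonempty (Module.Basis {p : ULift.{u} (Finset (Fin n)) × List ι | yHom h p = r} k
      (TorKK 𝒜 r)) := by
  refine nonempty_tor_basis (yBasis b) hR (range_dY_le hR hx hxk hb hz) (dY_mem hx hz)
    dY_of_mem_zero (LinearMap.congr_fun (dY_dY b hz hmul)) (yAug 𝒜 x) (yAug_surjective b)
    (yAug_dY hx) (fun p hp => ?_) (exists_dY_eq hR hx hx1 hb hz hmul) r
  exact yAug_of_mem_ne (fun h0 => hp (congrArg Prod.fst h0)) _
    (basis_mem_gradedPiece 𝒜 (yBasis b) (h := yHom h) (g := yInt g) p)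

/-- The basis elements of `Y` of bidegree `(r, j)` give a basis of `Tor_{r,j}(k, k)`. -/
theorem nonempty_biTor_basis_yBasis (hR : IsStandardGraded 𝒜) (hx : ∀ i, x i ∈ 𝒜 1)
    (hx1 : 𝒜 1 ≤ Submodule.span k (Set.range x)) (hxk : LinearIndependent k x)
    (hb : ∀ i, b i = cls x (z i))
    (hz : ∀ i, (z i : Koszul R n) ∈ koszulDeg 𝒜 n (h i) (g i))
    (hmul : ∀ i i', (z i : Koszul R n) * (z i' : Koszul R n) = 0)
    {M : Type u} [AddCommGroup M] [Module k M] [Module R M] [IsScalarTower k R M]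
    {ℳ : ℕ → ℕ → Submodule k M} {d : M →ₗ[R] M} (hM : IsGradedFreeResolution 𝒜 ℳ d) (r j : ℕ) :
    Nonempty (Module.Basis
      {p : ULift.{u} (Finset (Fin n)) × List ι | yHom h p = r ∧ yInt g p = j} k
      (BiTor 𝒜 ℳ d r j)) := by
  have hY := (isMinimalGradedFreeResolution_dY hR hx hx1 hxk hb hz
    hmul).toIsGradedFreeResolution
  have hdeg : yDeg 𝒜 x = gradedPiece 𝒜 (yBasis b) (yHom h) (yInt g) :=
    funext fun r => funext fun j => yDeg_eq hx hb hz r j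
  rw [hdeg] at hY
  obtain ⟨f⟩ := nonempty_biTor_equiv hM hY r j
  obtain ⟨B⟩ := nonempty_biTor_basis (yBasis b) (h := yHom h) (g := yInt g) hR
    (range_dY_le hR hx hxk hb hz) r j
  exact ⟨B.map f.symm⟩

end YGrading

/-! ### Generating series of weighted sets -/

section Generating

variable {σ A B ι : Type*}

/-- The generating series `∑_a X ^ deg a` of a set `A` with a degree function whose fibres are
finite. -/
def gen (deg : A → σ →₀ ℕ) : MvPowerSeries σ ℤ := fun m => (Nat.card {a // deg a = m} : ℤ)

theorem coeff_gen (deg : A → σ →₀ ℕ) (m : σ →₀ ℕ) :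
    MvPowerSeries.coeff m (gen deg) = (Nat.card {a // deg a = m} : ℤ) := rfl

theorem gen_equiv (f : A ≃ B) (deg : B → σ →₀ ℕ) : gen (fun a => deg (f a)) = gen deg := by
  ext m
  rw [coeff_gen, coeff_gen]
  exact congrArg _ (Nat.card_congr (f.subtypeEquiv fun a => Iff.rfl))

theorem gen_sum (deg : A → σ →₀ ℕ) (deg' : B → σ →₀ ℕ) (hA : ∀ m, Finite {a // deg a = m})
    (hB : ∀ m, Finite {a // deg' a = m}) : gen (Sum.elim deg deg') = gen deg + gen deg' := by
  ext m
  rw [map_add, coeff_gen, coeff_gen, coeff_gen, Nat.card_congr (Equiv.subtypeSum (p := fun a =>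
    Sum.elim deg deg' a = m))]
  have := Fintype.ofFinite {a // deg a = m}
  have := Fintype.ofFinite {a // deg' a = m}
  change (Nat.card ({a // deg a = m} ⊕ {a // deg' a = m}) : ℤ) = _
  simp only [Nat.card_eq_fintype_card, Fintype.card_sum, Nat.cast_add]

/-- Adding degrees on a product of sets corresponds to multiplying generating series. -/
theorem gen_prod (deg : A → σ →₀ ℕ) (deg' : B → σ →₀ ℕ) (hA : ∀ m, Finite {a // deg a = m})
    (hB : ∀ m, Finite {a // deg' a = m}) :
    gen (fun p : A × B => deg p.1 + deg' p.2) = gen deg * gen deg' := by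
  classical
  ext m
  rw [MvPowerSeries.coeff_mul]
  simp only [coeff_gen]
  let f : {p : A × B // deg p.1 + deg' p.2 = m} ≃
      Σ q : Finset.HasAntidiagonal.antidiagonal m, {a // deg a = q.1.1} × {a // deg' a = q.1.2} :=
    { toFun := fun p => ⟨⟨(deg p.1.1, deg' p.1.2), Finset.HasAntidiagonal.mem_antidiagonal.2 p.2⟩,
        ⟨p.1.1, rfl⟩, ⟨p.1.2, rfl⟩⟩
      invFun := fun s => ⟨(s.2.1.1, s.2.2.1), by
        rw [s.2.1.2, s.2.2.2]; exact Finset.HasAntidiagonal.mem_antidiagonal.1 s.1.2⟩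
      left_inv := fun p => rfl
      right_inv := by
        rintro ⟨⟨⟨m₁, m₂⟩, hm⟩, ⟨a, ha⟩, ⟨a', ha'⟩⟩
        change deg a = m₁ at ha
        change deg' a' = m₂ at ha'
        subst ha ha'
        rfl }
  rw [Nat.card_congr f, Nat.card_sigma, Nat.cast_sum]
  simp only [Nat.card_prod, Nat.cast_mul]
  exact Finset.sum_coe_sort _ fun q : (σ →₀ ℕ) × (σ →₀ ℕ) =>
    (Nat.card {a // deg a = q.1} : ℤ) * (Nat.card {a // deg' a = q.2} : ℤ)

theorem gen_fintype [Fintype A] (deg : A → σ →₀ ℕ) :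
    gen deg = ∑ a, MvPowerSeries.monomial (deg a) 1 := by
  classical
  ext m
  rw [coeff_gen, map_sum, Nat.card_eq_fintype_card, Fintype.card_subtype, Finset.card_filter]
  push_cast
  exact Finset.sum_congr rfl fun a _ => by
    rw [MvPowerSeries.coeff_monomial]; simp only [eq_comm]

theorem gen_const_add (deg : A → σ →₀ ℕ) (t : σ →₀ ℕ) (hA : ∀ m, Finite {a // deg a = m}) :
    gen (fun a => t + deg a) = MvPowerSeries.monomial t 1 * gen deg := by
  have h1 := gen_prod (fun _ : Unit => t) deg (fun m => inferInstance) hA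
  rw [gen_fintype (fun _ : Unit => t), Finset.univ_unique, Finset.sum_singleton] at h1
  rw [← h1]
  exact gen_equiv (Equiv.punitProd A).symm (fun p : Unit × A => t + deg p.2)

theorem gen_zero_unit : gen (fun _ : Unit => (0 : σ →₀ ℕ)) = 1 := by
  rw [gen_fintype, Finset.univ_unique, Finset.sum_singleton]
  rfl

/-- An additional element of degree zero adds `1`. -/
theorem gen_option (w : ι → σ →₀ ℕ) (hw : ∀ m, Finite {i // w i = m}) :
    gen (fun i : Option ι => i.elim 0 w) = gen w + 1 := by
  rw [← gen_zero_unit, ← gen_sum w _ hw fun m => inferInstance,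
    ← gen_equiv (Equiv.optionEquivSumPUnit ι)]
  congr 1
  funext i
  rcases i with _ | i <;> rfl

/-- A word is empty or consists of a letter and a word. -/
theorem gen_list (w : ι → σ →₀ ℕ) (hw : ∀ m, Finite {i // w i = m})
    (hl : ∀ m, Finite {l : List ι // (l.map w).sum = m}) :
    gen (fun l : List ι => (l.map w).sum) = 1 + gen w * gen fun l : List ι => (l.map w).sum := by
  let f : List ι ≃ Unit ⊕ ι × List ι :=
    { toFun := fun l => l.casesOn (Sum.inl ()) fun i l => Sum.inr (i, l)
      invFun := Sum.elim (fun _ => []) fun p => p.1 :: p.2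
      left_inv := fun l => by cases l <;> rfl
      right_inv := fun s => by rcases s with _ | _ <;> rfl }
  have hdeg : (fun l : List ι => (l.map w).sum) = fun l =>
      Sum.elim (fun _ : Unit => 0) (fun p : ι × List ι => w p.1 + (p.2.map w).sum) (f l) := by
    funext l
    rcases l with _ | ⟨i, l⟩
    · rfl
    · exact List.sum_cons
  have hfin : ∀ m, Finite {p : ι × List ι // w p.1 + (p.2.map w).sum = m} := fun m => by
    refine Finite.of_injective (β := {l : List ι // (l.map w).sum = m})
      (fun p => ⟨p.1.1 :: p.1.2, by rw [List.map_cons, List.sum_cons]; exact p.2⟩) ?_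
    rintro ⟨⟨i, l⟩, hp⟩ ⟨⟨i', l'⟩, hp'⟩ hpp
    simpa using hpp
  conv_lhs => rw [hdeg]
  rw [gen_equiv f, gen_sum _ _ (fun m => inferInstance) hfin, gen_zero_unit,
    gen_prod w _ hw hl]

/-- The binomial theorem. -/
theorem gen_finset (n : ℕ) (t : σ →₀ ℕ) :
    gen (fun s : Finset (Fin n) => s.card • t) = (1 + MvPowerSeries.monomial t 1) ^ n := by
  have := Fintype.sum_pow_mul_eq_add_pow (Fin n) (MvPowerSeries.monomial t (1 : ℤ)) 1
  rw [Fintype.card_fin, add_comm] at this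
  rw [← this, gen_fintype]
  refine Finset.sum_congr rfl fun s _ => ?_
  rw [one_pow, mul_one, MvPowerSeries.monomial_pow, one_pow]

/-- The generating series of the products of a set of `n` elements of degree `t` and a word in
letters of degree `s + w i`. -/
theorem gen_mul_one_sub (n : ℕ) (t s : σ →₀ ℕ) (w : ι → σ →₀ ℕ) (hw : ∀ m, Finite {i // w i = m})
    (hl : ∀ m, Finite {l : List ι // (l.map fun i => s + w i).sum = m}) :
    gen (fun p : ULift (Finset (Fin n)) × List ι =>
        p.1.down.card • t + (p.2.map fun i => s + w i).sum) *
      (1 - MvPowerSeries.monomial s 1 * (gen (fun i : Option ι => i.elim 0 w) - 1)) =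
    (1 + MvPowerSeries.monomial t 1) ^ n := by
  have hw' : ∀ m, Finite {i // s + w i = m} := fun m => by
    refine Finite.of_injective (β := {i // w i = m - s})
      (fun i => ⟨i.1, eq_tsub_of_add_eq ((add_comm _ _).trans i.2)⟩) fun i i' hi => ?_
    simpa [Subtype.ext_iff] using hi
  have h1 := gen_list (fun i => s + w i) hw' hl
  rw [gen_prod (fun a : ULift (Finset (Fin n)) => a.down.card • t) _ (fun m => inferInstance) hl,
    show gen (fun a : ULift (Finset (Fin n)) => a.down.card • t) = _ from
      gen_equiv Equiv.ulift (fun a : Finset (Fin n) => a.card • t), gen_finset, gen_option w hw,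
    add_sub_cancel_right, ← gen_const_add w s hw]
  linear_combination (1 + MvPowerSeries.monomial t 1) ^ n * h1

end Generating

section Poincare

variable {ι : Type u} {h g : ι → ℕ}

/-- There are finitely many words of a given homological degree. -/
theorem finite_wordHom (hh : ∀ r, {i | h i = r}.Finite) (r : ℕ) :
    {l : List ι | wordHom h l = r}.Finite := by
  induction r using Nat.strong_induction_on with
  | _ r ih =>
    have hfin : (⋃ p ∈ Finset.range r, Set.image2 List.cons {i | h i = p}
        {l | wordHom h l = r - (p + 1)}).Finite :=
      (Finset.range r).finite_toSet.biUnion fun p hp =>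
        (hh p).image2 _ (ih _ (by have := Finset.mem_range.1 hp; omega))
    refine ((Set.finite_singleton []).union hfin).subset fun l hl => ?_
    rcases l with _ | ⟨i, l⟩
    · exact Or.inl rfl
    · have hl' : h i + 1 + wordHom h l = r := hl
      refine Or.inr (Set.mem_biUnion (x := h i) (Finset.mem_coe.2 (Finset.mem_range.2 (by omega)))
        ⟨i, rfl, l, ?_, rfl⟩)
      change wordHom h l = r - (h i + 1)
      omega

theorem biSeries_eq_gen {A : Type*} (p q : A → ℕ) :
    biSeries (fun r j => Nat.card {a | p a = r ∧ q a = j}) =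
      gen fun a => Finsupp.single (0 : Fin 2) (p a) + Finsupp.single 1 (q a) := by
  ext m
  rw [coeff_gen]
  refine congrArg Nat.cast (Nat.card_congr (Equiv.subtypeEquivRight fun a => ?_))
  rw [Finsupp.ext_iff, Fin.forall_fin_two]
  simp

theorem series_eq_gen {A : Type*} (p : A → ℕ) :
    series (fun r => Nat.card {a | p a = r}) =
      gen fun a => Finsupp.single () (p a) := by
  ext m
  rw [series, PowerSeries.coeff_mk]
  refine congrArg Nat.cast (Nat.card_congr (Equiv.subtypeEquivRight fun a => ?_))
  simp [Finsupp.ext_iff]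

/-- The count of the basis of `Y` in two variables, where `Option ι` stands for the basis of `H(K)`
consisting of the classes of `1` and the `z i`. -/
theorem biSeries_yBasis (hh : ∀ r, {i | h i = r}.Finite) (n : ℕ) :
    biSeries (fun r j => Nat.card
        {p : ULift.{u} (Finset (Fin n)) × List ι | yHom h p = r ∧ yInt g p = j}) *
      (1 - MvPowerSeries.X 0 * (biSeries (fun r j => Nat.card
        {i : Option ι | i.elim 0 h = r ∧ i.elim 0 g = j}) - 1)) =
    (1 + MvPowerSeries.X 0 * MvPowerSeries.X 1) ^ n := by
  have hword : ∀ l : List ι, (l.map fun i => Finsupp.single (0 : Fin 2) 1 +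
      (Finsupp.single 0 (h i) + Finsupp.single 1 (g i))).sum =
      Finsupp.single 0 (wordHom h l) + Finsupp.single 1 (wordInt g l) := by
    intro l
    induction l with
    | nil => simp [wordHom, wordInt]
    | cons i l ih =>
      rw [List.map_cons, List.sum_cons, ih]
      change _ = Finsupp.single 0 (h i + 1 + wordHom h l) + Finsupp.single 1 (g i + wordInt g l)
      simp only [Finsupp.single_add]
      abel
  have key := gen_mul_one_sub n (Finsupp.single 0 1 + Finsupp.single 1 1) (Finsupp.single 0 1)
    (fun i => Finsupp.single (0 : Fin 2) (h i) + Finsupp.single 1 (g i))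
    (fun m => ((hh (m 0)).subset (by rintro i rfl; simp)).to_subtype)
    (fun m => ((finite_wordHom hh (m 0)).subset
      (by rintro l rfl; rw [hword]; simp)).to_subtype)
  rw [biSeries_eq_gen, biSeries_eq_gen, MvPowerSeries.X, MvPowerSeries.X,
    MvPowerSeries.monomial_mul_monomial, one_mul, ← key]
  congr 2
  · funext p
    rw [hword, yHom, yInt]
    simp only [Finsupp.single_add, smul_add, Finsupp.smul_single, smul_eq_mul, mul_one]
    abel
  · congr 4
    funext i
    rcases i with _ | i
    · simp
    · rfl

/-- The count of the basis of `Y` in one variable. -/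
theorem series_yBasis (hh : ∀ r, {i | h i = r}.Finite) (n : ℕ) :
    series (fun r => Nat.card
        {p : ULift.{u} (Finset (Fin n)) × List ι | yHom h p = r}) *
      (1 - PowerSeries.X * (series (fun r => Nat.card
        {i : Option ι | i.elim 0 h = r}) - 1)) =
    (1 + PowerSeries.X) ^ n := by
  have hword : ∀ l : List ι, (l.map fun i => Finsupp.single () 1 +
      Finsupp.single () (h i)).sum = Finsupp.single () (wordHom h l) := by
    intro l
    induction l with
    | nil => simp [wordHom]
    | cons i l ih =>
      rw [List.map_cons, List.sum_cons, ih]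
      change _ = Finsupp.single () (h i + 1 + wordHom h l)
      simp only [Finsupp.single_add]
      abel
  have key := gen_mul_one_sub n (Finsupp.single () 1) (Finsupp.single () 1)
    (fun i => Finsupp.single () (h i))
    (fun m => ((hh (m ())).subset (by rintro i rfl; simp)).to_subtype)
    (fun m => ((finite_wordHom hh (m ())).subset
      (by rintro l rfl; rw [hword]; simp)).to_subtype)
  rw [series_eq_gen, series_eq_gen]
  refine Eq.trans ?_ key
  congr 2
  · funext p
    rw [hword, yHom]
    simp only [Finsupp.single_add, Finsupp.smul_single, smul_eq_mul, mul_one]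
  · congr 4
    funext i
    rcases i with _ | i
    · simp
    · rfl

end Poincare

end Golod

end

theorem mainTheorem1 {k R : Type u} [Field k] [CommRing R] [Algebra k R]
    (𝒜 : ℕ → Submodule k R) [GradedAlgebra 𝒜] (hR : IsStandardGraded 𝒜)
    -- a basis of `R_1`
    (n : ℕ) (X : Module.Basis (Fin n) k (𝒜 1)) (x : Fin n → R) (hx : ∀ i, x i = X i)
    -- bihomogeneous cycles in `K_+` representing a basis of `H_+(K)`, with all products zero
    {ι : Type u} (z : ι → koszulZPlus x)
    (hz : ∀ i, ∃ r j, (z i : Koszul R n) ∈ koszulDeg 𝒜 n r j)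
    (b : Module.Basis ι k (HPlus x)) (hb : ∀ i, b i = cls x (z i))
    (hmul : ∀ i i', (z i : Koszul R n) * (z i' : Koszul R n) = 0) :
    -- `Y` is a minimal graded free resolution of `k` over `R`
    IsMinimalGradedFreeResolution 𝒜 (yDeg 𝒜 x)
      (dY x (b.constr k fun i => (z i : Koszul R n))) ∧
    -- the Poincaré series in one variable
    ((∀ r, Module.Finite k (TorKK 𝒜 r)) ∧ (∀ r, Module.Finite k (KoszulHomology k x r)) ∧
      series (fun r => Module.finrank k (TorKK 𝒜 r)) *
          (1 - PowerSeries.X * (series (fun r => Module.finrank k (KoszulHomology k x r)) - 1)) =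
        (1 + PowerSeries.X) ^ n) ∧
    -- the Poincaré series in two variables, `Tor_{r,j}` being computed from an arbitrary graded
    -- free resolution of `k` over `R`
    (∀ r j, Module.Finite k (KoszulBiHomology 𝒜 x r j)) ∧
    ∀ (M : Type u) [AddCommGroup M] [Module k M] [Module R M] [IsScalarTower k R M]
      (ℳ : ℕ → ℕ → Submodule k M) (d : M →ₗ[R] M), IsGradedFreeResolution 𝒜 ℳ d →
      (∀ r j, Module.Finite k (BiTor 𝒜 ℳ d r j)) ∧
      biSeries (fun r j => Module.finrank k (BiTor 𝒜 ℳ d r j)) *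
          (1 - MvPowerSeries.X 0 *
            (biSeries (fun r j => Module.finrank k (KoszulBiHomology 𝒜 x r j)) - 1)) =
        (1 + MvPowerSeries.X 0 * MvPowerSeries.X 1) ^ n := by
  have hx1 : ∀ i, x i ∈ 𝒜 1 := fun i => by rw [hx]; exact (X i).2
  have hxX : x = (𝒜 1).subtype ∘ X := funext hx
  have hxk : LinearIndependent k x := by
    rw [hxX]
    exact X.linearIndependent.map' _ (Submodule.ker_subtype _)
  have hspan : 𝒜 1 ≤ Submodule.span k (Set.range x) := by
    rw [hxX, Set.range_comp, Submodule.span_image, X.span_eq, Submodule.map_subtype_top]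
  choose h g hz using hz
  have hK := nonempty_koszulHomology_basis hR hx1 hspan hb hz
  have hBK := nonempty_koszulBiHomology_basis hR hx1 hspan hb hz
  have hTor := nonempty_tor_basis_yBasis hR hx1 hspan hxk hb hz hmul
  have hKfin := finite_koszulHomology (𝒜 := 𝒜) (x := x) hR hspan
  -- the Koszul homology is finite, so there are finitely many `z i` of each homological degree
  have hOfin : ∀ r, {i : Option ι | i.elim 0 h = r}.Finite := fun r => by
    obtain ⟨B⟩ := hK r
    have := hKfin r
    exact Set.finite_coe_iff.1 (Module.Finite.finite_basis B)
  have hfin : ∀ r, {i | h i = r}.Finite := fun r =>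
    (hOfin r).preimage (f := some) (Option.some_injective ι).injOn
  have hYfin : ∀ r, {p : ULift.{u} (Finset (Fin n)) × List ι | yHom h p = r}.Finite := fun r => by
    refine ((Set.finite_univ (α := ULift.{u} (Finset (Fin n)))).prod
      ((Finset.range (r + 1)).finite_toSet.biUnion fun s _ => finite_wordHom hfin s)).subset ?_
    rintro ⟨s, l⟩ hl
    refine ⟨Set.mem_univ _, Set.mem_biUnion (x := wordHom h l) ?_ rfl⟩
    change s.down.card + wordHom h l = r at hl
    exact Finset.mem_coe.2 (Finset.mem_range.2 (by omega))
  refine ⟨isMinimalGradedFreeResolution_dY hR hx1 hspan hxk hb hz hmul, ⟨fun r => ?_, hKfin, ?_⟩,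
    fun r j => ?_, fun M _ _ _ _ ℳ d hM => ⟨fun r j => ?_, ?_⟩⟩
  · obtain ⟨B⟩ := hTor r
    have := (hYfin r).to_subtype
    exact Module.Finite.of_basis B
  · have h1 : ∀ r, Module.finrank k (TorKK 𝒜 r) = _ := fun r =>
      Module.finrank_eq_nat_card_basis (hTor r).some
    have h2 : ∀ r, Module.finrank k (KoszulHomology k x r) = _ := fun r =>
      Module.finrank_eq_nat_card_basis (hK r).some
    simp only [h1, h2]
    exact series_yBasis hfin n
  · obtain ⟨B⟩ := hBK r j
    have := ((hOfin r).subset (t := {i : Option ι | i.elim 0 h = r ∧ i.elim 0 g = j})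
      fun i hi => hi.1).to_subtype
    exact Module.Finite.of_basis B
  · obtain ⟨B⟩ := nonempty_biTor_basis_yBasis hR hx1 hspan hxk hb hz hmul hM r j
    have := ((hYfin r).subset
      (t := {p : ULift.{u} (Finset (Fin n)) × List ι | yHom h p = r ∧ yInt g p = j})
      fun i hi => hi.1).to_subtype
    exact Module.Finite.of_basis B
  · have h1 : ∀ r j, Module.finrank k (BiTor 𝒜 ℳ d r j) = _ := fun r j =>
      Module.finrank_eq_nat_card_basis
        (nonempty_biTor_basis_yBasis hR hx1 hspan hxk hb hz hmul hM r j).some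
    have h2 : ∀ r j, Module.finrank k (KoszulBiHomology 𝒜 x r j) = _ := fun r j =>
      Module.finrank_eq_nat_card_basis (hBK r j).some
    simp only [h1, h2]
    exact biSeries_yBasis hfin n
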